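/- **Setting.** Let $T>0$, let $\mathbb S^m$ be the symmetric $m\times m$ matrices, and let $A:[0,T]\times\mathbb R^n\to\mathbb R^n$, $B:[0,T]\times\mathbb R^n\to\mathbb R^{n\times m}$, $Q:[0,T]\times\mathbb R^n\to\mathbb R$, $S:[0,T]\times\mathbb R^n\to\mathbb R^m$, $R:[0,T]\times\mathbb R^n\to\mathbb S^m$, $G:\mathbb R^n\to\mathbb R$. Matrix norms are operator norms for the Euclidean norm. Assume: (H1) $A,B$ are continuous and there are $L_A,L_B,\tilde L_B>0$ with $|A(s,x)-A(s,\bar x)|\le L_A|x-\bar x|$, $|B(s,x)-B(s,\bar x)|\le\tilde L_B|x-\bar x|$ and $\langle[B(s,x)-B(s,\bar x)]^T(x-\bar x),u\rangle\le L_B|x-\bar x|^2$ for all $s\in[0,T]$, $u\in\mathbb R^m$, $x,\bar x\in\mathbb R^n$. (H2) $Q,S,R,G$ are continuous, and there are $L,Q_0,G_0,S_0,\rho_0>0$, $\varepsilon_0\in(0,1)$ and a continuous $\rho:\mathbb R^n\to[\rho_0,\infty)$ such that for all $(s,x)\in[0,T]\times\mathbb R^n$ (arguments $(s,x)$ omitted):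 $R\ge\rho(x)I$; $(1-\varepsilon_0)Q-\frac12S^TR^{-1}S\ge-L$; $G(x)\ge-L$; $Q\le Q_0(1+|x|^2)$; $G(x)\le G_0(1+|x|^2)$; $|S|\le S_0(1+|x|)$; $|A+BR^{-1}S|\le L(1+|x|)$; $|BR^{-1}B^T|\le L$. (H3) $A,B,Q,S,R$ are twice continuously differentiable on $[0,T]\times\mathbb R^n$, and $G$ is twice continuously differentiable on $\mathbb R^n$. Fix $t\in[0,T]$, $x\in\mathbb R^n$ and $u\in\mathcal U:=L^2(t,T;\mathbb R^m)$. For a control $u$ let $X=X(\cdot;t,x,u)$ be the (absolutely continuous) solution on $[t,T]$ of $$\dot X(s)=A(s,X(s))+B(s,X(s))u(s),\qquad X(t)=x,$$ and let $$J(t,x;u)=\int_t^T\Big[Q(s,X(s))+\langle S(s,X(s)),u(s)\rangle+\tfrac12\langle R(s,X(s))u(s),u(s)\rangle\Big]ds+G(X(T)).$$ $D_uJ(t,x;u)\in\mathcal U$ denotes the gradient of $J(t,x;\cdot)$ on the Hilbert space $\mathcal U$ at $u$ (for the Fréchet derivative), and $D_{uu}J(t,x;u):\mathcal U\to\mathcal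 U$ the Fréchet derivative of $D_uJ(t,x;\cdot)$ at $u$. Write $B^j$ for the $j$-th column of $B$, $\tilde B^i$ for the $i$-th column of $B^T$, $R^j$ for the $j$-th column of $R$. With all coefficients and their derivatives in the state evaluated at $(s,X(s))$, put $$\mathbf A(s)=A_x+\sum_j u^j(s)B^j_x,$$ let $Y$ be the solution on $[t,T]$ of $$\dot Y(s)=-\mathbf A(s)^TY(s)-Q_x^T-S_x^Tu(s)-\tfrac12\sum_{j,k}u^j(s)u^k(s)(R^{jk}_x)^T,\qquad Y(T)=G_x(X(T))^T,$$ and put $$\mathbf A_1(s)=\sum_iY^i(s)A^i_{xx}+Q_{xx}+\tfrac12\sum_{j,k}u^j(s)u^k(s)R^{jk}_{xx}+\sum_ju^j(s)\Big[\sum_iY^i(s)B^{ij}_{xx}+S^j_{xx}\Big],$$ $$\mathbf C(s)=\sum_ju^j(s)R^j_x+S_x+\sum_iY^i(s)\tilde B^i_x.$$ Let $\Phi(s,\tau)$, $t\le\tau\le s\le T$, be the fundamental matrix of $\mathbf A$: $\frac{d}{ds}\Phi(s,\tau)=\mathbf A(s)\Phi(s,\tau)$ on $[\tau,T]$, $\Phi(\tau,\tau)=I$.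 For $s,r\in[t,T]$ let $$\begin{aligned}\mathbf F(s,r)={}&B(s,X(s))^T\Phi(T,s)^TG_{xx}(X(T))\Phi(T,r)B(r,X(r))\\&+\int_{s\vee r}^TB(s,X(s))^T\Phi(q,s)^T\mathbf A_1(q)\Phi(q,r)B(r,X(r))\,dq\\&+\mathbf C(s)\Phi(s,r)B(r,X(r))I_{[t,s]}(r)+B(s,X(s))^T\Phi(r,s)^T\mathbf C(r)^TI_{[s,T]}(r).\end{aligned}$$ **Proposition 5.1.** Under (H1)–(H3), $X$, $Y$ and $\Phi$ exist, $J(t,x;\cdot)$ is Fréchet differentiable on $\mathcal U$ and its gradient is Fréchet differentiable at $u$. For these $X,Y,\Phi$, the operator $D_{uu}J(t,x;u)$ has a bounded inverse on $\mathcal U$ if and only if the second kind Fredholm integral equation $$w(s)=R(s,X(s))v(s)+\int_t^T\mathbf F(s,r)v(r)\,dr,\qquad\text{a.e. }s\in[t,T],$$ is well-posed, that is, for every $w\in\mathcal U$ it has exactly one solution $v\in\mathcal U$, and $v$ depends continuously on $w$ in $\mathcal U$. Both hold if, for some $\alpha<\frac1T$, $$|R(s,X(s))^{-1}\mathbf F(s,r)|\le\alpha\qquad\text{for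 almost every }s\in[t,T]\text{ and almost every }r\in[t,T].$$ -/

import Mathlib

open MeasureTheory Set
open scoped InnerProduct

/-- Euclidean space of dimension `k`, with the Euclidean norm. -/
abbrev Euc (k : ℕ) : Type := EuclideanSpace ℝ (Fin k)

/-- The Hilbert space `L²(t, T; ℝᵐ)` of admissible controls on `[t, T]` (control set `U = ℝᵐ`). -/
abbrev Control (m : ℕ) (t T : ℝ) : Type :=
  Lp (Euc m) 2 ((volume : Measure ℝ).restrict (Icc t T))

/-- The Hessian of a real function on a real Hilbert space: the Fréchet derivative of its gradient
(the gradient being the Riesz representative of the Fréchet derivative). -/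
noncomputable def hess {H : Type*} [NormedAddCommGroup H] [InnerProductSpace ℝ H] [CompleteSpace H]
    (f : H → ℝ) (x : H) : H →L[ℝ] H :=
  fderiv ℝ (gradient f) x

/-- `Z` is the (absolutely continuous) solution on `[a, b]` of `Z' = f(s, Z)` with value `z` at the
point `c ∈ [a, b]`, in integrated form. -/
structure SolvesODE {E : Type*} [NormedAddCommGroup E] [NormedSpace ℝ E]
    (f : ℝ → E → E) (a b c : ℝ) (z : E) (Z : ℝ → E) : Prop where
  continuousOn : ContinuousOn Z (Icc a b)
  integrable : IntervalIntegrable (fun r => f r (Z r)) volume a b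
  eq_integral : ∀ s ∈ Icc a b, Z s = z + ∫ r in c..s, f r (Z r)

/-- The data of an affine-quadratic control problem with state space `ℝⁿ` and control space `ℝᵐ`
on the time horizon `[0, T]`. Matrices are written as linear maps between Euclidean spaces.
Only the values at times in `[0, T]` are used. -/
structure AQProblem (n m : ℕ) where
  T : ℝ
  A : ℝ → Euc n → Euc n
  B : ℝ → Euc n → (Euc m →L[ℝ] Euc n)
  Q : ℝ → Euc n → ℝ
  S : ℝ → Euc n → Euc m
  R : ℝ → Euc n → (Euc m →L[ℝ] Euc m)
  G : Euc n → ℝ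

namespace AQProblem

variable {n m : ℕ} (P : AQProblem n m)

/-- The domain `[0, T] × ℝⁿ`. -/
def dom : Set (ℝ × Euc n) := Icc 0 P.T ×ˢ univ

/-- Standing assumption on the dynamics, for the control set `U = ℝᵐ`. -/
structure H1 : Prop where
  contA : ContinuousOn (Function.uncurry P.A) P.dom
  contB : ContinuousOn (Function.uncurry P.B) P.dom
  lipA : ∃ LA > 0, ∀ s ∈ Icc 0 P.T, ∀ x y, ‖P.A s x - P.A s y‖ ≤ LA * ‖x - y‖
  lipB : ∃ LB' > 0, ∀ s ∈ Icc 0 P.T, ∀ x y, ‖P.B s x - P.B s y‖ ≤ LB' * ‖x - y‖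
  monoB : ∃ LB > 0, ∀ s ∈ Icc 0 P.T, ∀ (u : Euc m) (x y : Euc n),
    inner ℝ (((P.B s x - P.B s y)†) (x - y)) u ≤ LB * ‖x - y‖ ^ 2

/-- Standing assumption on the cost coefficients (operator norms, `R⁻¹` being a true inverse by
the lower bound on `R`). -/
structure H2 : Prop where
  contQ : ContinuousOn (Function.uncurry P.Q) P.dom
  contS : ContinuousOn (Function.uncurry P.S) P.dom
  contR : ContinuousOn (Function.uncurry P.R) P.dom
  contG : Continuous P.G
  symmR : ∀ s ∈ Icc 0 P.T, ∀ x, IsSelfAdjoint (P.R s x)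
  bounds : ∃ L > 0, ∃ Q₀ > 0, ∃ G₀ > 0, ∃ S₀ > 0, ∃ ε₀ ∈ Ioo (0 : ℝ) 1, ∃ ρ₀ > 0,
    ∃ ρ : Euc n → ℝ, Continuous ρ ∧ (∀ x, ρ₀ ≤ ρ x) ∧
    ∀ s ∈ Icc 0 P.T, ∀ x,
      (∀ u : Euc m, ρ x * ‖u‖ ^ 2 ≤ inner ℝ (P.R s x u) u) ∧
      -L ≤ (1 - ε₀) * P.Q s x - 1 / 2 * inner ℝ ((P.R s x).inverse (P.S s x)) (P.S s x) ∧
      -L ≤ P.G x ∧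
      P.Q s x ≤ Q₀ * (1 + ‖x‖ ^ 2) ∧
      P.G x ≤ G₀ * (1 + ‖x‖ ^ 2) ∧
      ‖P.S s x‖ ≤ S₀ * (1 + ‖x‖) ∧
      ‖P.A s x + P.B s x ((P.R s x).inverse (P.S s x))‖ ≤ L * (1 + ‖x‖) ∧
      ‖P.B s x ∘L (P.R s x).inverse ∘L (P.B s x)†‖ ≤ L

/-- Smoothness assumption: all coefficients are twice continuously differentiable, jointly in time and
state, up to the end points of `[0, T]`. -/
structure H3 : Prop where
  smoothA : ContDiffOn ℝ 2 (Function.uncurry P.A) P.dom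
  smoothB : ContDiffOn ℝ 2 (Function.uncurry P.B) P.dom
  smoothQ : ContDiffOn ℝ 2 (Function.uncurry P.Q) P.dom
  smoothS : ContDiffOn ℝ 2 (Function.uncurry P.S) P.dom
  smoothR : ContDiffOn ℝ 2 (Function.uncurry P.R) P.dom
  smoothG : ContDiff ℝ 2 P.G

/-- `X` is the state trajectory: `X' = A(s, X) + B(s, X) u(s)` on `[t, T]`, `X(t) = x`. -/
def IsState (t : ℝ) (x : Euc n) (u : Control m t P.T) (X : ℝ → Euc n) : Prop :=
  SolvesODE (fun s z => P.A s z + P.B s z (u s)) t P.T t x X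

/-- The state trajectory `X(· ; t, x, u)` (chosen; it is unique on `[t, T]`). -/
noncomputable def state (t : ℝ) (x : Euc n) (u : Control m t P.T) : ℝ → Euc n :=
  Classical.epsilon (P.IsState t x u)

/-- The cost functional `J(t, x; u)`. -/
noncomputable def cost (t : ℝ) (x : Euc n) (u : Control m t P.T) : ℝ :=
  (∫ s in t..P.T,
    (P.Q s (P.state t x u s) + inner ℝ (P.S s (P.state t x u s)) (u s)
      + 1 / 2 * inner ℝ (P.R s (P.state t x u s) (u s)) (u s)))
    + P.G (P.state t x u P.T)

/-- `𝐀(s) = A_x(s, X(s)) + ∑ⱼ uʲ(s) Bʲ_x(s, X(s))`; the sum is the derivative at `X(s)` of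
`y ↦ B(s, y) u(s)`. -/
noncomputable def bA (u : ℝ → Euc m) (X : ℝ → Euc n) (s : ℝ) : Euc n →L[ℝ] Euc n :=
  fderiv ℝ (P.A s) (X s) + fderiv ℝ (fun y => P.B s y (u s)) (X s)

/-- `Y` is the adjoint trajectory along `(X, u)`: on `[t, T]`,
`Y' = - 𝐀(s)ᵀ Y - Q_xᵀ - S_xᵀ u - ½ ∑ uʲ uᵏ (R_xʲᵏ)ᵀ` and `Y(T) = G_x(X(T))ᵀ`. -/
def IsAdjointState (t : ℝ) (u : Control m t P.T) (X Y : ℝ → Euc n) : Prop :=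
  SolvesODE
    (fun s p => -(((P.bA u X s)†) p) - gradient (P.Q s) (X s)
      - ((fderiv ℝ (P.S s) (X s))†) (u s)
      - (1 / 2 : ℝ) • gradient (fun y => inner ℝ (P.R s y (u s)) (u s)) (X s))
    t P.T P.T (gradient P.G (X P.T)) Y

/-- `𝐀₁(s) = ∑ᵢ Yⁱ Aⁱ_xx + Q_xx + ½ ∑ uʲ uᵏ Rʲᵏ_xx + ∑ⱼ uʲ [∑ᵢ Yⁱ Bⁱʲ_xx + Sʲ_xx]` at `(s, X(s))`,
each sum being the Hessian of the corresponding contracted scalar function of the state. -/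
noncomputable def bA₁ (u : ℝ → Euc m) (X Y : ℝ → Euc n) (s : ℝ) : Euc n →L[ℝ] Euc n :=
  hess (fun y => inner ℝ (Y s) (P.A s y)) (X s)
    + hess (P.Q s) (X s)
    + (1 / 2 : ℝ) • hess (fun y => inner ℝ (P.R s y (u s)) (u s)) (X s)
    + hess (fun y => inner ℝ (Y s) (P.B s y (u s))) (X s)
    + hess (fun y => inner ℝ (P.S s y) (u s)) (X s)

/-- `𝐂(s) = ∑ⱼ uʲ Rʲ_x + S_x + ∑ᵢ Yⁱ B̃ⁱ_x` at `(s, X(s))`, where `Rʲ` are the columns of `R` and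
`B̃ⁱ` the columns of `Bᵀ`. -/
noncomputable def bC (u : ℝ → Euc m) (X Y : ℝ → Euc n) (s : ℝ) : Euc n →L[ℝ] Euc m :=
  fderiv ℝ (fun y => P.R s y (u s)) (X s)
    + fderiv ℝ (P.S s) (X s)
    + fderiv ℝ (fun y => ((P.B s y)†) (Y s)) (X s)

/-- `Φ(s, τ)`, `t ≤ τ ≤ s ≤ T`, is the fundamental matrix of `𝐀`:
`d/ds Φ(s, τ) = 𝐀(s) Φ(s, τ)` on `[τ, T]`, `Φ(τ, τ) = I`. -/
def IsFundamental (t : ℝ) (u : Control m t P.T) (X : ℝ → Euc n)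
    (Φ : ℝ → ℝ → (Euc n →L[ℝ] Euc n)) : Prop :=
  ∀ τ ∈ Icc t P.T,
    SolvesODE (fun s M => P.bA u X s ∘L M) τ P.T τ (ContinuousLinearMap.id ℝ (Euc n))
      (fun s => Φ s τ)

/-- The kernel `𝐅(s, r)`. -/
noncomputable def bF (t : ℝ) (u : Control m t P.T) (X Y : ℝ → Euc n)
    (Φ : ℝ → ℝ → (Euc n →L[ℝ] Euc n)) (s r : ℝ) : Euc m →L[ℝ] Euc m :=
  (P.B s (X s))† ∘L (Φ P.T s)† ∘L hess P.G (X P.T) ∘L Φ P.T r ∘L P.B r (X r)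
    + (∫ q in (max s r)..P.T,
        (P.B s (X s))† ∘L (Φ q s)† ∘L P.bA₁ u X Y q ∘L Φ q r ∘L P.B r (X r))
    + (Icc t s).indicator (fun r' => P.bC u X Y s ∘L Φ s r' ∘L P.B r' (X r')) r
    + (Icc s P.T).indicator (fun r' => (P.B s (X s))† ∘L (Φ r' s)† ∘L (P.bC u X Y r')†) r

/-- `v` solves the second kind Fredholm equation
`w(s) = R(s, X(s)) v(s) + ∫_t^T 𝐅(s, r) v(r) dr` for almost every `s ∈ [t, T]`. -/
def SolvesFredholm (t : ℝ) (u : Control m t P.T) (X Y : ℝ → Euc n)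
    (Φ : ℝ → ℝ → (Euc n →L[ℝ] Euc n)) (w v : Control m t P.T) : Prop :=
  ∀ᵐ s ∂((volume : Measure ℝ).restrict (Icc t P.T)),
    IntervalIntegrable (fun r => P.bF t u X Y Φ s r (v r)) volume t P.T ∧
    w s = P.R s (X s) (v s) + ∫ r in t..P.T, P.bF t u X Y Φ s r (v r)

/-- Well-posedness (in the sense of Hadamard) of the Fredholm equation: for every right-hand side
there is exactly one solution in `L²`, and it depends continuously on the right-hand side. -/
def FredholmWellPosed (t : ℝ) (u : Control m t P.T) (X Y : ℝ → Euc n)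
    (Φ : ℝ → ℝ → (Euc n →L[ℝ] Euc n)) : Prop :=
  ∃ sol : Control m t P.T → Control m t P.T, Continuous sol ∧
    ∀ w v, P.SolvesFredholm t u X Y Φ w v ↔ v = sol w

end AQProblem

/-! The Hessian of the cost is shown to be the Fredholm operator itself, `v ↦ R v + ∫ 𝐅(·, r) v(r)
dr`. Bijectivity, bounded invertibility and well-posedness then coincide by the open mapping
theorem, and the smallness condition gives bijectivity by a Neumann series.

Smoothness. A trajectory is a zero of `stateDefect`, that is `(u, X) ↦ X - x - ∫ (A(X) + B(X) u)` on
`L² × C([t, T])`. Superposition with a `C²` coefficient is a `C²` map on continuous functions,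
because `[t, T]` is compact. The control enters linearly through the bounded pairing `C × L² → L²`,
so this map is `C²` as well. Its partial derivative in `X` is the identity minus a linear Volterra
operator with square integrable coefficient, hence invertible (`bijective_linearised_state`). The
implicit function theorem makes the control-to-state map `Z` of class `C²` (`contDiff_solution`),
and the cost, a Bolza functional of `(u, Z u)`, inherits this.

Second derivative. Along every trajectory the cost differs by a constant from a Lagrangian, the
Bolza functional with Hamiltonian coefficients plus a linear term in `X`. The adjoint state `Y` is
chosen so that this Lagrangian is stationary in `X` at `(u, Z u)`. The second derivative of `Z`
therefore drops out, and the Hessian form is the second derivative of the Lagrangian on the pairs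
`(v, Z'(u) v)` (`inner_hess_bolza`). A second costate `l`, solving the linearised adjoint equation
driven by `(v, ζ)` with `ζ = Z'(u) v`, removes the other linearised state by integration by parts.
The result is the representative `R v + 𝐂 ζ + B† l` (`hess_bolza_ae_eq`).

Kernel. With `Ψ = Φ(·, t)` and its inverse `Ξ`, one has `Φ(s, τ) = Ψ(s) Ξ(τ)`. Variation of
constants expresses `ζ` and `l` by `v`, and integrating the kernel over `[t, s]` and `[s, T]`
separately gives `∫ 𝐅(s, r) v(r) dr = 𝐂 ζ + B† l` (`FundamentalPair.fredholmKernel_integral`). -/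

set_option linter.unusedSectionVars false

/-! ### Fixed points of Volterra type maps -/

section Volterra

variable {E : Type*} [NormedAddCommGroup E] {a b : ℝ}

/-- Iterating the Volterra inequality gains a factorial. Distances are squared because the Lipschitz
bound of the controlled dynamics is only `L²` in time: Cauchy–Schwarz then moves it into the
constant `M`. -/
theorem norm_iterate_sub_sq_le_of_volterra (hab : a ≤ b) (c : Icc a b)
    (Γ : C(Icc a b, E) → C(Icc a b, E)) {M : ℝ} (hM : 0 ≤ M)
    (hΓ : ∀ X Y s, ‖Γ X s - Γ Y s‖ ^ 2 ≤
      M * ∫ r in uIoc (c : ℝ) s, ‖X (projIcc a b hab r) - Y (projIcc a b hab r)‖ ^ 2)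
    (X Y : C(Icc a b, E)) (k : ℕ) (s : Icc a b) :
    ‖Γ^[k] X s - Γ^[k] Y s‖ ^ 2 ≤ (M * |(s : ℝ) - c|) ^ k / k.factorial * dist X Y ^ 2 := by
  induction k generalizing s with
  | zero =>
    simp only [Function.iterate_zero, id_eq, pow_zero, Nat.factorial_zero, Nat.cast_one, div_one,
      one_mul]
    rw [← dist_eq_norm]
    gcongr
    exact ContinuousMap.dist_apply_le_dist s
  | succ k ih =>
    rw [Function.iterate_succ_apply', Function.iterate_succ_apply']
    refine (hΓ _ _ s).trans ?_
    have h1 : ∫ r in uIoc (c : ℝ) s,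
        ‖(Γ^[k] X) (projIcc a b hab r) - (Γ^[k] Y) (projIcc a b hab r)‖ ^ 2 ≤
        ∫ r in uIoc (c : ℝ) s, M ^ k / k.factorial * dist X Y ^ 2 * |r - c| ^ k := by
      apply setIntegral_mono_on
      · apply Continuous.integrableOn_uIoc
        fun_prop
      · apply Continuous.integrableOn_uIoc
        fun_prop
      · exact measurableSet_uIoc
      · intro r hr
        have hr' : r ∈ Icc a b := uIcc_subset_Icc c.2 s.2 (uIoc_subset_uIcc hr)
        refine (ih _).trans (le_of_eq ?_)
        rw [projIcc_of_mem hab hr', mul_pow]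
        ring
    refine (mul_le_mul_of_nonneg_left h1 hM).trans (le_of_eq ?_)
    -- The integral of `|r - c|^k` is `|s - c|^(k+1) / (k+1)`, which turns `k!` into `(k+1)!`.
    rw [integral_const_mul, integral_pow_abs_sub_uIoc, Nat.factorial_succ]
    push_cast
    rw [mul_pow]
    field_simp
    ring

/-- Some iterate is a contraction, whatever the length of the interval. Its fixed point is fixed by
`Γ`, and every fixed point of `Γ` is fixed by the iterate. -/
theorem existsUnique_fixedPoint_of_volterra [CompleteSpace E] (hab : a ≤ b) (c : Icc a b)
    (Γ : C(Icc a b, E) → C(Icc a b, E)) {M : ℝ} (hM : 0 ≤ M)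
    (hΓ : ∀ X Y s, ‖Γ X s - Γ Y s‖ ^ 2 ≤
      M * ∫ r in uIoc (c : ℝ) s, ‖X (projIcc a b hab r) - Y (projIcc a b hab r)‖ ^ 2) :
    ∃! X, Γ X = X := by
  obtain ⟨k, hk⟩ := (FloorSemiring.tendsto_pow_div_factorial_atTop (M * (b - a))).eventually
    (gt_mem_nhds (zero_lt_one)) |>.exists
  have hba : 0 ≤ b - a := sub_nonneg.2 hab
  set K : ℝ := (M * (b - a)) ^ k / k.factorial with hK
  have hK0 : 0 ≤ K := by positivity
  -- The estimate controls squared distances by `K < 1`, so the contraction constant is `√K`.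
  have hcontr : ContractingWith (√K).toNNReal (Γ^[k]) := by
    refine ⟨?_, LipschitzWith.of_dist_le_mul fun X Y => ?_⟩
    · rw [Real.toNNReal_lt_one, Real.sqrt_lt' one_pos]
      simpa using hk
    · rw [Real.coe_toNNReal _ (Real.sqrt_nonneg _)]
      rw [ContinuousMap.dist_le (by positivity)]
      intro s
      rw [dist_eq_norm]
      refine abs_le_of_sq_le_sq' ?_ (by positivity) |>.2
      refine (norm_iterate_sub_sq_le_of_volterra hab c Γ hM hΓ X Y k s).trans ?_
      rw [mul_pow √K, Real.sq_sqrt hK0]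
      rw [hK]
      gcongr
      rw [abs_le]
      constructor <;> linarith [s.2.1, s.2.2, c.2.1, c.2.2]
  refine ⟨_, hcontr.isFixedPt_fixedPoint_iterate, fun Y hY => ?_⟩
  exact hcontr.fixedPoint_unique (Function.IsFixedPt.iterate hY k)

end Volterra

theorem setIntegral_mul_sq_le {f g : ℝ → ℝ} {μ : Measure ℝ}
    (hf : MemLp f 2 μ) (hg : MemLp g 2 μ) :
    (∫ r, f r * g r ∂μ) ^ 2 ≤ (∫ r, f r ^ 2 ∂μ) * ∫ r, g r ^ 2 ∂μ := by
  have h := real_inner_mul_inner_self_le (hf.toLp f) (hg.toLp g)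
  have e : ∀ {f g : ℝ → ℝ} (hf : MemLp f 2 μ) (hg : MemLp g 2 μ),
      inner ℝ (hf.toLp f) (hg.toLp g) = ∫ r, f r * g r ∂μ := by
    intro f g hf hg
    rw [L2.inner_def]
    apply integral_congr_ae
    filter_upwards [hf.coeFn_toLp, hg.coeFn_toLp] with r h1 h2
    rw [h1, h2]
    simp [mul_comm]
  rw [e, e, e] at h
  simpa [sq] using h

/-! ### Carathéodory differential equations with an `L²` Lipschitz bound -/

section ODE

variable {E : Type*} [NormedAddCommGroup E] [NormedSpace ℝ E] {a b c : ℝ} {f : ℝ → E → E}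

/-- Carathéodory vector fields on `[a, b]` with a square integrable Lipschitz bound. -/
structure LipschitzField (f : ℝ → E → E) (a b : ℝ) (ℓ : ℝ → ℝ) : Prop where
  memLp : MemLp ℓ 2 (volume.restrict (Icc a b))
  lip : ∀ r ∈ Icc a b, ∀ z z', ‖f r z - f r z'‖ ≤ ℓ r * ‖z - z'‖
  integrable : ∀ Z : ℝ → E, ContinuousOn Z (Icc a b) →
    IntervalIntegrable (fun r => f r (Z r)) volume a b

theorem continuousOn_integral_of_mem {g : ℝ → E} (hc : c ∈ Icc a b)
    (hg : IntervalIntegrable g volume a b) :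
    ContinuousOn (fun s => ∫ r in c..s, g r) (Icc a b) := by
  have hab : a ≤ b := hc.1.trans hc.2
  have := intervalIntegral.continuousOn_primitive_interval' (b₁ := a) (b₂ := b) (a := c) hg
    (by rwa [uIcc_of_le hab])
  rwa [uIcc_of_le hab] at this

/-- The Picard operator of a vector field. -/
noncomputable def picardMap (hab : a ≤ b) (hc : c ∈ Icc a b) {ℓ : ℝ → ℝ}
    (hf : LipschitzField f a b ℓ) (z : E) (X : C(Icc a b, E)) : C(Icc a b, E) where
  toFun s := z + ∫ r in c..s, f r (X (projIcc a b hab r))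
  continuous_toFun := by
    have h := continuousOn_integral_of_mem hc (hf.integrable
      (fun r => X (projIcc a b hab r)) (by fun_prop))
    exact continuous_const.add (continuousOn_iff_continuous_domRestrict.1 h)

/-- Cauchy–Schwarz separates the Lipschitz bound `ℓ` from the distance of the two curves. The first
factor is then enlarged to all of `[a, b]`, so that the constant does not depend on `s`. -/
theorem volterra_picardMap (hab : a ≤ b) (hc : c ∈ Icc a b) {ℓ : ℝ → ℝ}
    (hf : LipschitzField f a b ℓ) (z : E) (X Y : C(Icc a b, E)) (s : Icc a b) :
    ‖picardMap hab hc hf z X s - picardMap hab hc hf z Y s‖ ^ 2 ≤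
      (∫ r in Icc a b, ℓ r ^ 2) *
        ∫ r in uIoc c s, ‖X (projIcc a b hab r) - Y (projIcc a b hab r)‖ ^ 2 := by
  have hsub : uIoc c s ⊆ Icc a b := uIoc_subset_uIcc.trans (uIcc_subset_Icc hc s.2)
  have hle : volume.restrict (uIoc c s) ≤ volume.restrict (Icc a b) :=
    Measure.restrict_mono hsub le_rfl
  have hi : ∀ X : C(Icc a b, E),
      IntervalIntegrable (fun r => f r (X (projIcc a b hab r))) volume c s := fun X =>
    (hf.integrable (fun r => X (projIcc a b hab r)) (by fun_prop)).mono_set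
      (by rw [uIcc_of_le hab]; exact uIcc_subset_Icc hc s.2)
  have hD : MemLp (fun r => ‖X (projIcc a b hab r) - Y (projIcc a b hab r)‖) 2
      (volume.restrict (uIoc c s)) := by
    have hcont : Continuous fun r => ‖X (projIcc a b hab r) - Y (projIcc a b hab r)‖ := by fun_prop
    have : IsFiniteMeasure (volume.restrict (uIoc c s)) :=
      ⟨by rw [Measure.restrict_apply_univ]; exact (measure_mono hsub).trans_lt measure_Icc_lt_top⟩
    refine MemLp.of_bound hcont.aestronglyMeasurable ‖X - Y‖ (.of_forall fun r => ?_)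
    rw [norm_norm]
    exact (X - Y).norm_coe_le_norm _
  have hl := hf.memLp.mono_measure hle
  have h1 : ‖picardMap hab hc hf z X s - picardMap hab hc hf z Y s‖ ≤
      ∫ r in uIoc c s, ℓ r * ‖X (projIcc a b hab r) - Y (projIcc a b hab r)‖ := by
    simp only [picardMap, ContinuousMap.coe_mk, add_sub_add_left_eq_sub]
    rw [← intervalIntegral.integral_sub (hi X) (hi Y)]
    rw [intervalIntegral.norm_intervalIntegral_eq]
    apply norm_integral_le_of_norm_le
    · exact hl.integrable_mul hD
    · filter_upwards [ae_restrict_mem measurableSet_uIoc] with r hr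
      exact hf.lip r (hsub hr) _ _
  calc _ ≤ (∫ r in uIoc c s, ℓ r * ‖X (projIcc a b hab r) - Y (projIcc a b hab r)‖) ^ 2 := by
        gcongr
    _ ≤ _ := setIntegral_mul_sq_le hl hD
    _ ≤ _ := by
        gcongr
        · exact .of_forall fun r => sq_nonneg _
        · exact hf.memLp.integrable_sq

theorem SolvesODE.domRestrict_isFixedPt (hab : a ≤ b) (hc : c ∈ Icc a b) {ℓ : ℝ → ℝ}
    (hf : LipschitzField f a b ℓ) {z : E} {Z : ℝ → E} (hZ : SolvesODE f a b c z Z) :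
    picardMap hab hc hf z ⟨_, hZ.continuousOn.domRestrict⟩ = ⟨_, hZ.continuousOn.domRestrict⟩ := by
  ext s
  simp only [picardMap, ContinuousMap.coe_mk, domRestrict_apply]
  rw [hZ.eq_integral s s.2]
  congr 1
  apply intervalIntegral.integral_congr
  intro r hr
  have hr' : r ∈ Icc a b := uIcc_subset_Icc hc s.2 hr
  simp only [projIcc_of_mem hab hr']

theorem solvesODE_of_isFixedPt (hab : a ≤ b) (hc : c ∈ Icc a b) {ℓ : ℝ → ℝ}
    (hf : LipschitzField f a b ℓ) {z : E} {X : C(Icc a b, E)}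
    (hX : picardMap hab hc hf z X = X) :
    SolvesODE f a b c z (fun r => X (projIcc a b hab r)) where
  continuousOn := by fun_prop
  integrable := hf.integrable _ (by fun_prop)
  eq_integral s hs := by
    have := DFunLike.congr_fun hX ⟨s, hs⟩
    simp only [projIcc_of_mem hab hs]
    exact this.symm

variable [CompleteSpace E]

theorem existsUnique_picardMap (hab : a ≤ b) (hc : c ∈ Icc a b) {ℓ : ℝ → ℝ}
    (hf : LipschitzField f a b ℓ) (z : E) : ∃! X, picardMap hab hc hf z X = X :=
  existsUnique_fixedPoint_of_volterra hab ⟨c, hc⟩ _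
    (integral_nonneg fun _ => sq_nonneg _) (volterra_picardMap hab hc hf z)

theorem LipschitzField.exists_solvesODE (hc : c ∈ Icc a b) {ℓ : ℝ → ℝ}
    (hf : LipschitzField f a b ℓ) (z : E) : ∃ Z, SolvesODE f a b c z Z :=
  have hab := hc.1.trans hc.2
  let ⟨_, hX, _⟩ := existsUnique_picardMap hab hc hf z
  ⟨_, solvesODE_of_isFixedPt hab hc hf hX⟩

theorem LipschitzField.eqOn_of_solvesODE (hc : c ∈ Icc a b) {ℓ : ℝ → ℝ}
    (hf : LipschitzField f a b ℓ) {z : E} {Z W : ℝ → E} (hZ : SolvesODE f a b c z Z)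
    (hW : SolvesODE f a b c z W) : EqOn Z W (Icc a b) := by
  have hab := hc.1.trans hc.2
  have h := (existsUnique_picardMap hab hc hf z).unique (hZ.domRestrict_isFixedPt hab hc hf)
    (hW.domRestrict_isFixedPt hab hc hf)
  intro s hs
  exact DFunLike.congr_fun h ⟨s, hs⟩

end ODE

/-! ### Absolute continuity of vector valued primitives -/

section AC
open AbsolutelyContinuousOnInterval Filter Topology

variable {X Y Z : Type*} [PseudoMetricSpace X] [PseudoMetricSpace Y] [PseudoMetricSpace Z] {a b : ℝ}

/-- The sums defining absolute continuity of `h` are dominated termwise by those of `F` and `G`.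
This serves both for primitives and for bilinear products. -/
theorem AbsolutelyContinuousOnInterval.of_dist_le {F : ℝ → X} {G : ℝ → Y} {h : ℝ → Z} {C : ℝ}
    (hF : AbsolutelyContinuousOnInterval F a b) (hG : AbsolutelyContinuousOnInterval G a b)
    (hh : ∀ x ∈ uIcc a b, ∀ y ∈ uIcc a b,
      dist (h x) (h y) ≤ C * (dist (F x) (F y) + dist (G x) (G y))) :
    AbsolutelyContinuousOnInterval h a b := by
  have hlim := (Filter.Tendsto.add hF hG).const_mul C
  rw [add_zero, mul_zero] at hlim
  refine squeeze_zero' (.of_forall fun _ => Finset.sum_nonneg fun _ _ => dist_nonneg) ?_ hlim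
  have : ∀ᶠ (E : ℕ × (ℕ → ℝ × ℝ)) in totalLengthFilter ⊓ 𝓟 (disjWithin a b),
      E ∈ disjWithin a b := eventually_inf_principal.mpr (by simp)
  filter_upwards [this] with E hE
  rw [← Finset.sum_add_distrib, Finset.mul_sum]
  exact Finset.sum_le_sum fun i hi => hh _ (hE.1 i hi).1 _ (hE.1 i hi).2

/-- The increments of the primitive of `f` are dominated by those of the real primitive of `‖f‖`. -/
theorem IntervalIntegrable.absolutelyContinuousOnInterval_integral {E : Type*}
    [NormedAddCommGroup E] [NormedSpace ℝ E] {f : ℝ → E}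
    (hf : IntervalIntegrable f volume a b) :
    AbsolutelyContinuousOnInterval (fun x => ∫ r in a..x, f r) a b := by
  have hK := hf.norm.absolutelyContinuousOnInterval_intervalIntegral (c := a) left_mem_uIcc
  refine hK.of_dist_le (C := 1) hK fun x hx y hy => ?_
  have hi : ∀ x ∈ uIcc a b, IntervalIntegrable f volume a x := fun x hx =>
    hf.mono_set (uIcc_subset_uIcc left_mem_uIcc hx)
  rw [dist_comm, dist_comm (∫ v in a..x, ‖f v‖), dist_eq_norm, dist_eq_norm,
    intervalIntegral.integral_interval_sub_left (hi y hy) (hi x hx),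
    intervalIntegral.integral_interval_sub_left (hi y hy).norm (hi x hx).norm]
  have := intervalIntegral.norm_integral_le_abs_integral_norm (f := f) (a := x) (b := y)
    (μ := volume)
  rw [Real.norm_eq_abs]
  nlinarith [abs_nonneg (∫ v in x..y, ‖f v‖)]

end AC

/-! ### Calculus of absolutely continuous functions in integrated form -/

section Primitive

theorem ae_bound_of_continuousOn {H : Type*} [NormedAddCommGroup H] {g : ℝ → H} {a b : ℝ}
    (hg : ContinuousOn g (uIcc a b)) : ∃ C, ∀ᵐ s ∂volume.restrict (uIoc a b), ‖g s‖ ≤ C := by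
  obtain ⟨C, hC⟩ := isCompact_uIcc.exists_bound_of_continuousOn hg
  exact ⟨C, (ae_restrict_iff' measurableSet_uIoc).2
    (.of_forall fun s hs => hC s (uIoc_subset_uIcc hs))⟩

variable {E F G : Type*} [NormedAddCommGroup E] [NormedSpace ℝ E]
  [NormedAddCommGroup F] [NormedSpace ℝ F] [NormedAddCommGroup G] [NormedSpace ℝ G]
  {a b c : ℝ}

/-- `φ` is absolutely continuous on `[a, b]` with integrable derivative `φ'`, in integrated
form. -/
structure IsPrimitive (a b : ℝ) (φ φ' : ℝ → E) : Prop where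
  integrable : IntervalIntegrable φ' volume a b
  eq_integral : ∀ s ∈ Icc a b, φ s = φ a + ∫ r in a..s, φ' r

namespace IsPrimitive

variable {φ φ' : ℝ → E} {ψ ψ' : ℝ → F}

theorem integrable_sub (h : IsPrimitive a b φ φ') {x y : ℝ} (hx : x ∈ Icc a b)
    (hy : y ∈ Icc a b) : IntervalIntegrable φ' volume x y :=
  h.integrable.mono_set (by
    rw [uIcc_of_le (hx.1.trans hx.2)]; exact uIcc_subset_Icc hx hy)

theorem sub_eq (h : IsPrimitive a b φ φ') {x y : ℝ} (hx : x ∈ Icc a b) (hy : y ∈ Icc a b) :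
    φ y - φ x = ∫ r in x..y, φ' r := by
  have ha : a ∈ Icc a b := left_mem_Icc.2 (hx.1.trans hx.2)
  rw [h.eq_integral x hx, h.eq_integral y hy, add_sub_add_left_eq_sub,
    intervalIntegral.integral_interval_sub_left (h.integrable_sub ha hy) (h.integrable_sub ha hx)]

theorem eq_add (h : IsPrimitive a b φ φ') {x y : ℝ} (hx : x ∈ Icc a b) (hy : y ∈ Icc a b) :
    φ y = φ x + ∫ r in x..y, φ' r := by
  rw [← h.sub_eq hx hy]; abel

theorem mono (h : IsPrimitive a b φ φ') {x y : ℝ} (hx : x ∈ Icc a b) (hy : y ∈ Icc a b) :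
    IsPrimitive x y φ φ' where
  integrable := h.integrable_sub hx hy
  eq_integral s hs := h.eq_add hx ⟨hx.1.trans hs.1, hs.2.trans hy.2⟩

theorem congr (h : IsPrimitive a b φ φ') {χ χ' : ℝ → E} (h1 : EqOn χ φ (Icc a b))
    (hab : a ≤ b) (h2 : χ' =ᵐ[volume.restrict (Icc a b)] φ') : IsPrimitive a b χ χ' where
  integrable := by
    have hi := h.integrable
    rw [intervalIntegrable_iff_integrableOn_Icc_of_le hab] at hi ⊢
    exact Integrable.congr hi h2.symm
  eq_integral s hs := by
    rw [h1 hs, h1 (left_mem_Icc.2 hab), h.eq_integral s hs]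
    congr 1
    apply intervalIntegral.integral_congr_ae
    rw [Filter.EventuallyEq, ae_restrict_iff' measurableSet_Icc] at h2
    filter_upwards [h2] with r hr hr'
    rw [uIoc_of_le hs.1] at hr'
    exact (hr ⟨hr'.1.le, hr'.2.trans hs.2⟩).symm

theorem continuousOn (h : IsPrimitive a b φ φ') : ContinuousOn φ (Icc a b) := by
  rcases le_or_gt a b with hab | hab
  · refine ContinuousOn.congr (f := fun s => φ a + ∫ r in a..s, φ' r) ?_ h.eq_integral
    exact continuousOn_const.add (continuousOn_integral_of_mem (left_mem_Icc.2 hab) h.integrable)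
  · simp [Icc_eq_empty hab.not_ge]

theorem solvesODE (h : IsPrimitive a b φ φ') {f : ℝ → E → E} (hc : c ∈ Icc a b)
    (hf : ∀ᵐ r ∂volume.restrict (Icc a b), f r (φ r) = φ' r) :
    SolvesODE f a b c (φ c) φ := by
  have h' := h.congr (χ' := fun r => f r (φ r)) (fun _ _ => rfl) (hc.1.trans hc.2) hf
  exact ⟨h.continuousOn, h'.integrable, fun s hs => h'.eq_add hc hs⟩

theorem of_solvesODE {f : ℝ → E → E} {z : E} (hc : c ∈ Icc a b) (h : SolvesODE f a b c z φ) :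
    IsPrimitive a b φ (fun r => f r (φ r)) where
  integrable := h.integrable
  eq_integral s hs := by
    have hi : ∀ x ∈ Icc a b, ∀ y ∈ Icc a b,
        IntervalIntegrable (fun r => f r (φ r)) volume x y := fun x hx y hy =>
      h.integrable.mono_set (by
        rw [uIcc_of_le (hc.1.trans hc.2)]; exact uIcc_subset_Icc hx hy)
    have ha : a ∈ Icc a b := left_mem_Icc.2 (hc.1.trans hc.2)
    rw [h.eq_integral s hs, h.eq_integral a ha, add_assoc,
      intervalIntegral.integral_add_adjacent_intervals (hi c hc a ha) (hi a ha s hs)]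

theorem integral {g : ℝ → E} (hg : IntervalIntegrable g volume a b) (hc : c ∈ Icc a b) :
    IsPrimitive a b (fun s => ∫ r in c..s, g r) g where
  integrable := hg
  eq_integral s hs := by
    have hi : ∀ x ∈ Icc a b, ∀ y ∈ Icc a b, IntervalIntegrable g volume x y := fun x hx y hy =>
      hg.mono_set (by
        rw [uIcc_of_le (hc.1.trans hc.2)]; exact uIcc_subset_Icc hx hy)
    have ha : a ∈ Icc a b := left_mem_Icc.2 (hc.1.trans hc.2)
    rw [intervalIntegral.integral_add_adjacent_intervals (hi c hc a ha) (hi a ha s hs)]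

theorem const (x : E) : IsPrimitive a b (fun _ => x) (fun _ => (0 : E)) where
  integrable := intervalIntegrable_const
  eq_integral s _ := by simp

theorem add (h : IsPrimitive a b φ φ') {χ χ' : ℝ → E} (h2 : IsPrimitive a b χ χ') :
    IsPrimitive a b (fun s => φ s + χ s) (fun s => φ' s + χ' s) where
  integrable := h.integrable.add h2.integrable
  eq_integral s hs := by
    have ha : a ∈ Icc a b := left_mem_Icc.2 (hs.1.trans hs.2)
    rw [intervalIntegral.integral_add (h.integrable_sub ha hs) (h2.integrable_sub ha hs),
      h.eq_integral s hs, h2.eq_integral s hs]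
    abel

theorem neg (h : IsPrimitive a b φ φ') :
    IsPrimitive a b (fun s => - φ s) (fun s => - φ' s) where
  integrable := h.integrable.neg
  eq_integral s hs := by
    rw [intervalIntegral.integral_neg, h.eq_integral s hs]
    abel

/-- The product rule that justifies every integration by parts below. The product and the primitive
of its formal derivative are both absolutely continuous with the same derivative almost everywhere,
so they differ by a constant. -/
theorem bilin [CompleteSpace E] [CompleteSpace F] [CompleteSpace G]
    (L : E →L[ℝ] F →L[ℝ] G) (hφ : IsPrimitive a b φ φ') (hψ : IsPrimitive a b ψ ψ')
    (hab : a ≤ b) :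
    IsPrimitive a b (fun s => L (φ s) (ψ s)) (fun s => L (φ' s) (ψ s) + L (φ s) (ψ' s)) := by
  -- Nothing is known of `φ` and `ψ` outside `[a, b]`. The primitives agree with them there, and
  -- their almost everywhere derivatives come from Lebesgue differentiation.
  set Φ : ℝ → E := fun s => φ a + ∫ r in a..s, φ' r with hΦ
  set Ψ : ℝ → F := fun s => ψ a + ∫ r in a..s, ψ' r with hΨ
  have huIcc : uIcc a b = Icc a b := uIcc_of_le hab
  have hΦc : ContinuousOn Φ (Icc a b) := hφ.continuousOn.congr fun s hs => (hφ.eq_integral s hs).symm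
  have hΨc : ContinuousOn Ψ (Icc a b) := hψ.continuousOn.congr fun s hs => (hψ.eq_integral s hs).symm
  have hint : IntervalIntegrable (fun s => L (φ' s) (Ψ s) + L (Φ s) (ψ' s)) volume a b := by
    rw [← huIcc] at hΦc hΨc
    obtain ⟨C₁, h1⟩ := ae_bound_of_continuousOn hΦc
    obtain ⟨C₂, h2⟩ := ae_bound_of_continuousOn hΨc
    have mΦ : AEStronglyMeasurable Φ (volume.restrict (uIoc a b)) :=
      (hΦc.mono uIoc_subset_uIcc).aestronglyMeasurable measurableSet_uIoc
    have mΨ : AEStronglyMeasurable Ψ (volume.restrict (uIoc a b)) :=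
      (hΨc.mono uIoc_subset_uIcc).aestronglyMeasurable measurableSet_uIoc
    have i1 := hφ.integrable
    have i2 := hψ.integrable
    rw [intervalIntegrable_iff] at i1 i2 ⊢
    exact (L.integrable_of_bilin_of_bdd_right C₂ i1 mΨ h2).add
      (L.integrable_of_bilin_of_bdd_left C₁ mΦ h1 i2)
  obtain ⟨C₁, hC₁⟩ := isCompact_Icc.exists_bound_of_continuousOn hΦc
  obtain ⟨C₂, hC₂⟩ := isCompact_Icc.exists_bound_of_continuousOn hΨc
  have acΦ : AbsolutelyContinuousOnInterval Φ a b := by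
    have := hφ.integrable.absolutelyContinuousOnInterval_integral
    exact this.of_dist_le (C := 1) this fun x _ y _ => by
      rw [dist_add_left]; linarith [dist_nonneg (x := ∫ r in a..x, φ' r) (y := ∫ r in a..y, φ' r)]
  have acΨ : AbsolutelyContinuousOnInterval Ψ a b := by
    have := hψ.integrable.absolutelyContinuousOnInterval_integral
    exact this.of_dist_le (C := 1) this fun x _ y _ => by
      rw [dist_add_left]; linarith [dist_nonneg (x := ∫ r in a..x, ψ' r) (y := ∫ r in a..y, ψ' r)]
  have acL : AbsolutelyContinuousOnInterval (fun s => L (Φ s) (Ψ s)) a b := by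
    refine acΦ.of_dist_le (C := ‖L‖ * max C₁ C₂) acΨ fun x hx y hy => ?_
    rw [huIcc] at hx hy
    rw [dist_eq_norm, dist_eq_norm, dist_eq_norm]
    have e : L (Φ x) (Ψ x) - L (Φ y) (Ψ y) = L (Φ x - Φ y) (Ψ x) + L (Φ y) (Ψ x - Ψ y) := by
      simp
    rw [e]
    have n1 := L.le_opNorm₂ (Φ x - Φ y) (Ψ x)
    have n2 := L.le_opNorm₂ (Φ y) (Ψ x - Ψ y)
    have b1 : ‖Ψ x‖ ≤ max C₁ C₂ := (hC₂ x hx).trans (le_max_right _ _)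
    have b2 : ‖Φ y‖ ≤ max C₁ C₂ := (hC₁ y hy).trans (le_max_left _ _)
    calc _ ≤ ‖L‖ * ‖Φ x - Φ y‖ * ‖Ψ x‖ + ‖L‖ * ‖Φ y‖ * ‖Ψ x - Ψ y‖ :=
          (norm_add_le _ _).trans (add_le_add n1 n2)
      _ ≤ ‖L‖ * ‖Φ x - Φ y‖ * max C₁ C₂ + ‖L‖ * max C₁ C₂ * ‖Ψ x - Ψ y‖ := by gcongr
      _ = _ := by ring
  have acI := hint.absolutelyContinuousOnInterval_integral
  -- An absolutely continuous function whose derivative vanishes almost everywhere is constant.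
  obtain ⟨C, hC⟩ := (acL.sub acI).const_of_ae_hasDerivAt_zero (by
    filter_upwards [hφ.integrable.ae_hasDerivAt_integral, hψ.integrable.ae_hasDerivAt_integral,
      hint.ae_hasDerivAt_integral] with s h1 h2 h3 hs
    have d1 : HasDerivAt Φ (φ' s) s := (h1 hs a left_mem_uIcc).const_add (φ a)
    have d2 : HasDerivAt Ψ (ψ' s) s := (h2 hs a left_mem_uIcc).const_add (ψ a)
    have d3 := h3 hs a left_mem_uIcc
    have d4 : HasDerivAt (fun s => L (Φ s) (Ψ s)) (L (φ' s) (Ψ s) + L (Φ s) (ψ' s)) s :=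
      ((L.hasFDerivAt.comp_hasDerivAt s d1).clm_apply d2)
    simpa using d4.sub d3)
  have key : IsPrimitive a b (fun s => L (Φ s) (Ψ s))
      (fun s => L (φ' s) (Ψ s) + L (Φ s) (ψ' s)) := by
    refine ⟨hint, fun s hs => ?_⟩
    have h1 := hC s (huIcc ▸ hs)
    have h2 := hC a left_mem_uIcc
    simp only [Pi.sub_apply, intervalIntegral.integral_same, sub_zero] at h1 h2
    rw [← sub_eq_iff_eq_add, h1, h2]
  refine key.congr (fun s hs => ?_) hab ?_
  · simp only [hΦ, hΨ, ← hφ.eq_integral s hs, ← hψ.eq_integral s hs]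
  · filter_upwards [ae_restrict_mem measurableSet_Icc] with s hs
    simp only [hΦ, hΨ, ← hφ.eq_integral s hs, ← hψ.eq_integral s hs]

theorem clm [CompleteSpace E] [CompleteSpace F] (L : E →L[ℝ] F) (h : IsPrimitive a b φ φ') :
    IsPrimitive a b (fun s => L (φ s)) (fun s => L (φ' s)) where
  integrable := ⟨L.integrable_comp h.integrable.1, L.integrable_comp h.integrable.2⟩
  eq_integral s hs := by
    have ha : a ∈ Icc a b := left_mem_Icc.2 (hs.1.trans hs.2)
    rw [L.intervalIntegral_comp_comm (h.integrable_sub ha hs), ← map_add, ← h.eq_integral s hs]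

end IsPrimitive

end Primitive

/-! ### Bounded linear and bilinear operations between `C([a, b])` and `L²(a, b)` -/

section Spaces

/-- Continuous maps into a normed space, with the topology given by the norm. -/
abbrev CMap (K V : Type*) [TopologicalSpace K] [NormedAddCommGroup V] : Type _ := C(K, V)

variable {K : Type*} [TopologicalSpace K] [CompactSpace K]
  {E F G : Type*} [NormedAddCommGroup E] [NormedSpace ℝ E]
  [NormedAddCommGroup F] [NormedSpace ℝ F] [NormedAddCommGroup G] [NormedSpace ℝ G]

/-- Pointwise application, as a bounded bilinear map on spaces of continuous functions. -/
noncomputable def ContinuousMap.applyL : CMap K (E →L[ℝ] F) →L[ℝ] C(K, E) →L[ℝ] C(K, F) :=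
  LinearMap.mkContinuous₂
    (LinearMap.mk₂ ℝ (fun (M : CMap K (E →L[ℝ] F)) (X : C(K, E)) =>
      (⟨fun s => M s (X s), by fun_prop⟩ : C(K, F)))
      (fun _ _ _ => by ext; simp) (fun _ _ _ => by ext; simp)
      (fun _ _ _ => by ext; simp) (fun _ _ _ => by ext; simp)) 1
    (fun M X => by
      rw [one_mul, ContinuousMap.norm_le _ (by positivity)]
      intro s
      simp only [LinearMap.mk₂_apply, ContinuousMap.coe_mk]
      exact ((M s).le_opNorm _).trans (mul_le_mul (M.norm_coe_le_norm s) (X.norm_coe_le_norm s)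
        (norm_nonneg (X s)) ((norm_nonneg (M s)).trans (M.norm_coe_le_norm s))))

@[simp]
theorem ContinuousMap.applyL_apply (M : CMap K (E →L[ℝ] F)) (X : C(K, E)) (s : K) :
    ContinuousMap.applyL M X s = M s (X s) := rfl

variable {a b : ℝ}

/-- The embedding of the continuous functions on `[a, b]` into `Lᵖ(a, b)`. -/
noncomputable def toLpIcc (hab : a ≤ b) (p : ENNReal) [Fact (1 ≤ p)] :
    C(Icc a b, E) →L[ℝ] Lp E p (volume.restrict (Icc a b)) :=
  (BoundedContinuousFunction.toLp p (volume.restrict (Icc a b)) ℝ).comp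
    ((BoundedContinuousFunction.compContinuousCLM E ℝ
        (⟨projIcc a b hab, continuous_projIcc⟩ : C(ℝ, Icc a b))).comp
      (ContinuousMap.linearIsometryBoundedOfCompact (Icc a b) E
        ℝ).toContinuousLinearEquiv.toContinuousLinearMap)

theorem coeFn_toLpIcc (hab : a ≤ b) (p : ENNReal) [Fact (1 ≤ p)] (X : C(Icc a b, E)) :
    toLpIcc hab p X =ᵐ[volume.restrict (Icc a b)] fun r => X (projIcc a b hab r) :=
  BoundedContinuousFunction.coeFn_toLp _ _ _ _

/-- Multiplication of a square integrable function by a continuous operator valued one. -/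
noncomputable def mulLp (hab : a ≤ b) : CMap (Icc a b) (E →L[ℝ] F) →L[ℝ]
    Lp E 2 (volume.restrict (Icc a b)) →L[ℝ] Lp F 2 (volume.restrict (Icc a b)) :=
  ((ContinuousLinearMap.id ℝ (E →L[ℝ] F)).holderL (volume.restrict (Icc a b)) ⊤ 2 2).comp
    (toLpIcc hab ⊤)

theorem coeFn_mulLp (hab : a ≤ b) (M : CMap (Icc a b) (E →L[ℝ] F))
    (v : Lp E 2 (volume.restrict (Icc a b))) :
    mulLp hab M v =ᵐ[volume.restrict (Icc a b)] fun r => M (projIcc a b hab r) (v r) := by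
  have h := (ContinuousLinearMap.id ℝ (E →L[ℝ] F)).coeFn_holder (r := 2) (toLpIcc hab ⊤ M) v
  filter_upwards [h, coeFn_toLpIcc hab ⊤ M] with r h1 h2
  simp only [mulLp, ContinuousLinearMap.comp_apply]
  refine h1.trans ?_
  rw [h2]
  rfl

theorem intervalIntegrable_of_memLp_two {v : ℝ → E} (hab : a ≤ b)
    (hv : MemLp v 2 (volume.restrict (Icc a b))) : IntervalIntegrable v volume a b := by
  rw [intervalIntegrable_iff_integrableOn_Icc_of_le hab]
  exact hv.integrable (by norm_num)

theorem Lp.intervalIntegrable (hab : a ≤ b) (v : Lp E 2 (volume.restrict (Icc a b))) :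
    IntervalIntegrable v volume a b :=
  intervalIntegrable_of_memLp_two hab (Lp.memLp v)

theorem Lp.intervalIntegrable_sub (v : Lp E 2 (volume.restrict (Icc a b))) {x y : ℝ}
    (hx : x ∈ Icc a b) (hy : y ∈ Icc a b) : IntervalIntegrable v volume x y :=
  (Lp.intervalIntegrable (hx.1.trans hx.2) v).mono_set (by
    rw [uIcc_of_le (hx.1.trans hx.2)]; exact uIcc_subset_Icc hx hy)

theorem intervalIntegral_congr_ae_Icc {f g : ℝ → E} {x y : ℝ} (hx : x ∈ Icc a b)
    (hy : y ∈ Icc a b) (h : f =ᵐ[volume.restrict (Icc a b)] g) :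
    ∫ r in x..y, f r = ∫ r in x..y, g r := by
  apply intervalIntegral.integral_congr_ae
  rw [Filter.EventuallyEq, ae_restrict_iff' measurableSet_Icc] at h
  filter_upwards [h] with r hr hr'
  exact hr (uIcc_subset_Icc hx hy (uIoc_subset_uIcc hr'))

theorem integral_norm_le_sqrt_mul_norm (hab : a ≤ b) (v : Lp E 2 (volume.restrict (Icc a b))) :
    ∫ r in Icc a b, ‖v r‖ ≤ √(b - a) * ‖v‖ := by
  have h := setIntegral_mul_sq_le (memLp_const (μ := volume.restrict (Icc a b)) (1 : ℝ))
    (Lp.memLp v).norm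
  simp only [one_mul, one_pow, integral_const, smul_eq_mul, mul_one, measureReal_restrict_apply,
    MeasurableSet.univ, univ_inter, Real.volume_real_Icc_of_le hab] at h
  have hn : ∫ r in Icc a b, ‖v r‖ ^ 2 = ‖v‖ ^ 2 := by
    rw [Lp.norm_def, (Lp.memLp v).eLpNorm_eq_integral_rpow_norm two_ne_zero ENNReal.ofNat_ne_top,
      ENNReal.toReal_ofReal (by positivity)]
    simp only [ENNReal.toReal_ofNat, Real.rpow_ofNat]
    rw [← Real.rpow_natCast, ← Real.rpow_mul (by positivity)]
    norm_num
  rw [hn] at h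
  refine abs_le_of_sq_le_sq' ?_ (by positivity) |>.2
  rwa [mul_pow, Real.sq_sqrt (sub_nonneg.2 hab)]

/-- The primitive vanishing at the left end point. -/
noncomputable def primL (hab : a ≤ b) :
    Lp E 2 (volume.restrict (Icc a b)) →L[ℝ] C(Icc a b, E) :=
  LinearMap.mkContinuous
    { toFun := fun v => ⟨fun s => ∫ r in a..s, v r,
        continuousOn_iff_continuous_domRestrict.1
          (continuousOn_integral_of_mem (left_mem_Icc.2 hab) (Lp.intervalIntegrable hab v))⟩
      map_add' := fun v w => by
        ext s
        have ha := left_mem_Icc.2 hab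
        change ∫ r in a..s, (v + w : Lp E 2 _) r = (∫ r in a..s, v r) + ∫ r in a..s, w r
        rw [intervalIntegral_congr_ae_Icc ha s.2 (Lp.coeFn_add v w), ←
          intervalIntegral.integral_add (Lp.intervalIntegrable_sub v ha s.2)
          (Lp.intervalIntegrable_sub w ha s.2)]
        rfl
      map_smul' := fun c v => by
        ext s
        have ha := left_mem_Icc.2 hab
        change ∫ r in a..s, (c • v : Lp E 2 _) r = c • ∫ r in a..s, v r
        rw [intervalIntegral_congr_ae_Icc ha s.2 (Lp.coeFn_smul c v), ←
          intervalIntegral.integral_smul]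
        rfl } (√(b - a))
    (fun v => by
      rw [ContinuousMap.norm_le _ (by positivity)]
      intro s
      refine le_trans ?_ (integral_norm_le_sqrt_mul_norm hab v)
      change ‖∫ r in a..s, v r‖ ≤ _
      refine (intervalIntegral.norm_integral_le_integral_norm s.2.1).trans ?_
      rw [intervalIntegral.integral_of_le s.2.1]
      refine setIntegral_mono_set ?_ (.of_forall fun _ => norm_nonneg _) ?_
      · have := (Lp.intervalIntegrable hab v).norm
        rwa [intervalIntegrable_iff_integrableOn_Icc_of_le hab] at this
      · exact (Ioc_subset_Icc_self.trans (Icc_subset_Icc_right s.2.2)).eventuallyLE)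

@[simp]
theorem primL_apply (hab : a ≤ b) (v : Lp E 2 (volume.restrict (Icc a b))) (s : Icc a b) :
    primL hab v s = ∫ r in a..s, v r := rfl

/-- Integration of continuous functions on `[a, b]`. -/
noncomputable def integralL (hab : a ≤ b) : C(Icc a b, ℝ) →L[ℝ] ℝ :=
  LinearMap.mkContinuous
    { toFun := fun X => ∫ r in a..b, X (projIcc a b hab r)
      map_add' := fun X Y => by
        simp only [ContinuousMap.add_apply]
        apply intervalIntegral.integral_add <;>
        · apply Continuous.intervalIntegrable
          fun_prop
      map_smul' := fun c X => by
        simp [intervalIntegral.integral_const_mul] } |b - a|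
    (fun X => by
      rw [mul_comm]
      exact intervalIntegral.norm_integral_le_of_norm_le_const fun r _ => X.norm_coe_le_norm _)

end Spaces

/-! ### Superposition operators on spaces of continuous functions -/

section Nemytskii

variable {K : Type*} [TopologicalSpace K] [CompactSpace K] [LocallyCompactSpace K]
  {E F : Type*} [NormedAddCommGroup E] [NormedSpace ℝ E]
  [NormedAddCommGroup F] [NormedSpace ℝ F]

/-- The superposition (Nemytskii) operator `X ↦ f(·, X(·))`. -/
def ContinuousMap.superpose {E F : Type*} [TopologicalSpace E] [TopologicalSpace F]
    (f : C(K × E, F)) (X : C(K, E)) : C(K, F) :=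
  f.comp ((ContinuousMap.id K).prodMk X)

open ContinuousMap

@[simp]
theorem ContinuousMap.superpose_apply {E F : Type*} [TopologicalSpace E] [TopologicalSpace F]
    (f : C(K × E, F)) (X : C(K, E)) (s : K) : f.superpose X s = f (s, X s) := rfl

/-- In the compact-open topology postcomposition with `f` is continuous, and so is `X ↦ (id, X)` by
currying the evaluation map. On a compact `K` this is the topology of the sup norm. -/
theorem ContinuousMap.continuous_superpose (f : C(K × E, F)) : Continuous f.superpose := by
  refine f.continuous_postcomp.comp (ContinuousMap.continuous_of_continuous_uncurry
    (fun X : C(K, E) => (ContinuousMap.id K).prodMk X) ?_)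
  exact continuous_snd.prodMk (continuous_eval : Continuous fun p : C(K, E) × K => p.1 p.2)

/-- The pointwise derivative is the derivative in sup norm because the remainder is uniform in `s`:
the superposition operator of `f'` is continuous, and the mean value inequality applies on each
segment from `X s` to `Z s`. -/
theorem ContinuousMap.hasFDerivAt_superpose {f : C(K × E, F)} {f' : CMap (K × E) (E →L[ℝ] F)}
    (h : ∀ s y, HasFDerivAt (fun y => f (s, y)) (f' (s, y)) y) (X : C(K, E)) :
    HasFDerivAt f.superpose (applyL (f'.superpose X)) X := by
  rw [hasFDerivAt_iff_isLittleO, Asymptotics.isLittleO_iff]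
  intro c hc
  have hcont := Metric.continuousAt_iff.1 (f'.continuous_superpose.continuousAt (x := X)) c hc
  obtain ⟨δ, hδ, hδ'⟩ := hcont
  filter_upwards [Metric.ball_mem_nhds X hδ] with Z hZ
  rw [ContinuousMap.norm_le _ (by positivity)]
  intro s
  simp only [sub_apply, superpose_apply, applyL_apply]
  have hb : ∀ y ∈ segment ℝ (X s) (Z s), ‖f' (s, y) - f' (s, X s)‖ ≤ c := by
    rintro y hy
    rw [segment_eq_image'] at hy
    obtain ⟨θ, hθ, rfl⟩ := hy
    -- A point of the segment is the value at `s` of the continuous function `X + θ • (Z - X)`,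
    -- which lies in the same ball around `X`. Closeness of the superposed derivatives in sup norm
    -- thus gives the bound at every `s` at once.
    have h1 : dist (X + θ • (Z - X)) X < δ := by
      rw [dist_eq_norm, add_sub_cancel_left, norm_smul, Real.norm_of_nonneg hθ.1]
      rw [Metric.mem_ball, dist_eq_norm] at hZ
      nlinarith [norm_nonneg (Z - X), hθ.2]
    have h2 := (ContinuousMap.dist_apply_le_dist (f := f'.superpose (X + θ • (Z - X)))
      (g := f'.superpose X) s).trans (hδ' h1).le
    rwa [dist_eq_norm] at h2
  have := (convex_segment (X s) (Z s)).norm_image_sub_le_of_norm_hasFDerivWithin_le'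
    (f := fun y => f (s, y)) (f' := fun y => f' (s, y)) (φ := f' (s, X s)) (C := c)
    (fun y _ => (h s y).hasFDerivWithinAt) hb
    (left_mem_segment ℝ _ _) (right_mem_segment ℝ _ _)
  refine this.trans ?_
  gcongr
  exact (Z - X).norm_coe_le_norm s

/-- A continuous function of `(s, y)` together with its first and second continuous
derivatives in `y`. -/
structure SmoothCoeff (K E F : Type*) [TopologicalSpace K] [NormedAddCommGroup E] [NormedSpace ℝ E]
    [NormedAddCommGroup F] [NormedSpace ℝ F] where
  fn : C(K × E, F)
  deriv : CMap (K × E) (E →L[ℝ] F)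
  deriv₂ : CMap (K × E) (E →L[ℝ] E →L[ℝ] F)
  hasFDerivAt_fn : ∀ s y, HasFDerivAt (fun y => fn (s, y)) (deriv (s, y)) y
  hasFDerivAt_deriv : ∀ s y, HasFDerivAt (fun y => deriv (s, y)) (deriv₂ (s, y)) y

/-- Smooth coefficients with values in bounded operators. -/
abbrev OpCoeff (K E F G : Type*) [TopologicalSpace K] [NormedAddCommGroup E] [NormedSpace ℝ E]
    [NormedAddCommGroup F] [NormedSpace ℝ F] [NormedAddCommGroup G] [NormedSpace ℝ G] :=
  SmoothCoeff K E (F →L[ℝ] G)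

theorem ContinuousMap.contDiff_one_superpose {f : C(K × E, F)} {f' : CMap (K × E) (E →L[ℝ] F)}
    (h : ∀ s y, HasFDerivAt (fun y => f (s, y)) (f' (s, y)) y) : ContDiff ℝ 1 f.superpose := by
  rw [contDiff_one_iff_fderiv]
  refine ⟨fun X => (hasFDerivAt_superpose h X).differentiableAt, ?_⟩
  have : fderiv ℝ f.superpose = fun X => applyL (f'.superpose X) :=
    funext fun X => (hasFDerivAt_superpose h X).fderiv
  rw [this]
  exact applyL.continuous.comp f'.continuous_superpose

/-- The derivative is the superposition by `f.deriv` followed by the bounded linear map `applyL`, so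
the first order statement can be applied to it once more. -/
theorem SmoothCoeff.contDiff_superpose (f : SmoothCoeff K E F) : ContDiff ℝ 2 f.fn.superpose := by
  rw [show (2 : WithTop ℕ∞) = 1 + 1 by norm_num, contDiff_succ_iff_fderiv]
  refine ⟨fun X => (hasFDerivAt_superpose f.hasFDerivAt_fn X).differentiableAt, by simp, ?_⟩
  have : fderiv ℝ f.fn.superpose = fun X => applyL (f.deriv.superpose X) :=
    funext fun X => (hasFDerivAt_superpose f.hasFDerivAt_fn X).fderiv
  rw [this]
  exact applyL.contDiff.comp (contDiff_one_superpose f.hasFDerivAt_deriv)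

theorem SmoothCoeff.hasFDerivAt_superpose (f : SmoothCoeff K E F) (X : C(K, E)) :
    HasFDerivAt f.fn.superpose (applyL (f.deriv.superpose X)) X :=
  ContinuousMap.hasFDerivAt_superpose f.hasFDerivAt_fn X

theorem SmoothCoeff.hasFDerivAt_deriv_superpose (f : SmoothCoeff K E F) (X : C(K, E)) :
    HasFDerivAt f.deriv.superpose (applyL (f.deriv₂.superpose X)) X :=
  ContinuousMap.hasFDerivAt_superpose f.hasFDerivAt_deriv X

end Nemytskii

/-! ### Gradient and Hessian through the Riesz representation -/

section Hess

variable {H : Type*} [NormedAddCommGroup H] [InnerProductSpace ℝ H] [CompleteSpace H]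

/-- The Riesz representation, as a real linear map. -/
noncomputable def rieszL (H : Type*) [NormedAddCommGroup H] [InnerProductSpace ℝ H]
    [CompleteSpace H] : (H →L[ℝ] ℝ) →L[ℝ] H :=
  LinearMap.mkContinuous
    { toFun := fun φ => (InnerProductSpace.toDual ℝ H).symm φ
      map_add' := fun φ χ => map_add _ φ χ
      map_smul' := fun c φ => by simp } 1 (fun φ => by simp)

theorem inner_rieszL (φ : H →L[ℝ] ℝ) (v : H) : inner ℝ (rieszL H φ) v = φ v :=
  InnerProductSpace.toDual_symm_apply

theorem gradient_eq_rieszL_comp (f : H → ℝ) :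
    gradient f = fun x => rieszL H (fderiv ℝ f x) := rfl

theorem hasFDerivAt_gradient {f : H → ℝ} {x : H} (h : DifferentiableAt ℝ (fderiv ℝ f) x) :
    HasFDerivAt (gradient f) ((rieszL H).comp (fderiv ℝ (fderiv ℝ f) x)) x := by
  rw [gradient_eq_rieszL_comp]
  exact (rieszL H).hasFDerivAt.comp x h.hasFDerivAt

theorem inner_hess_apply {f : H → ℝ} {x : H} (h : DifferentiableAt ℝ (fderiv ℝ f) x) (v w : H) :
    inner ℝ (hess f x v) w = fderiv ℝ (fderiv ℝ f) x v w := by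
  rw [hess, (hasFDerivAt_gradient h).fderiv]
  exact inner_rieszL _ _

theorem inner_gradient_apply (f : H → ℝ) (x v : H) :
    inner ℝ (gradient f x) v = fderiv ℝ f x v := by
  rw [gradient_eq_rieszL_comp]
  exact inner_rieszL _ _

end Hess

/-! ### Derivatives along lines; second derivatives at stationary points -/

section Calculus

variable {V W G : Type*} [NormedAddCommGroup V] [NormedSpace ℝ V]
  [NormedAddCommGroup W] [NormedSpace ℝ W] [NormedAddCommGroup G] [NormedSpace ℝ G]

/-- Differentiability comes from composing smooth maps; the value of the derivative is then read off
along a line, where only product rules in one real variable are needed. -/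
theorem fderiv_apply_eq_of_hasDerivAt {f : V → G} {p q : V} {d : G}
    (hf : DifferentiableAt ℝ f p) (h : HasDerivAt (fun ε : ℝ => f (p + ε • q)) d 0) :
    fderiv ℝ f p q = d := by
  have hl : HasDerivAt (fun ε : ℝ => p + ε • q) q 0 := by
    simpa using ((hasDerivAt_id (0 : ℝ)).smul_const q).const_add p
  have hf' : HasFDerivAt f (fderiv ℝ f p) (p + (0 : ℝ) • q) := by simpa using hf.hasFDerivAt
  exact (hf'.comp_hasDerivAt (0 : ℝ) hl).unique h

theorem HasFDerivAt.hasDerivAt_line {f : V → G} {f' : V →L[ℝ] G} {p : V} (hf : HasFDerivAt f f' p)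
    (q : V) : HasDerivAt (fun ε : ℝ => f (p + ε • q)) (f' q) 0 := by
  have hl : HasDerivAt (fun ε : ℝ => p + ε • q) q 0 := by
    simpa using ((hasDerivAt_id (0 : ℝ)).smul_const q).const_add p
  have hf' : HasFDerivAt f f' (p + (0 : ℝ) • q) := by simpa using hf
  exact hf'.comp_hasDerivAt (0 : ℝ) hl

/-- The second derivative of `u ↦ L (u, Z u)` at a point where `L` is stationary in the second
variable. -/
theorem fderiv_fderiv_comp_prodMk_of_stationary {L : V × W → ℝ} {Z : V → W} (hL : ContDiff ℝ 2 L)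
    (hZ : ContDiff ℝ 2 Z) {u : V}
    (hstat : ∀ η, fderiv ℝ L (u, Z u) (0, η) = 0) (v w : V) :
    fderiv ℝ (fderiv ℝ fun u => L (u, Z u)) u v w =
      fderiv ℝ (fderiv ℝ L) (u, Z u) (v, fderiv ℝ Z u v) (w, fderiv ℝ Z u w) := by
  have hZd : Differentiable ℝ Z := hZ.differentiable (by norm_num)
  have hLd : Differentiable ℝ L := hL.differentiable (by norm_num)
  have hL' : Differentiable ℝ (fderiv ℝ L) :=
    (hL.fderiv_right (m := 1) (by norm_num)).differentiable (by norm_num)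
  have hZ' : Differentiable ℝ (fderiv ℝ Z) :=
    (hZ.fderiv_right (m := 1) (by norm_num)).differentiable (by norm_num)
  have hpair : ∀ u, HasFDerivAt (fun u => (u, Z u))
      ((ContinuousLinearMap.id ℝ V).prod (fderiv ℝ Z u)) u := fun u =>
    (hasFDerivAt_id u).prodMk (hZd u).hasFDerivAt
  have h1 : (fderiv ℝ fun u => L (u, Z u)) = fun u =>
      (fderiv ℝ L (u, Z u)).comp ((ContinuousLinearMap.id ℝ V).prod (fderiv ℝ Z u)) :=
    funext fun u => ((hLd (u, Z u)).hasFDerivAt.comp u (hpair u)).fderiv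
  have h2 : HasFDerivAt (fun u => fderiv ℝ L (u, Z u))
      ((fderiv ℝ (fderiv ℝ L) (u, Z u)).comp
        ((ContinuousLinearMap.id ℝ V).prod (fderiv ℝ Z u))) u :=
    (hL' (u, Z u)).hasFDerivAt.comp u (hpair u)
  rw [h1]
  have hd : DifferentiableAt ℝ (fun u => (fderiv ℝ L (u, Z u)).comp
      ((ContinuousLinearMap.id ℝ V).prod (fderiv ℝ Z u))) u := by
    refine h2.differentiableAt.clm_comp ?_
    have : DifferentiableAt ℝ (fun u => ContinuousLinearMap.prodₗᵢ ℝ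
      (ContinuousLinearMap.id ℝ V, fderiv ℝ Z u)) u :=
      (ContinuousLinearMap.prodₗᵢ (R := ℝ) (𝕜 := ℝ) (E := V) (F := V) (G := W) ).differentiable.differentiableAt.comp u
        ((differentiableAt_const _).prodMk (hZ' u))
    exact this
  refine congrArg (fun T : V →L[ℝ] ℝ => T w) (rfl : fderiv ℝ _ u v = _) |>.trans ?_
  have h3 : HasFDerivAt (fun u => (fderiv ℝ L (u, Z u)) (w, fderiv ℝ Z u w)) _ u :=
    h2.clm_apply ((hasFDerivAt_const w u).prodMk ((hZ' u).hasFDerivAt.clm_apply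
      (hasFDerivAt_const w u)))
  have h4 := (hd.hasFDerivAt.clm_apply (hasFDerivAt_const w u)).unique h3
  have h5 := DFunLike.congr_fun h4 v
  -- Besides the wanted term, the chain rule produces `L'` applied to `(0, Z''(u)(v, w))`, which
  -- stationarity kills.
  simpa [hstat] using h5

theorem HasDerivAt.clm_map {φ : ℝ → V} {φ' : V} {x : ℝ} (L : V →L[ℝ] W) (h : HasDerivAt φ φ' x) :
    HasDerivAt (fun ε => L (φ ε)) (L φ') x :=
  L.hasFDerivAt.comp_hasDerivAt x h

end Calculus

/-! ### The Bolza functional and its first two derivatives -/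

section Superpose

variable {K : Type*} [TopologicalSpace K] [CompactSpace K] [LocallyCompactSpace K]
  {E F : Type*} [NormedAddCommGroup E] [NormedSpace ℝ E]
  [NormedAddCommGroup F] [NormedSpace ℝ F]

open ContinuousMap

theorem SmoothCoeff.hasDerivAt_line (f : SmoothCoeff K E F) (X Y : C(K, E)) :
    HasDerivAt (fun ε : ℝ => f.fn.superpose (X + ε • Y)) (applyL (f.deriv.superpose X) Y) 0 :=
  (f.hasFDerivAt_superpose X).hasDerivAt_line Y

theorem SmoothCoeff.hasDerivAt_deriv_line (f : SmoothCoeff K E F) (X Y η : C(K, E)) :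
    HasDerivAt (fun ε : ℝ => applyL (f.deriv.superpose (X + ε • Y)) η)
      (applyL (applyL (f.deriv₂.superpose X) Y) η) 0 := by
  have h : HasDerivAt (fun ε : ℝ => f.deriv.superpose (X + ε • Y))
      (applyL (f.deriv₂.superpose X) Y) 0 :=
    (f.hasFDerivAt_deriv_superpose X).hasDerivAt_line Y
  exact HasDerivAt.clm_map ((applyL (K := K) (E := E) (F := F)).flip η) h

variable {V : Type*} [NormedAddCommGroup V] [NormedSpace ℝ V]

theorem SmoothCoeff.hasDerivAt_map (f : SmoothCoeff K E F) (T : C(K, F) →L[ℝ] V) (X Y : C(K, E)) :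
    HasDerivAt (fun ε : ℝ => T (f.fn.superpose (X + ε • Y)))
      (T (applyL (f.deriv.superpose X) Y)) 0 :=
  (f.hasDerivAt_line X Y).clm_map T

theorem SmoothCoeff.hasDerivAt_map_deriv (f : SmoothCoeff K E F) (T : C(K, F) →L[ℝ] V)
    (X Y η : C(K, E)) :
    HasDerivAt (fun ε : ℝ => T (applyL (f.deriv.superpose (X + ε • Y)) η))
      (T (applyL (applyL (f.deriv₂.superpose X) Y) η)) 0 :=
  (f.hasDerivAt_deriv_line X Y η).clm_map T

theorem SmoothCoeff.contDiff_map_snd (f : SmoothCoeff K E F) (T : C(K, F) →L[ℝ] V) {W : Type*}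
    [NormedAddCommGroup W] [NormedSpace ℝ W] :
    ContDiff ℝ 2 fun p : W × C(K, E) => T (f.fn.superpose p.2) :=
  T.contDiff.comp (f.contDiff_superpose.comp contDiff_snd)

theorem OpCoeff.hasDerivAt_mulLp {F G : Type*} [NormedAddCommGroup F] [NormedSpace ℝ F]
    [NormedAddCommGroup G] [NormedSpace ℝ G] {a b : ℝ} (hab : a ≤ b)
    (f : OpCoeff (Icc a b) E F G) (X Y : C(Icc a b, E)) :
    HasDerivAt (fun ε : ℝ => mulLp hab (f.fn.superpose (X + ε • Y)))
      (mulLp hab (applyL (f.deriv.superpose X) Y)) 0 :=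
  (f.hasDerivAt_line X Y).clm_map (W := Lp F 2 (volume.restrict (Icc a b)) →L[ℝ]
    Lp G 2 (volume.restrict (Icc a b))) (mulLp hab)

theorem OpCoeff.hasDerivAt_mulLp_deriv {F G : Type*} [NormedAddCommGroup F] [NormedSpace ℝ F]
    [NormedAddCommGroup G] [NormedSpace ℝ G] {a b : ℝ} (hab : a ≤ b)
    (f : OpCoeff (Icc a b) E F G) (X Y η : C(Icc a b, E)) :
    HasDerivAt (fun ε : ℝ => mulLp hab (applyL (f.deriv.superpose (X + ε • Y)) η))
      (mulLp hab (applyL (applyL (f.deriv₂.superpose X) Y) η)) 0 :=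
  (f.hasDerivAt_deriv_line X Y η).clm_map (W := Lp F 2 (volume.restrict (Icc a b)) →L[ℝ]
    Lp G 2 (volume.restrict (Icc a b))) (mulLp hab)

variable {a b : ℝ} {U : Type*} [NormedAddCommGroup U] [InnerProductSpace ℝ U]

/-- A Bolza type functional, affine-quadratic in the control, of the pair (control, state). -/
noncomputable def bolza (hab : a ≤ b) (f₀ : SmoothCoeff (Icc a b) E ℝ)
    (f₁ : SmoothCoeff (Icc a b) E U) (f₂ : OpCoeff (Icc a b) E U U) (g : E → ℝ)
    (ℓ : C(Icc a b, E) →L[ℝ] ℝ) (p : Lp U 2 (volume.restrict (Icc a b)) × C(Icc a b, E)) : ℝ :=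
  integralL hab (f₀.fn.superpose p.2) + inner ℝ (toLpIcc hab 2 (f₁.fn.superpose p.2)) p.1
    + 1 / 2 * inner ℝ (mulLp hab (f₂.fn.superpose p.2) p.1) p.1
    + g (p.2 ⟨b, right_mem_Icc.2 hab⟩) + ℓ p.2

variable {hab : a ≤ b} {f₀ : SmoothCoeff (Icc a b) E ℝ}
    {f₁ : SmoothCoeff (Icc a b) E U} {f₂ : OpCoeff (Icc a b) E U U} {g : E → ℝ}
    {ℓ : C(Icc a b, E) →L[ℝ] ℝ}

/-- Each term pairs a superposition in `X`, of class `C²`, with the control through bounded bilinear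
maps, in which the control occurs at most quadratically. -/
theorem contDiff_bolza (hg : ContDiff ℝ 2 g) : ContDiff ℝ 2 (bolza hab f₀ f₁ f₂ g ℓ) := by
  have t0 : ContDiff ℝ 2 fun p : Lp U 2 (volume.restrict (Icc a b)) × C(Icc a b, E) =>
      integralL hab (f₀.fn.superpose p.2) :=
    f₀.contDiff_map_snd (integralL hab)
  have t1 : ContDiff ℝ 2 fun p : Lp U 2 (volume.restrict (Icc a b)) × C(Icc a b, E) =>
      inner ℝ (toLpIcc hab 2 (f₁.fn.superpose p.2)) p.1 :=
    (f₁.contDiff_map_snd (toLpIcc hab 2)).inner ℝ contDiff_fst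
  have t2 : ContDiff ℝ 2 fun p : Lp U 2 (volume.restrict (Icc a b)) × C(Icc a b, E) =>
      mulLp hab (f₂.fn.superpose p.2) p.1 :=
    (f₂.contDiff_map_snd (mulLp (E := U) (F := U) hab)).clm_apply contDiff_fst
  have t2' : ContDiff ℝ 2 fun p : Lp U 2 (volume.restrict (Icc a b)) × C(Icc a b, E) =>
      1 / 2 * inner ℝ (mulLp hab (f₂.fn.superpose p.2) p.1) p.1 :=
    contDiff_const.mul (t2.inner ℝ contDiff_fst)
  have t3 : ContDiff ℝ 2 fun p : Lp U 2 (volume.restrict (Icc a b)) × C(Icc a b, E) =>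
      p.2 ⟨b, right_mem_Icc.2 hab⟩ :=
    (ContinuousMap.evalCLM (M := E) ℝ (⟨b, right_mem_Icc.2 hab⟩ : Icc a b)).contDiff.comp contDiff_snd
  have t4 : ContDiff ℝ 2 fun p : Lp U 2 (volume.restrict (Icc a b)) × C(Icc a b, E) => ℓ p.2 :=
    ℓ.contDiff.comp contDiff_snd
  exact (((t0.add t1).add t2').add (hg.comp t3)).add t4

/-- The first derivative of `bolza`. -/
noncomputable def bolzaDeriv (hab : a ≤ b) (f₀ : SmoothCoeff (Icc a b) E ℝ)
    (f₁ : SmoothCoeff (Icc a b) E U) (f₂ : OpCoeff (Icc a b) E U U) (g : E → ℝ)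
    (ℓ : C(Icc a b, E) →L[ℝ] ℝ) (p q : Lp U 2 (volume.restrict (Icc a b)) × C(Icc a b, E)) : ℝ :=
  integralL hab (applyL (f₀.deriv.superpose p.2) q.2)
    + (inner ℝ (toLpIcc hab 2 (f₁.fn.superpose p.2)) q.1
      + inner ℝ (toLpIcc hab 2 (applyL (f₁.deriv.superpose p.2) q.2)) p.1)
    + 1 / 2 * (inner ℝ (mulLp hab (f₂.fn.superpose p.2) p.1) q.1
      + inner ℝ (mulLp hab (applyL (f₂.deriv.superpose p.2) q.2) p.1
        + mulLp hab (f₂.fn.superpose p.2) q.1) p.1)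
    + fderiv ℝ g (p.2 ⟨b, right_mem_Icc.2 hab⟩) (q.2 ⟨b, right_mem_Icc.2 hab⟩) + ℓ q.2

theorem fderiv_bolza (hg : ContDiff ℝ 2 g)
    (p q : Lp U 2 (volume.restrict (Icc a b)) × C(Icc a b, E)) :
    fderiv ℝ (bolza hab f₀ f₁ f₂ g ℓ) p q = bolzaDeriv hab f₀ f₁ f₂ g ℓ p q := by
  refine fderiv_apply_eq_of_hasDerivAt ((contDiff_bolza hg).differentiable (by norm_num) p) ?_
  have hu : HasDerivAt (fun ε : ℝ => (p + ε • q).1) q.1 0 :=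
    (ContinuousLinearMap.fst ℝ _ _).hasFDerivAt.hasDerivAt_line (p := p) q
  have h0 : HasDerivAt (fun ε : ℝ => integralL hab (f₀.fn.superpose (p + ε • q).2)) _ 0 :=
    f₀.hasDerivAt_map (integralL hab) p.2 q.2
  have h1 : HasDerivAt (fun ε : ℝ => toLpIcc hab 2 (f₁.fn.superpose (p + ε • q).2)) _ 0 :=
    f₁.hasDerivAt_map (toLpIcc hab 2) p.2 q.2
  have h2 : HasDerivAt (fun ε : ℝ => mulLp hab (f₂.fn.superpose (p + ε • q).2)) _ 0 :=
    f₂.hasDerivAt_mulLp hab p.2 q.2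
  have h3 : HasDerivAt (fun ε : ℝ => g ((p + ε • q).2 ⟨b, right_mem_Icc.2 hab⟩)) _ 0 :=
    (((hg.differentiable (by norm_num)) (p.2 ⟨b, right_mem_Icc.2 hab⟩)).hasFDerivAt).hasDerivAt_line
      (q.2 ⟨b, right_mem_Icc.2 hab⟩)
  have h4 : HasDerivAt (fun ε : ℝ => ℓ (p + ε • q).2) _ 0 :=
    ℓ.hasFDerivAt.hasDerivAt_line (p := p.2) q.2
  have H := (((h0.add (h1.inner ℝ hu)).add
    (((h2.clm_apply hu).inner ℝ hu).const_mul (1 / 2 : ℝ))).add h3).add h4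
  simp only [zero_smul, add_zero] at H
  exact H

/-- The second derivative of `bolza`. -/
noncomputable def bolzaDeriv₂ (hab : a ≤ b) (f₀ : SmoothCoeff (Icc a b) E ℝ)
    (f₁ : SmoothCoeff (Icc a b) E U) (f₂ : OpCoeff (Icc a b) E U U) (g : E → ℝ)
    (p q q' : Lp U 2 (volume.restrict (Icc a b)) × C(Icc a b, E)) : ℝ :=
  integralL hab (applyL (applyL (f₀.deriv₂.superpose p.2) q.2) q'.2)
    + (inner ℝ (toLpIcc hab 2 (applyL (f₁.deriv.superpose p.2) q.2)) q'.1
      + (inner ℝ (toLpIcc hab 2 (applyL (f₁.deriv.superpose p.2) q'.2)) q.1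
        + inner ℝ (toLpIcc hab 2 (applyL (applyL (f₁.deriv₂.superpose p.2) q.2) q'.2)) p.1))
    + 1 / 2 * (inner ℝ (mulLp hab (applyL (f₂.deriv.superpose p.2) q.2) p.1
        + mulLp hab (f₂.fn.superpose p.2) q.1) q'.1
      + (inner ℝ (mulLp hab (applyL (f₂.deriv.superpose p.2) q'.2) p.1
        + mulLp hab (f₂.fn.superpose p.2) q'.1) q.1
        + inner ℝ ((mulLp hab (applyL (applyL (f₂.deriv₂.superpose p.2) q.2) q'.2) p.1
            + mulLp hab (applyL (f₂.deriv.superpose p.2) q'.2) q.1)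
          + mulLp hab (applyL (f₂.deriv.superpose p.2) q.2) q'.1) p.1))
    + fderiv ℝ (fderiv ℝ g) (p.2 ⟨b, right_mem_Icc.2 hab⟩) (q.2 ⟨b, right_mem_Icc.2 hab⟩)
      (q'.2 ⟨b, right_mem_Icc.2 hab⟩)

theorem fderiv_fderiv_bolza (hg : ContDiff ℝ 2 g)
    (p q q' : Lp U 2 (volume.restrict (Icc a b)) × C(Icc a b, E)) :
    fderiv ℝ (fderiv ℝ (bolza hab f₀ f₁ f₂ g ℓ)) p q q' = bolzaDeriv₂ hab f₀ f₁ f₂ g p q q' := by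
  have hd : Differentiable ℝ (fderiv ℝ (bolza hab f₀ f₁ f₂ g ℓ)) :=
    ((contDiff_bolza hg).fderiv_right (m := 1) (by norm_num)).differentiable (by norm_num)
  have hgd : Differentiable ℝ (fderiv ℝ g) :=
    (hg.fderiv_right (m := 1) (by norm_num)).differentiable (by norm_num)
  -- With the second argument frozen at `q'`, the second derivative is the first derivative of a
  -- scalar function, hence computable along a line.
  have e : fderiv ℝ (fderiv ℝ (bolza hab f₀ f₁ f₂ g ℓ)) p q q' =
      fderiv ℝ (fun p => fderiv ℝ (bolza hab f₀ f₁ f₂ g ℓ) p q') p q := by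
    rw [fderiv_clm_apply (hd p) (differentiableAt_const _)]
    simp
  rw [e]
  refine fderiv_apply_eq_of_hasDerivAt ((hd p).clm_apply (differentiableAt_const _)) ?_
  simp only [fderiv_bolza hg]
  have hu : HasDerivAt (fun ε : ℝ => (p + ε • q).1) q.1 0 :=
    (ContinuousLinearMap.fst ℝ _ _).hasFDerivAt.hasDerivAt_line (p := p) q
  have h0 : HasDerivAt (fun ε : ℝ =>
      integralL hab (applyL (f₀.deriv.superpose (p + ε • q).2) q'.2)) _ 0 :=
    f₀.hasDerivAt_map_deriv (integralL hab) p.2 q.2 q'.2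
  have h1 : HasDerivAt (fun ε : ℝ => toLpIcc hab 2 (f₁.fn.superpose (p + ε • q).2)) _ 0 :=
    f₁.hasDerivAt_map (toLpIcc hab 2) p.2 q.2
  have h1' : HasDerivAt (fun ε : ℝ =>
      toLpIcc hab 2 (applyL (f₁.deriv.superpose (p + ε • q).2) q'.2)) _ 0 :=
    f₁.hasDerivAt_map_deriv (toLpIcc hab 2) p.2 q.2 q'.2
  have h2 : HasDerivAt (fun ε : ℝ => mulLp hab (f₂.fn.superpose (p + ε • q).2)) _ 0 :=
    f₂.hasDerivAt_mulLp hab p.2 q.2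
  have h2' : HasDerivAt (fun ε : ℝ =>
      mulLp hab (applyL (f₂.deriv.superpose (p + ε • q).2) q'.2)) _ 0 :=
    f₂.hasDerivAt_mulLp_deriv hab p.2 q.2 q'.2
  have h3 : HasDerivAt (fun ε : ℝ => fderiv ℝ g ((p + ε • q).2 ⟨b, right_mem_Icc.2 hab⟩)) _ 0 :=
    ((hgd (p.2 ⟨b, right_mem_Icc.2 hab⟩)).hasFDerivAt).hasDerivAt_line
      (q.2 ⟨b, right_mem_Icc.2 hab⟩)
  have c1 := hasDerivAt_const (0 : ℝ) q'.1
  have c2 := hasDerivAt_const (0 : ℝ) (q'.2 ⟨b, right_mem_Icc.2 hab⟩)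
  have H := (((h0.add ((h1.inner ℝ c1).add (h1'.inner ℝ hu))).add
    ((((h2.clm_apply hu).inner ℝ c1).add
      (((h2'.clm_apply hu).add (h2.clm_apply c1)).inner ℝ hu)).const_mul
      (1 / 2 : ℝ))).add (h3.clm_apply c2)).add_const (ℓ q'.2)
  simp only [Pi.add_apply, zero_smul, add_zero, map_zero, inner_zero_right, zero_add] at H
  exact H

end Superpose

/-- Square integrability on `[a, b]` of a function with values in a normed space. -/
abbrev SqInt {V : Type*} [NormedAddCommGroup V] (a b : ℝ) (A : ℝ → V) : Prop :=
  MemLp A 2 (volume.restrict (Icc a b))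

/-! ### Linear equations with square integrable coefficients -/

section LinearField

variable {E F G : Type*} [NormedAddCommGroup E] [NormedSpace ℝ E]
  [NormedAddCommGroup F] [NormedSpace ℝ F] [NormedAddCommGroup G] [NormedSpace ℝ G] {a b : ℝ}

theorem intervalIntegrable_bilin (L : E →L[ℝ] F →L[ℝ] G) {f : ℝ → E} {g : ℝ → F} (hab : a ≤ b)
    (hf : IntervalIntegrable f volume a b) (hg : ContinuousOn g (Icc a b)) :
    IntervalIntegrable (fun r => L (f r) (g r)) volume a b := by
  rw [← uIcc_of_le hab] at hg
  obtain ⟨C, hC⟩ := ae_bound_of_continuousOn hg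
  have mg : AEStronglyMeasurable g (volume.restrict (uIoc a b)) :=
    (hg.mono uIoc_subset_uIcc).aestronglyMeasurable measurableSet_uIoc
  rw [intervalIntegrable_iff] at hf ⊢
  exact L.integrable_of_bilin_of_bdd_right C hf mg hC

theorem LipschitzField.of_linear {A : ℝ → E →L[ℝ] E} (hab : a ≤ b)
    (hA : SqInt a b A) {g : ℝ → E}
    (hg : IntervalIntegrable g volume a b) :
    LipschitzField (fun r z => A r z + g r) a b (fun r => ‖A r‖) where
  memLp := hA.norm
  lip r _ z z' := by
    rw [add_sub_add_right_eq_sub, ← map_sub]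
    exact (A r).le_opNorm _
  integrable Z hZ := (intervalIntegrable_bilin (ContinuousLinearMap.id ℝ (E →L[ℝ] E)) hab
    (intervalIntegrable_of_memLp_two hab hA) hZ).add hg

theorem memLp_comp_projIcc (hab : a ≤ b) (X : C(Icc a b, E)) (p : ENNReal) :
    MemLp (fun r => X (projIcc a b hab r)) p (volume.restrict (Icc a b)) := by
  refine MemLp.of_bound (C := ‖X‖) ?_ (.of_forall fun r => X.norm_coe_le_norm _)
  exact (X.continuous.comp continuous_projIcc).aestronglyMeasurable

theorem memLp_bilin_projIcc (L : E →L[ℝ] F →L[ℝ] G) (hab : a ≤ b) (X : C(Icc a b, E)) {v : ℝ → F}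
    {p : ENNReal} (hv : MemLp v p (volume.restrict (Icc a b))) :
    MemLp (fun r => L (X (projIcc a b hab r)) (v r)) p (volume.restrict (Icc a b)) :=
  L.memLp_of_bilin p (memLp_comp_projIcc hab X ⊤) hv

end LinearField

/-! ### The control-to-state map by the implicit function theorem -/

section StateMap

open ContinuousMap

variable {a b : ℝ} {E U : Type*} [NormedAddCommGroup E] [NormedSpace ℝ E]
  [NormedAddCommGroup U] [InnerProductSpace ℝ U]

/-- The velocity of a trajectory, as a function of the pair (control, state). -/
noncomputable def velocity (hab : a ≤ b) (α : SmoothCoeff (Icc a b) E E)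
    (β : OpCoeff (Icc a b) E U E) (p : Lp U 2 (volume.restrict (Icc a b)) × C(Icc a b, E)) :
    Lp E 2 (volume.restrict (Icc a b)) :=
  toLpIcc hab 2 (α.fn.superpose p.2) + mulLp hab (β.fn.superpose p.2) p.1

/-- The derivative of `velocity`. -/
noncomputable def velocityDeriv (hab : a ≤ b) (α : SmoothCoeff (Icc a b) E E)
    (β : OpCoeff (Icc a b) E U E) (p q : Lp U 2 (volume.restrict (Icc a b)) × C(Icc a b, E)) :
    Lp E 2 (volume.restrict (Icc a b)) :=
  toLpIcc hab 2 (applyL (α.deriv.superpose p.2) q.2)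
    + (mulLp hab (applyL (β.deriv.superpose p.2) q.2) p.1 + mulLp hab (β.fn.superpose p.2) q.1)

/-- The linearised drift along `(u, X)`. -/
noncomputable def drift (hab : a ≤ b) (α : SmoothCoeff (Icc a b) E E)
    (β : OpCoeff (Icc a b) E U E) (p : Lp U 2 (volume.restrict (Icc a b)) × C(Icc a b, E))
    (r : ℝ) : E →L[ℝ] E :=
  α.deriv (projIcc a b hab r, p.2 (projIcc a b hab r))
    + (β.deriv (projIcc a b hab r, p.2 (projIcc a b hab r))).flip (p.1 r)

/-- The left-hand side of the state equation. -/
noncomputable def stateDefect (hab : a ≤ b) (α : SmoothCoeff (Icc a b) E E)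
    (β : OpCoeff (Icc a b) E U E) (x : E)
    (p : Lp U 2 (volume.restrict (Icc a b)) × C(Icc a b, E)) : C(Icc a b, E) :=
  p.2 - ContinuousMap.const _ x - primL hab (velocity hab α β p)

variable (hab : a ≤ b) (α : SmoothCoeff (Icc a b) E E) (β : OpCoeff (Icc a b) E U E)
  (p q : Lp U 2 (volume.restrict (Icc a b)) × C(Icc a b, E))

theorem coeFn_velocity : velocity hab α β p =ᵐ[volume.restrict (Icc a b)] fun r =>
    α.fn (projIcc a b hab r, p.2 (projIcc a b hab r))
      + β.fn (projIcc a b hab r, p.2 (projIcc a b hab r)) (p.1 r) := by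
  filter_upwards [Lp.coeFn_add (toLpIcc hab 2 (α.fn.superpose p.2))
    (mulLp hab (β.fn.superpose p.2) p.1), coeFn_toLpIcc hab 2 (α.fn.superpose p.2),
    coeFn_mulLp hab (β.fn.superpose p.2) p.1] with r h1 h2 h3
  rw [velocity, h1, Pi.add_apply, h2, h3]
  rfl

theorem coeFn_velocityDeriv : velocityDeriv hab α β p q =ᵐ[volume.restrict (Icc a b)] fun r =>
    drift hab α β p r (q.2 (projIcc a b hab r))
      + β.fn (projIcc a b hab r, p.2 (projIcc a b hab r)) (q.1 r) := by
  filter_upwards [Lp.coeFn_add (toLpIcc hab 2 (applyL (α.deriv.superpose p.2) q.2))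
      (mulLp hab (applyL (β.deriv.superpose p.2) q.2) p.1 + mulLp hab (β.fn.superpose p.2) q.1),
    Lp.coeFn_add (mulLp hab (applyL (β.deriv.superpose p.2) q.2) p.1)
      (mulLp hab (β.fn.superpose p.2) q.1),
    coeFn_toLpIcc hab 2 (applyL (α.deriv.superpose p.2) q.2),
    coeFn_mulLp hab (applyL (β.deriv.superpose p.2) q.2) p.1,
    coeFn_mulLp hab (β.fn.superpose p.2) q.1] with r h1 h2 h3 h4 h5
  rw [velocityDeriv, h1, Pi.add_apply, h2, Pi.add_apply, h3, h4, h5, ← add_assoc]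
  rfl

/-- Bounded bilinear maps, with all topologies given by norms. -/
abbrev BilinMap (V W G : Type*) [NormedAddCommGroup V] [NormedSpace ℝ V]
    [NormedAddCommGroup W] [NormedSpace ℝ W] [NormedAddCommGroup G] [NormedSpace ℝ G] :=
  V →L[ℝ] W →L[ℝ] G

/-- `(M, w) ↦ (e ↦ M e w)`, as a bounded bilinear map. -/
noncomputable def flipL (E F G : Type*) [NormedAddCommGroup E] [NormedSpace ℝ E]
    [NormedAddCommGroup F] [NormedSpace ℝ F] [NormedAddCommGroup G] [NormedSpace ℝ G] :
    BilinMap (E →L[ℝ] F →L[ℝ] G) F (E →L[ℝ] G) :=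
  LinearMap.mkContinuous₂ (LinearMap.mk₂ ℝ (fun (M : E →L[ℝ] F →L[ℝ] G) (v : F) => M.flip v)
    (fun _ _ _ => by ext; simp) (fun _ _ _ => by ext; simp)
    (fun _ _ _ => by ext; simp) (fun _ _ _ => by ext; simp)) 1 (fun M v => by
      rw [one_mul, LinearMap.mk₂_apply]
      exact (M.flip.le_opNorm v).trans_eq (by rw [ContinuousLinearMap.opNorm_flip]))

theorem memLp_drift : SqInt a b (drift hab α β p) := by
  have h1 : SqInt a b (fun r => α.deriv.superpose p.2 (projIcc a b hab r)) :=
    memLp_comp_projIcc (E := E →L[ℝ] E) hab (α.deriv.superpose p.2) 2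
  have h2 : SqInt a b (fun r => flipL E U E (β.deriv.superpose p.2 (projIcc a b hab r)) (p.1 r)) :=
    memLp_bilin_projIcc (E := E →L[ℝ] U →L[ℝ] E) (F := U) (G := E →L[ℝ] E) (flipL E U E) hab
      (β.deriv.superpose p.2) (Lp.memLp p.1)
  exact h1.add h2

theorem contDiff_velocity : ContDiff ℝ 2 (velocity hab α β) := by
  have t0 : ContDiff ℝ 2 fun p : Lp U 2 (volume.restrict (Icc a b)) × C(Icc a b, E) =>
      toLpIcc hab 2 (α.fn.superpose p.2) := α.contDiff_map_snd (toLpIcc hab 2)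
  have t1 : ContDiff ℝ 2 fun p : Lp U 2 (volume.restrict (Icc a b)) × C(Icc a b, E) =>
      mulLp hab (β.fn.superpose p.2) :=
    β.contDiff_map_snd (V := Lp U 2 (volume.restrict (Icc a b)) →L[ℝ]
      Lp E 2 (volume.restrict (Icc a b))) (mulLp hab)
  exact t0.add (t1.clm_apply contDiff_fst)

theorem contDiff_stateDefect (x : E) : ContDiff ℝ 2 (stateDefect hab α β x) :=
  (contDiff_snd.sub contDiff_const).sub ((primL (E := E) hab).contDiff.comp (contDiff_velocity hab α β))

theorem fderiv_velocity : fderiv ℝ (velocity hab α β) p q = velocityDeriv hab α β p q := by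
  refine fderiv_apply_eq_of_hasDerivAt
    ((contDiff_velocity hab α β).differentiable (by norm_num) p) ?_
  have hu : HasDerivAt (fun ε : ℝ => (p + ε • q).1) q.1 0 :=
    (ContinuousLinearMap.fst ℝ _ _).hasFDerivAt.hasDerivAt_line (p := p) q
  have h1 : HasDerivAt (fun ε : ℝ => toLpIcc hab 2 (α.fn.superpose (p + ε • q).2)) _ 0 :=
    α.hasDerivAt_map (toLpIcc hab 2) p.2 q.2
  have h2 : HasDerivAt (fun ε : ℝ => mulLp hab (β.fn.superpose (p + ε • q).2)) _ 0 :=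
    β.hasDerivAt_mulLp hab p.2 q.2
  have H := h1.add (h2.clm_apply hu)
  simp only [zero_smul, add_zero] at H
  exact H

theorem fderiv_stateDefect (x : E) :
    fderiv ℝ (stateDefect hab α β x) p q = q.2 - primL hab (velocityDeriv hab α β p q) := by
  have h1 := ((contDiff_velocity hab α β).differentiable (by norm_num) p).hasFDerivAt
  have h2 : HasFDerivAt (fun p => primL hab (velocity hab α β p)) _ p :=
    (primL (E := E) hab).hasFDerivAt.comp p h1
  have h3 : HasFDerivAt (stateDefect hab α β x) _ p :=
    ((hasFDerivAt_snd (p := p)).sub_const (ContinuousMap.const _ x)).sub h2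
  rw [h3.fderiv]
  simp [fderiv_velocity]

variable [CompleteSpace E]

/-- The invertibility required by the implicit function theorem. The linearised equation is again a
Volterra equation, whose coefficient `drift` is affine in the control and therefore in `L²`. -/
theorem bijective_linearised_state :
    Function.Bijective fun ζ : C(Icc a b, E) =>
      ζ - primL hab (velocityDeriv hab α β p (0, ζ)) := by
  rw [Function.bijective_iff_existsUnique]
  intro g
  have ha : a ∈ Icc a b := left_mem_Icc.2 hab
  have hA := memLp_drift hab α β p
  have hg : IntervalIntegrable (fun r => drift hab α β p r (g (projIcc a b hab r))) volume a b :=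
    intervalIntegrable_bilin (ContinuousLinearMap.id ℝ (E →L[ℝ] E)) hab
      (intervalIntegrable_of_memLp_two hab hA) (by fun_prop)
  have hf := LipschitzField.of_linear hab hA hg
  -- With `ζ = X + g` the equation reads `X = ∫ drift (X + g)`, a Picard fixed point equation with
  -- inhomogeneity `drift g`. No differentiability of `g` is needed.
  have key : ∀ X, picardMap hab ha hf 0 X =
      primL hab (velocityDeriv hab α β p (0, X + g)) := by
    intro X
    ext s
    simp only [picardMap, ContinuousMap.coe_mk, zero_add, primL_apply]
    apply intervalIntegral_congr_ae_Icc ha s.2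
    filter_upwards [coeFn_velocityDeriv hab α β p (0, X + g),
      Lp.coeFn_zero U 2 (volume.restrict (Icc a b))] with r h1 h2
    rw [h1]
    rw [h2]
    simp
  obtain ⟨X, hX, hX'⟩ := existsUnique_picardMap hab ha hf (0 : E)
  refine ⟨X + g, ?_, fun ζ hζ => ?_⟩
  · simp only [← key, hX, add_sub_cancel_left]
  · have := hX' (ζ - g) (by
      simp only [key, sub_add_cancel]
      rw [← hζ]
      simp)
    rw [← this, sub_add_cancel]

theorem isInvertible_fderiv_stateDefect_inr (x : E) :
    (fderiv ℝ (stateDefect hab α β x) p ∘L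
      .inr ℝ (Lp U 2 (volume.restrict (Icc a b))) C(Icc a b, E)).IsInvertible := by
  have hb : Function.Bijective (fderiv ℝ (stateDefect hab α β x) p ∘L
      .inr ℝ (Lp U 2 (volume.restrict (Icc a b))) C(Icc a b, E)) := by
    convert bijective_linearised_state hab α β p using 2 with ζ
    simp [fderiv_stateDefect]
  refine ⟨ContinuousLinearEquiv.ofBijective _ (LinearMap.ker_eq_bot.2 hb.1)
    (LinearMap.range_eq_top.2 hb.2), ?_⟩
  ext1 ζ
  rfl

variable [CompleteSpace U] {hab α β}

/-- Zeros of the state defect are unique for each control, so near `u` the local implicit function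
has to agree with the globally defined `Z`. -/
theorem contDiff_solution {x : E} {Z : Lp U 2 (volume.restrict (Icc a b)) → C(Icc a b, E)}
    (hZ : ∀ u X, stateDefect hab α β x (u, X) = 0 ↔ X = Z u) : ContDiff ℝ 2 Z := by
  rw [contDiff_iff_contDiffAt]
  intro u
  have cd : ContDiffAt ℝ 2 (stateDefect hab α β x) (u, Z u) :=
    (contDiff_stateDefect hab α β x).contDiffAt
  have hi := isInvertible_fderiv_stateDefect_inr hab α β (u, Z u) x
  refine (cd.contDiffAt_implicitFunction two_ne_zero hi).congr_of_eventuallyEq ?_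
  filter_upwards [cd.eventually_apply_implicitFunction two_ne_zero hi] with v hv
  -- The implicit function stays on the level set through `(u, Z u)`, and that level is zero.
  rw [(hZ u (Z u)).2 rfl] at hv
  exact ((hZ _ _).1 hv).symm

/-- Differentiate the identity that the state defect vanishes along `u ↦ (u, Z u)`. -/
theorem fderiv_solution {x : E} {Z : Lp U 2 (volume.restrict (Icc a b)) → C(Icc a b, E)}
    (hZ : ∀ u X, stateDefect hab α β x (u, X) = 0 ↔ X = Z u)
    (u v : Lp U 2 (volume.restrict (Icc a b))) :
    fderiv ℝ Z u v = primL hab (velocityDeriv hab α β (u, Z u) (v, fderiv ℝ Z u v)) := by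
  have hd : HasFDerivAt Z (fderiv ℝ Z u) u :=
    ((contDiff_solution hZ).differentiable (by norm_num) u).hasFDerivAt
  have h1 : HasFDerivAt (fun u => (u, Z u))
      ((ContinuousLinearMap.id ℝ _).prod (fderiv ℝ Z u)) u := (hasFDerivAt_id u).prodMk hd
  have h2 := ((contDiff_stateDefect hab α β x).differentiable (by norm_num)
    (u, Z u)).hasFDerivAt.comp u h1
  have h3 : (stateDefect hab α β x ∘ fun u => (u, Z u)) = fun _ => 0 :=
    funext fun u => (hZ u (Z u)).2 rfl
  rw [h3] at h2
  have h4 := DFunLike.congr_fun (h2.unique (hasFDerivAt_const 0 u)) v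
  have h5 : fderiv ℝ (stateDefect hab α β x) (u, Z u) (v, fderiv ℝ Z u v) = 0 := h4
  rw [fderiv_stateDefect] at h5
  exact sub_eq_zero.1 h5

end StateMap

/-! ### From joint smoothness on the closed strip to derivatives in the state -/

section PartialDerivative

variable {E F G : Type*} [NormedAddCommGroup E] [NormedSpace ℝ E]
  [NormedAddCommGroup F] [NormedSpace ℝ F] [NormedAddCommGroup G] [NormedSpace ℝ G] {t T : ℝ}

/-- Jointly there is only a derivative within the strip, but the slice over a fixed time is the
whole space. The partial derivative in the state is therefore a genuine one, even at the end points
in time. -/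
theorem hasFDerivAt_section {f : ℝ → E → F} {s : ℝ} (hs : s ∈ Icc 0 T)
    (h : DifferentiableOn ℝ (Function.uncurry f) (Icc 0 T ×ˢ univ)) (y : E) :
    HasFDerivAt (f s) ((fderivWithin ℝ (Function.uncurry f) (Icc 0 T ×ˢ univ) (s, y)).comp
      (.inr ℝ ℝ E)) y := by
  have h1 := (h (s, y) ⟨hs, mem_univ y⟩).hasFDerivWithinAt
  have h2 : HasFDerivWithinAt (fun y : E => (s, y)) (.inr ℝ ℝ E) univ y :=
    (hasFDerivAt_prodMk_right s y).hasFDerivWithinAt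
  have h3 := h1.comp y h2 (fun z _ => ⟨hs, mem_univ z⟩)
  exact hasFDerivWithinAt_univ.1 h3

theorem contDiffOn_fderiv_section {f : ℝ → E → F} (hT : 0 < T) {k l : ℕ} (hkl : l + 1 ≤ k)
    (h : ContDiffOn ℝ k (Function.uncurry f) (Icc 0 T ×ˢ univ)) :
    ContDiffOn ℝ l (Function.uncurry fun s y => fderiv ℝ (f s) y) (Icc 0 T ×ˢ univ) := by
  -- Here `0 < T` matters: derivatives within a degenerate strip would not be unique.
  have hu : UniqueDiffOn ℝ (Icc 0 T ×ˢ (univ : Set E)) :=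
    (uniqueDiffOn_Icc hT).prod uniqueDiffOn_univ
  have h1 := h.fderivWithin hu (m := (l : WithTop ℕ∞)) (by exact_mod_cast hkl)
  have h2 : ContDiffOn ℝ l (fun p : ℝ × E =>
      (fderivWithin ℝ (Function.uncurry f) (Icc 0 T ×ˢ univ) p).comp (.inr ℝ ℝ E))
      (Icc 0 T ×ˢ univ) := h1.clm_comp contDiffOn_const
  refine h2.congr fun p hp => ?_
  exact (hasFDerivAt_section hp.1
    (h.differentiableOn (by exact_mod_cast (by omega : k ≠ 0))) p.2).fderiv

theorem continuous_uncurry_of_continuousOn {H : Type*} [TopologicalSpace H] {g : ℝ → E → H}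
    (ht : t ∈ Icc 0 T) (hg : ContinuousOn (Function.uncurry g) (Icc 0 T ×ˢ univ)) :
    Continuous fun p : Icc t T × E => g p.1 p.2 :=
  hg.comp_continuous (f := fun p : Icc t T × E => ((p.1 : ℝ), p.2)) (by fun_prop)
    fun p => ⟨Icc_subset_Icc_left ht.1 p.1.2, mem_univ _⟩

/-- The smooth coefficient given by a jointly twice continuously differentiable function. -/
noncomputable def SmoothCoeff.ofContDiffOn {f : ℝ → E → F} (hT : 0 < T) (ht : t ∈ Icc 0 T)
    (h : ContDiffOn ℝ 2 (Function.uncurry f) (Icc 0 T ×ˢ univ)) : SmoothCoeff (Icc t T) E F :=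
  have h1 := contDiffOn_fderiv_section hT (k := 2) (l := 1) le_rfl h
  have h2 := contDiffOn_fderiv_section hT (k := 1) (l := 0) le_rfl h1
  { fn := ⟨fun p => f p.1 p.2, continuous_uncurry_of_continuousOn ht h.continuousOn⟩
    deriv := ⟨fun p => fderiv ℝ (f p.1) p.2,
      continuous_uncurry_of_continuousOn ht h1.continuousOn⟩
    deriv₂ := ⟨fun p => fderiv ℝ (fderiv ℝ (f p.1)) p.2,
      continuous_uncurry_of_continuousOn ht h2.continuousOn⟩
    hasFDerivAt_fn := fun s y =>
      (hasFDerivAt_section (Icc_subset_Icc_left ht.1 s.2)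
        (h.differentiableOn (by norm_num)) y).differentiableAt.hasFDerivAt
    hasFDerivAt_deriv := fun s y =>
      (hasFDerivAt_section (f := fun s y => fderiv ℝ (f s) y) (Icc_subset_Icc_left ht.1 s.2)
        (h1.differentiableOn (by norm_num)) y).differentiableAt.hasFDerivAt }

end PartialDerivative

/-! ### Sums, compositions and contractions of smooth coefficients -/

section Operations

variable {K : Type*} [TopologicalSpace K]
  {E F G : Type*} [NormedAddCommGroup E] [NormedSpace ℝ E]
  [NormedAddCommGroup F] [NormedSpace ℝ F] [NormedAddCommGroup G] [NormedSpace ℝ G]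

/-- Sum of smooth coefficients. -/
noncomputable def SmoothCoeff.add (f g : SmoothCoeff K E F) : SmoothCoeff K E F where
  fn := f.fn + g.fn
  deriv := f.deriv + g.deriv
  deriv₂ := f.deriv₂ + g.deriv₂
  hasFDerivAt_fn s y := (f.hasFDerivAt_fn s y).add (g.hasFDerivAt_fn s y)
  hasFDerivAt_deriv s y := (f.hasFDerivAt_deriv s y).add (g.hasFDerivAt_deriv s y)

/-- Composition of a smooth coefficient with time dependent linear maps. -/
noncomputable def SmoothCoeff.timeComp (L : CMap K (F →L[ℝ] G)) (f : SmoothCoeff K E F) :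
    SmoothCoeff K E G where
  fn := ⟨fun p => L p.1 (f.fn p), by fun_prop⟩
  deriv := ⟨fun p => (L p.1).comp (f.deriv p),
    (L.continuous.comp continuous_fst).clm_comp f.deriv.continuous⟩
  deriv₂ := ⟨fun p => (ContinuousLinearMap.compL ℝ E F G (L p.1)).comp (f.deriv₂ p),
    ((ContinuousLinearMap.compL ℝ E F G).continuous.comp
      (L.continuous.comp continuous_fst)).clm_comp f.deriv₂.continuous⟩
  hasFDerivAt_fn s y := (L s).hasFDerivAt.comp y (f.hasFDerivAt_fn s y)
  hasFDerivAt_deriv s y :=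
    (ContinuousLinearMap.compL ℝ E F G (L s)).hasFDerivAt.comp y (f.hasFDerivAt_deriv s y)

theorem SmoothCoeff.fderiv_fn_comp (c : SmoothCoeff K E F) (φ : F →L[ℝ] G) (s : K) (y e : E) :
    fderiv ℝ (fun y => φ (c.fn (s, y))) y e = φ (c.deriv (s, y) e) := by
  have h : HasFDerivAt (fun y => φ (c.fn (s, y))) (φ.comp (c.deriv (s, y))) y :=
    φ.hasFDerivAt.comp y (c.hasFDerivAt_fn s y)
  rw [h.fderiv]
  rfl

theorem SmoothCoeff.inner_hess_fn_comp {H : Type*} [NormedAddCommGroup H] [InnerProductSpace ℝ H]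
    [CompleteSpace H] (c : SmoothCoeff K H F) (φ : F →L[ℝ] ℝ) (s : K) (y e e' : H) :
    inner ℝ (hess (fun y => φ (c.fn (s, y))) y e) e' = φ (c.deriv₂ (s, y) e e') := by
  have h : ∀ y, HasFDerivAt (fun y => φ (c.fn (s, y))) (φ.comp (c.deriv (s, y))) y := fun y =>
    φ.hasFDerivAt.comp y (c.hasFDerivAt_fn s y)
  have h' : fderiv ℝ (fun y => φ (c.fn (s, y))) =
      fun y => ContinuousLinearMap.compL ℝ H F ℝ φ (c.deriv (s, y)) :=
    funext fun y => (h y).fderiv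
  have h2 : HasFDerivAt (fderiv ℝ (fun y => φ (c.fn (s, y))))
      ((ContinuousLinearMap.compL ℝ H F ℝ φ).comp (c.deriv₂ (s, y))) y := by
    rw [h']
    exact (ContinuousLinearMap.compL ℝ H F ℝ φ).hasFDerivAt.comp y (c.hasFDerivAt_deriv s y)
  rw [inner_hess_apply h2.differentiableAt, h2.fderiv]
  rfl

end Operations

/-! ### Adjoints and contractions as bounded linear and bilinear maps -/

section Adjoint

variable {E U : Type*} [NormedAddCommGroup E] [InnerProductSpace ℝ E] [CompleteSpace E]
  [NormedAddCommGroup U] [InnerProductSpace ℝ U] [CompleteSpace U]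

/-- Taking adjoints, as a real linear map. -/
noncomputable def adjointL (U E : Type*) [NormedAddCommGroup E] [InnerProductSpace ℝ E]
    [CompleteSpace E] [NormedAddCommGroup U] [InnerProductSpace ℝ U] [CompleteSpace U] :
    (U →L[ℝ] E) →L[ℝ] (E →L[ℝ] U) :=
  LinearMap.mkContinuous
    { toFun := fun M => M†
      map_add' := fun M N => map_add _ M N
      map_smul' := fun c M => by simp } 1 (fun M => by simp)

/-- `(y, M) ↦ M† y`, as a bounded bilinear map. -/
noncomputable def adjointApplyL (U E : Type*) [NormedAddCommGroup E] [InnerProductSpace ℝ E]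
    [CompleteSpace E] [NormedAddCommGroup U] [InnerProductSpace ℝ U] [CompleteSpace U] :
    BilinMap E (U →L[ℝ] E) U :=
  LinearMap.mkContinuous₂ (LinearMap.mk₂ ℝ (fun (y : E) (M : U →L[ℝ] E) => (M†) y)
    (fun _ _ _ => by simp) (fun _ _ _ => by simp)
    (fun _ _ _ => by simp) (fun _ _ _ => by simp)) 1 (fun y M => by
      rw [one_mul, LinearMap.mk₂_apply, mul_comm]
      exact ((M†).le_opNorm y).trans_eq (by simp))

@[simp]
theorem adjointApplyL_apply (y : E) (M : U →L[ℝ] E) : adjointApplyL U E y M = (M†) y := rfl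

/-- `(φ, M) ↦ (e ↦ e' ↦ φ (M e e'))`, as a bounded bilinear map. -/
noncomputable def postL (E W : Type*) [NormedAddCommGroup E] [NormedSpace ℝ E]
    [NormedAddCommGroup W] [NormedSpace ℝ W] :
    BilinMap (W →L[ℝ] ℝ) (E →L[ℝ] E →L[ℝ] W) (E →L[ℝ] E →L[ℝ] ℝ) :=
  LinearMap.mkContinuous₂ (LinearMap.mk₂ ℝ (fun (φ : W →L[ℝ] ℝ) (M : E →L[ℝ] E →L[ℝ] W) =>
      (ContinuousLinearMap.compL ℝ E W ℝ φ).comp M)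
    (fun _ _ _ => by ext; simp) (fun _ _ _ => by ext; simp)
    (fun _ _ _ => by ext; simp) (fun _ _ _ => by ext; simp)) 1 (fun φ M => by
      rw [one_mul, LinearMap.mk₂_apply]
      refine ContinuousLinearMap.opNorm_le_bound₂ _ (by positivity) fun e e' => ?_
      calc ‖φ (M e e')‖ ≤ ‖φ‖ * ‖M e e'‖ := φ.le_opNorm _
        _ ≤ ‖φ‖ * (‖M‖ * ‖e‖ * ‖e'‖) := by gcongr; exact M.le_opNorm₂ e e'
        _ = _ := by ring)

@[simp]
theorem postL_apply {E W : Type*} [NormedAddCommGroup E] [NormedSpace ℝ E]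
    [NormedAddCommGroup W] [NormedSpace ℝ W] (φ : W →L[ℝ] ℝ) (M : E →L[ℝ] E →L[ℝ] W) (e e' : E) :
    postL E W φ M e e' = φ (M e e') := rfl

/-- `(u, u') ↦ (M ↦ ⟪M u, u'⟫)`, as a bounded bilinear map. -/
noncomputable def innerApplyL (U : Type*) [NormedAddCommGroup U] [InnerProductSpace ℝ U] :
    BilinMap U U ((U →L[ℝ] U) →L[ℝ] ℝ) :=
  LinearMap.mkContinuous₂ (LinearMap.mk₂ ℝ (fun (u u' : U) =>
      (innerSL ℝ u').comp (ContinuousLinearMap.apply ℝ U u))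
    (fun _ _ _ => by ext; simp) (fun _ _ _ => by ext; simp)
    (fun _ _ _ => by ext; simp) (fun _ _ _ => by ext; simp)) 1
    (fun u u' => by
      rw [one_mul, LinearMap.mk₂_apply]
      refine ContinuousLinearMap.opNorm_le_bound _ (by positivity) fun M => ?_
      calc ‖inner ℝ u' (M u)‖ ≤ ‖u'‖ * ‖M u‖ := norm_inner_le_norm _ _
        _ ≤ ‖u'‖ * (‖M‖ * ‖u‖) := by gcongr; exact M.le_opNorm u
        _ = _ := by ring)

@[simp]
theorem innerApplyL_apply {U : Type*} [NormedAddCommGroup U] [InnerProductSpace ℝ U] (u u' : U) (M : U →L[ℝ] U) :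
    innerApplyL U u u' M = inner ℝ (M u) u' := real_inner_comm _ _

end Adjoint

/-! ### Global solvability of the state equation -/

section StateEquation

variable {a b : ℝ} {E U : Type*} [NormedAddCommGroup E] [NormedSpace ℝ E]
  [NormedAddCommGroup U] [InnerProductSpace ℝ U]

theorem SolvesODE.congr_field {c : ℝ} {f f' : ℝ → E → E} {z : E} {Z : ℝ → E} (hc : c ∈ Icc a b)
    (hff : ∀ r ∈ Icc a b, ∀ z, f' r z = f r z) (h : SolvesODE f a b c z Z) :
    SolvesODE f' a b c z Z := by
  have := h.eq_integral c hc
  rw [intervalIntegral.integral_same, add_zero] at this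
  rw [← this]
  exact (IsPrimitive.of_solvesODE hc h).solvesODE hc
    ((ae_restrict_iff' measurableSet_Icc).2 (.of_forall fun r hr => hff r hr _))

/-- The vector field of the state equation. -/
noncomputable def stateField (hab : a ≤ b) (α : SmoothCoeff (Icc a b) E E)
    (β : OpCoeff (Icc a b) E U E) (u : ℝ → U) (r : ℝ) (z : E) : E :=
  α.fn (projIcc a b hab r, z) + β.fn (projIcc a b hab r, z) (u r)

variable (hab : a ≤ b) (α : SmoothCoeff (Icc a b) E E) (β : OpCoeff (Icc a b) E U E)

/-- The Lipschitz bound grows linearly with `‖u r‖` and hence is only square integrable in time,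
which is what the class `LipschitzField` is made for. -/
theorem lipschitzField_stateField {LA LB : ℝ}
    (hα : ∀ s y z, ‖α.fn (s, y) - α.fn (s, z)‖ ≤ LA * ‖y - z‖)
    (hβ : ∀ s y z, ‖β.fn (s, y) - β.fn (s, z)‖ ≤ LB * ‖y - z‖)
    (u : Lp U 2 (volume.restrict (Icc a b))) :
    LipschitzField (stateField hab α β u) a b (fun r => LA + LB * ‖u r‖) where
  memLp := (memLp_const LA).add ((Lp.memLp u).norm.const_mul LB)
  lip r _ z z' := by
    have e : stateField hab α β u r z - stateField hab α β u r z' =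
        (α.fn (projIcc a b hab r, z) - α.fn (projIcc a b hab r, z'))
        + (β.fn (projIcc a b hab r, z) - β.fn (projIcc a b hab r, z')) (u r) := by
      simp only [stateField, sub_apply]
      abel
    rw [e, add_mul]
    refine (norm_add_le _ _).trans (add_le_add (hα _ _ _) ?_)
    refine (ContinuousLinearMap.le_opNorm _ _).trans ?_
    rw [mul_right_comm]
    gcongr
    exact hβ _ _ _
  integrable Z hZ := by
    have hp : ContinuousOn (fun r => (projIcc a b hab r, Z r)) (Icc a b) :=
      continuous_projIcc.continuousOn.prodMk hZ
    have h1 : IntervalIntegrable (fun r => α.fn (projIcc a b hab r, Z r)) volume a b := by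
      apply ContinuousOn.intervalIntegrable
      rw [uIcc_of_le hab]
      exact α.fn.continuous.comp_continuousOn hp
    refine h1.add ?_
    exact intervalIntegrable_bilin (F := U →L[ℝ] E)
      (ContinuousLinearMap.flip (ContinuousLinearMap.id ℝ (U →L[ℝ] E))) hab
      (Lp.intervalIntegrable hab u) (β.fn.continuous.comp_continuousOn hp)

/-- This links the two descriptions of a trajectory: smoothness is studied through the state defect,
existence and uniqueness through the Picard operator. -/
theorem stateDefect_eq_sub_picardMap {LA LB : ℝ}
    (hα : ∀ s y z, ‖α.fn (s, y) - α.fn (s, z)‖ ≤ LA * ‖y - z‖)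
    (hβ : ∀ s y z, ‖β.fn (s, y) - β.fn (s, z)‖ ≤ LB * ‖y - z‖)
    (x : E) (u : Lp U 2 (volume.restrict (Icc a b))) (X : C(Icc a b, E)) :
    stateDefect hab α β x (u, X) = X - picardMap hab (left_mem_Icc.2 hab)
      (lipschitzField_stateField hab α β hα hβ u) x X := by
  ext s
  change X s - x - ∫ r in a..s, velocity hab α β (u, X) r =
    X s - (x + ∫ r in a..s, stateField hab α β u r (X (projIcc a b hab r)))
  rw [sub_sub]
  congr 2
  apply intervalIntegral_congr_ae_Icc (left_mem_Icc.2 hab) s.2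
  filter_upwards [coeFn_velocity hab α β (u, X)] with r hr
  exact hr

theorem exists_solution_map [CompleteSpace E] {LA LB : ℝ}
    (hα : ∀ s y z, ‖α.fn (s, y) - α.fn (s, z)‖ ≤ LA * ‖y - z‖)
    (hβ : ∀ s y z, ‖β.fn (s, y) - β.fn (s, z)‖ ≤ LB * ‖y - z‖) (x : E) :
    ∃ Z : Lp U 2 (volume.restrict (Icc a b)) → C(Icc a b, E),
      (∀ u X, stateDefect hab α β x (u, X) = 0 ↔ X = Z u) ∧
      (∀ u : Lp U 2 (volume.restrict (Icc a b)), SolvesODE (stateField hab α β u) a b a x (fun r => Z u (projIcc a b hab r))) ∧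
      ∀ (u : Lp U 2 (volume.restrict (Icc a b))) (W : ℝ → E), SolvesODE (stateField hab α β u) a b a x W →
        EqOn W (fun r => Z u (projIcc a b hab r)) (Icc a b) := by
  have hf := lipschitzField_stateField hab α β hα hβ
  have h := fun u => existsUnique_picardMap hab (left_mem_Icc.2 hab) (hf u) x
  choose Z hZ hZ' using fun u => (h u)
  have hs : ∀ u : Lp U 2 (volume.restrict (Icc a b)), SolvesODE (stateField hab α β u) a b a x (fun r => Z u (projIcc a b hab r)) :=
    fun u => solvesODE_of_isFixedPt hab (left_mem_Icc.2 hab) (hf u) (hZ u)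
  refine ⟨Z, fun u X => ?_, hs, fun u W hW =>
    (hf u).eqOn_of_solvesODE (left_mem_Icc.2 hab) hW (hs u)⟩
  rw [stateDefect_eq_sub_picardMap hab α β hα hβ, sub_eq_zero]
  exact ⟨fun h => hZ' u X h.symm, fun h => by subst h; exact (hZ u).symm⟩

end StateEquation

/-! ### Integral representations of the Bolza functional and its derivatives -/

section Integrals

/-- The function `φ` is integrable on `[a, b]` with integral `c`. -/
structure HasIntervalIntegral (a b : ℝ) (φ : ℝ → ℝ) (c : ℝ) : Prop where
  integrable : IntervalIntegrable φ volume a b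
  integral_eq : ∫ r in a..b, φ r = c

namespace HasIntervalIntegral

variable {a b : ℝ} {φ ψ : ℝ → ℝ} {c d : ℝ}

theorem add (h : HasIntervalIntegral a b φ c) (h' : HasIntervalIntegral a b ψ d) :
    HasIntervalIntegral a b (fun r => φ r + ψ r) (c + d) :=
  ⟨h.integrable.add h'.integrable, by
    rw [intervalIntegral.integral_add h.integrable h'.integrable, h.integral_eq, h'.integral_eq]⟩

theorem const_mul (k : ℝ) (h : HasIntervalIntegral a b φ c) :
    HasIntervalIntegral a b (fun r => k * φ r) (k * c) :=
  ⟨h.integrable.const_mul k, by rw [intervalIntegral.integral_const_mul, h.integral_eq]⟩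

theorem congr (hab : a ≤ b) (h : HasIntervalIntegral a b φ c)
    (hφ : ψ =ᵐ[volume.restrict (Icc a b)] φ) : HasIntervalIntegral a b ψ c := by
  have hi := h.integrable
  refine ⟨?_, ?_⟩
  · rw [intervalIntegrable_iff_integrableOn_Icc_of_le hab] at hi ⊢
    exact Integrable.congr hi hφ.symm
  · rw [← h.integral_eq]
    exact intervalIntegral_congr_ae_Icc (left_mem_Icc.2 hab) (right_mem_Icc.2 hab) hφ

theorem of_eq (h : HasIntervalIntegral a b φ c) (hd : d = c) : HasIntervalIntegral a b φ d :=
  hd ▸ h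

theorem unique (h : HasIntervalIntegral a b φ c) (h' : HasIntervalIntegral a b φ d) : c = d :=
  h.integral_eq.symm.trans h'.integral_eq

end HasIntervalIntegral

variable {a b : ℝ} {E U V : Type*} [NormedAddCommGroup E] [NormedSpace ℝ E]
  [NormedAddCommGroup U] [InnerProductSpace ℝ U] [NormedAddCommGroup V] [InnerProductSpace ℝ V]

theorem hasIntervalIntegral_inner (hab : a ≤ b) (v w : Lp U 2 (volume.restrict (Icc a b))) :
    HasIntervalIntegral a b (fun r => inner ℝ (v r) (w r)) (inner ℝ v w) := by
  refine ⟨?_, ?_⟩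
  · rw [intervalIntegrable_iff_integrableOn_Icc_of_le hab]
    exact L2.integrable_inner v w
  · rw [L2.inner_def, intervalIntegral.integral_of_le hab, integral_Icc_eq_integral_Ioc]

theorem hasIntervalIntegral_integralL (hab : a ≤ b) (X : C(Icc a b, ℝ)) :
    HasIntervalIntegral a b (fun r => X (projIcc a b hab r)) (integralL hab X) :=
  ⟨by apply Continuous.intervalIntegrable; fun_prop, rfl⟩

theorem hasIntervalIntegral_toLpIcc (hab : a ≤ b) (X : C(Icc a b, U))
    (v : Lp U 2 (volume.restrict (Icc a b))) :
    HasIntervalIntegral a b (fun r => inner ℝ (X (projIcc a b hab r)) (v r))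
      (inner ℝ (toLpIcc hab 2 X) v) :=
  (hasIntervalIntegral_inner hab _ v).congr hab (by
    filter_upwards [coeFn_toLpIcc hab 2 X] with r hr
    rw [hr])

theorem hasIntervalIntegral_mulLp (hab : a ≤ b) (M : CMap (Icc a b) (U →L[ℝ] V))
    (u : Lp U 2 (volume.restrict (Icc a b))) (v : Lp V 2 (volume.restrict (Icc a b))) :
    HasIntervalIntegral a b (fun r => inner ℝ (M (projIcc a b hab r) (u r)) (v r))
      (inner ℝ (mulLp hab M u) v) :=
  (hasIntervalIntegral_inner hab _ v).congr hab (by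
    filter_upwards [coeFn_mulLp hab M u] with r hr
    rw [hr])

theorem HasIntervalIntegral.inner_add {φ ψ : ℝ → ℝ} {v v' w : U}
    (h : HasIntervalIntegral a b φ (inner ℝ v w)) (h' : HasIntervalIntegral a b ψ (inner ℝ v' w)) :
    HasIntervalIntegral a b (fun r => φ r + ψ r) (inner ℝ (v + v') w) :=
  (h.add h').of_eq (inner_add_left _ _ _)

variable (hab : a ≤ b) (f₀ : SmoothCoeff (Icc a b) E ℝ)
    (f₁ : SmoothCoeff (Icc a b) E U) (f₂ : OpCoeff (Icc a b) E U U) (g : E → ℝ)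
    (ℓ : C(Icc a b, E) →L[ℝ] ℝ)

theorem hasIntervalIntegral_bolza (u : Lp U 2 (volume.restrict (Icc a b))) (X : C(Icc a b, E)) :
    HasIntervalIntegral a b (fun r => f₀.fn (projIcc a b hab r, X (projIcc a b hab r))
        + inner ℝ (f₁.fn (projIcc a b hab r, X (projIcc a b hab r))) (u r)
        + 1 / 2 * inner ℝ (f₂.fn (projIcc a b hab r, X (projIcc a b hab r)) (u r)) (u r))
      (bolza hab f₀ f₁ f₂ g ℓ (u, X) - g (X ⟨b, right_mem_Icc.2 hab⟩) - ℓ X) := by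
  have h := ((hasIntervalIntegral_integralL hab (f₀.fn.superpose X)).add
    (hasIntervalIntegral_toLpIcc hab (f₁.fn.superpose X) u)).add
    ((hasIntervalIntegral_mulLp hab (f₂.fn.superpose X) u u).const_mul (1 / 2))
  exact h.of_eq (by
    dsimp only [bolza]
    ring)

theorem hasIntervalIntegral_bolzaDeriv_snd (u : Lp U 2 (volume.restrict (Icc a b)))
    (X ζ : C(Icc a b, E)) :
    HasIntervalIntegral a b (fun r =>
        f₀.deriv (projIcc a b hab r, X (projIcc a b hab r)) (ζ (projIcc a b hab r))
        + inner ℝ (f₁.deriv (projIcc a b hab r, X (projIcc a b hab r))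
          (ζ (projIcc a b hab r))) (u r)
        + 1 / 2 * inner ℝ (f₂.deriv (projIcc a b hab r, X (projIcc a b hab r))
          (ζ (projIcc a b hab r)) (u r)) (u r))
      (bolzaDeriv hab f₀ f₁ f₂ g ℓ (u, X) (0, ζ) - fderiv ℝ g (X ⟨b, right_mem_Icc.2 hab⟩)
        (ζ ⟨b, right_mem_Icc.2 hab⟩) - ℓ ζ) := by
  have h := ((hasIntervalIntegral_integralL hab (ContinuousMap.applyL (f₀.deriv.superpose X) ζ)).add
    (hasIntervalIntegral_toLpIcc hab (ContinuousMap.applyL (f₁.deriv.superpose X) ζ) u)).add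
    ((hasIntervalIntegral_mulLp hab (ContinuousMap.applyL (f₂.deriv.superpose X) ζ) u u).const_mul (1 / 2))
  exact h.of_eq (by
    dsimp only [bolzaDeriv]
    simp only [inner_zero_right, map_zero, add_zero, zero_add]
    ring)

/-- The second derivative in the state of the running cost. -/
noncomputable def runningHess (p : Lp U 2 (volume.restrict (Icc a b)) × C(Icc a b, E)) (r : ℝ) :
    E →L[ℝ] E →L[ℝ] ℝ :=
  f₀.deriv₂ (projIcc a b hab r, p.2 (projIcc a b hab r))
    + postL E U (innerSL ℝ (p.1 r)) (f₁.deriv₂ (projIcc a b hab r, p.2 (projIcc a b hab r)))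
    + postL E (U →L[ℝ] U) ((1 / 2 : ℝ) • innerApplyL U (p.1 r) (p.1 r))
      (f₂.deriv₂ (projIcc a b hab r, p.2 (projIcc a b hab r)))

/-- The mixed second derivative of the running cost. -/
noncomputable def runningMixed (p : Lp U 2 (volume.restrict (Icc a b)) × C(Icc a b, E)) (r : ℝ) :
    E →L[ℝ] U :=
  f₁.deriv (projIcc a b hab r, p.2 (projIcc a b hab r))
    + flipL E U U (f₂.deriv (projIcc a b hab r, p.2 (projIcc a b hab r))) (p.1 r)

/-- Symmetry of the quadratic coefficient makes the cross terms of `½⟨f₂ u, u⟩` agree in pairs,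
which absorbs the factor `½`. What remains is the block form of a linear-quadratic problem: a state
Hessian, a mixed term with its transpose, and the control weight. -/
theorem hasIntervalIntegral_bolzaDeriv₂ (p q q' : Lp U 2 (volume.restrict (Icc a b)) × C(Icc a b, E))
    (h₂ : ∀ s y u v, inner ℝ (f₂.fn (s, y) u) v = inner ℝ u (f₂.fn (s, y) v)) :
    HasIntervalIntegral a b (fun r =>
        runningHess hab f₀ f₁ f₂ p r (q.2 (projIcc a b hab r)) (q'.2 (projIcc a b hab r))
        + inner ℝ (runningMixed hab f₁ f₂ p r (q.2 (projIcc a b hab r))) (q'.1 r)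
        + inner ℝ (q.1 r) (runningMixed hab f₁ f₂ p r (q'.2 (projIcc a b hab r)))
        + inner ℝ (f₂.fn (projIcc a b hab r, p.2 (projIcc a b hab r)) (q.1 r)) (q'.1 r))
      (bolzaDeriv₂ hab f₀ f₁ f₂ g p q q' - fderiv ℝ (fderiv ℝ g) (p.2 ⟨b, right_mem_Icc.2 hab⟩)
        (q.2 ⟨b, right_mem_Icc.2 hab⟩) (q'.2 ⟨b, right_mem_Icc.2 hab⟩)) := by
  -- Symmetry passes to the state derivative by differentiating the scalar identity `⟪f₂ u, v⟫ = ⟪u,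
  -- f₂ v⟫` in the state.
  have h₂' : ∀ s y e u v, inner ℝ (f₂.deriv (s, y) e u) v = inner ℝ u (f₂.deriv (s, y) e v) := by
    intro s y e u v
    have h1 := f₂.fderiv_fn_comp (innerApplyL U u v) s y e
    have h2 := f₂.fderiv_fn_comp (innerApplyL U v u) s y e
    simp only [innerApplyL_apply] at h1 h2
    rw [← h1, real_inner_comm, ← h2]
    congr 2
    ext y
    rw [h₂, real_inner_comm]
  have h := ((hasIntervalIntegral_integralL hab
      (ContinuousMap.applyL (ContinuousMap.applyL (f₀.deriv₂.superpose p.2) q.2) q'.2)).add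
    ((hasIntervalIntegral_toLpIcc hab (ContinuousMap.applyL (f₁.deriv.superpose p.2) q.2) q'.1).add
    ((hasIntervalIntegral_toLpIcc hab (ContinuousMap.applyL (f₁.deriv.superpose p.2) q'.2) q.1).add
     (hasIntervalIntegral_toLpIcc hab
      (ContinuousMap.applyL (ContinuousMap.applyL (f₁.deriv₂.superpose p.2) q.2) q'.2) p.1)))).add
    ((((hasIntervalIntegral_mulLp hab (ContinuousMap.applyL (f₂.deriv.superpose p.2) q.2) p.1
      q'.1).inner_add
      (hasIntervalIntegral_mulLp hab (f₂.fn.superpose p.2) q.1 q'.1)).add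
     (((hasIntervalIntegral_mulLp hab (ContinuousMap.applyL (f₂.deriv.superpose p.2) q'.2) p.1
      q.1).inner_add
      (hasIntervalIntegral_mulLp hab (f₂.fn.superpose p.2) q'.1 q.1)).add
     (((hasIntervalIntegral_mulLp hab
          (ContinuousMap.applyL (ContinuousMap.applyL (f₂.deriv₂.superpose p.2) q.2) q'.2) p.1 p.1).inner_add
        (hasIntervalIntegral_mulLp hab (ContinuousMap.applyL (f₂.deriv.superpose p.2) q'.2) q.1 p.1)).inner_add
        (hasIntervalIntegral_mulLp hab (ContinuousMap.applyL (f₂.deriv.superpose p.2) q.2) q'.1 p.1)))).const_mul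
      (1 / 2))
  refine (h.of_eq (by
    rw [bolzaDeriv₂, add_sub_cancel_right])).congr hab (.of_forall fun r => ?_)
  simp only [runningHess, runningMixed, add_apply, ContinuousMap.applyL_apply, ContinuousMap.superpose_apply, postL_apply,
    inner_add_left, inner_add_right, smul_apply, smul_eq_mul, innerSL_apply_apply]
  have hf : ∀ (M : E →L[ℝ] U →L[ℝ] U) (e : E) (v : U), flipL E U U M v e = M e v :=
    fun _ _ _ => rfl
  simp only [hf]
  set s := projIcc a b hab r
  have k1 := h₂' s (p.2 s) (q'.2 s) (q.1 r) (p.1 r)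
  have k2 := h₂' s (p.2 s) (q.2 s) (q'.1 r) (p.1 r)
  have k3 := h₂' s (p.2 s) (q'.2 s) (p.1 r) (q.1 r)
  have k4 := h₂ s (p.2 s) (q'.1 r) (q.1 r)
  have c1 := real_inner_comm (f₁.deriv (s, p.2 s) (q'.2 s)) (q.1 r)
  have c2 := real_inner_comm (p.1 r) (f₂.deriv (s, p.2 s) (q'.2 s) (q.1 r))
  have c3 := real_inner_comm (p.1 r) (f₁.deriv₂ (s, p.2 s) (q.2 s) (q'.2 s))
  have c4 := real_inner_comm (q'.1 r) (f₂.deriv (s, p.2 s) (q.2 s) (p.1 r))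
  have c5 := real_inner_comm (q'.1 r) (f₂.fn (s, p.2 s) (q.1 r))
  have k5 : innerApplyL U (p.1 r) (p.1 r) (f₂.deriv₂ (s, p.2 s) (q.2 s) (q'.2 s)) =
      inner ℝ (f₂.deriv₂ (s, p.2 s) (q.2 s) (q'.2 s) (p.1 r)) (p.1 r) := innerApplyL_apply _ _ _
  linarith

end Integrals

theorem IsPrimitive.inner {a b : ℝ} {E : Type*} [NormedAddCommGroup E] [InnerProductSpace ℝ E]
    [CompleteSpace E] {φ φ' ψ ψ' : ℝ → E} (hφ : IsPrimitive a b φ φ') (hψ : IsPrimitive a b ψ ψ')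
    (hab : a ≤ b) :
    IsPrimitive a b (fun s => inner ℝ (φ s) (ψ s))
      (fun s => inner ℝ (φ' s) (ψ s) + inner ℝ (φ s) (ψ' s)) :=
  IsPrimitive.bilin (innerSL ℝ) hφ hψ hab

/-! ### The Lagrangian and the elimination of the second derivative of the state -/

section Lagrangian

variable {a b : ℝ} {E U : Type*} [NormedAddCommGroup E] [InnerProductSpace ℝ E] [CompleteSpace E]
  [NormedAddCommGroup U] [InnerProductSpace ℝ U] [CompleteSpace U]
  (hab : a ≤ b) (α : SmoothCoeff (Icc a b) E E) (β : OpCoeff (Icc a b) E U E)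
  (f₀ : SmoothCoeff (Icc a b) E ℝ) (f₁ : SmoothCoeff (Icc a b) E U) (f₂ : OpCoeff (Icc a b) E U U)
  (g : E → ℝ) (Y : C(Icc a b, E))

/-- The control free part of the Hamiltonian with adjoint state `Y`. -/
noncomputable def hamilton₀ : SmoothCoeff (Icc a b) E ℝ :=
  f₀.add (α.timeComp ⟨fun s => innerSL ℝ (Y s), (innerSL ℝ).continuous.comp Y.continuous⟩)

/-- The part of the Hamiltonian with adjoint state `Y` that is linear in the control. -/
noncomputable def hamilton₁ : SmoothCoeff (Icc a b) E U :=
  f₁.add (SmoothCoeff.timeComp (F := U →L[ℝ] E)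
    ⟨fun s => adjointApplyL U E (Y s), (adjointApplyL U E).continuous.comp Y.continuous⟩ β)

theorem hamilton₀_fn (s : Icc a b) (y : E) :
    (hamilton₀ α f₀ Y).fn (s, y) = f₀.fn (s, y) + inner ℝ (Y s) (α.fn (s, y)) := rfl

theorem hamilton₁_fn (s : Icc a b) (y : E) :
    (hamilton₁ β f₁ Y).fn (s, y) = f₁.fn (s, y) + (β.fn (s, y)†) (Y s) := rfl

theorem hamilton₀_deriv (s : Icc a b) (y e : E) :
    (hamilton₀ α f₀ Y).deriv (s, y) e = f₀.deriv (s, y) e + inner ℝ (Y s) (α.deriv (s, y) e) := rfl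

theorem hamilton₁_deriv (s : Icc a b) (y e : E) :
    (hamilton₁ β f₁ Y).deriv (s, y) e = f₁.deriv (s, y) e + (β.deriv (s, y) e†) (Y s) := rfl

variable {hab α β f₀ f₁ f₂ g Y} {x : E} {Z : Lp U 2 (volume.restrict (Icc a b)) → C(Icc a b, E)}

theorem isPrimitive_solution (hZ : ∀ u X, stateDefect hab α β x (u, X) = 0 ↔ X = Z u)
    (u : Lp U 2 (volume.restrict (Icc a b))) :
    IsPrimitive a b (fun s => Z u (projIcc a b hab s)) (fun r =>
      α.fn (projIcc a b hab r, Z u (projIcc a b hab r))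
        + β.fn (projIcc a b hab r, Z u (projIcc a b hab r)) (u r)) ∧
    Z u ⟨a, left_mem_Icc.2 hab⟩ = x := by
  have h := (hZ u (Z u)).2 rfl
  have ha := left_mem_Icc.2 hab
  have h' : ∀ s : Icc a b, Z u s = x + ∫ r in a..s, velocity hab α β (u, Z u) r := fun s => by
    have := DFunLike.congr_fun h s
    change Z u s - x - ∫ r in a..s, velocity hab α β (u, Z u) r = 0 at this
    rwa [sub_sub, sub_eq_zero] at this
  have hx : Z u ⟨a, ha⟩ = x := by simp [h' ⟨a, ha⟩]
  refine ⟨IsPrimitive.congr (φ' := velocity hab α β (u, Z u)) ⟨Lp.intervalIntegrable hab _,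
    fun s hs => ?_⟩ (fun _ _ => rfl) hab (coeFn_velocity hab α β (u, Z u)).symm, hx⟩
  rw [projIcc_of_mem hab hs, projIcc_of_mem hab ha, h' ⟨s, hs⟩, hx]

theorem isPrimitive_fderiv_solution (hZ : ∀ u X, stateDefect hab α β x (u, X) = 0 ↔ X = Z u)
    (u v : Lp U 2 (volume.restrict (Icc a b))) :
    IsPrimitive a b (fun s => fderiv ℝ Z u v (projIcc a b hab s)) (fun r =>
      drift hab α β (u, Z u) r (fderiv ℝ Z u v (projIcc a b hab r))
        + β.fn (projIcc a b hab r, Z u (projIcc a b hab r)) (v r)) ∧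
    fderiv ℝ Z u v ⟨a, left_mem_Icc.2 hab⟩ = 0 := by
  have h := fderiv_solution hZ u v
  have ha := left_mem_Icc.2 hab
  set ζ := fderiv ℝ Z u v
  have h' : ∀ s : Icc a b, ζ s = ∫ r in a..s, velocityDeriv hab α β (u, Z u) (v, ζ) r := fun s =>
    DFunLike.congr_fun h s
  have hx : ζ ⟨a, ha⟩ = 0 := by simp [h' ⟨a, ha⟩]
  refine ⟨IsPrimitive.congr (φ' := velocityDeriv hab α β (u, Z u) (v, ζ))
    ⟨Lp.intervalIntegrable hab _,
    fun s hs => ?_⟩ (fun _ _ => rfl) hab (coeFn_velocityDeriv hab α β (u, Z u) (v, ζ)).symm, hx⟩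
  rw [projIcc_of_mem hab hs, projIcc_of_mem hab ha, h' ⟨s, hs⟩, hx, zero_add]

/-- Adding the state equation tested with the fixed curve `Y` changes the functional only by a
constant along trajectories. The adjoint equation makes the new functional stationary in the state
at `(u, Z u)`, so its second derivative involves only the first derivative of `Z`. -/
theorem inner_hess_bolza (hZ : ∀ u X, stateDefect hab α β x (u, X) = 0 ↔ X = Z u)
    (hg : ContDiff ℝ 2 g) {u : Lp U 2 (volume.restrict (Icc a b))} {Y' : ℝ → E}
    (hY : IsPrimitive a b (fun s => Y (projIcc a b hab s)) Y')
    (hY' : ∀ᵐ r ∂volume.restrict (Icc a b), ∀ e, inner ℝ (Y' r) e =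
      -((hamilton₀ α f₀ Y).deriv (projIcc a b hab r, Z u (projIcc a b hab r)) e
        + inner ℝ ((hamilton₁ β f₁ Y).deriv (projIcc a b hab r, Z u (projIcc a b hab r)) e) (u r)
        + 1 / 2 * inner ℝ (f₂.deriv (projIcc a b hab r, Z u (projIcc a b hab r)) e (u r)) (u r)))
    (hYb : ∀ e, inner ℝ (Y ⟨b, right_mem_Icc.2 hab⟩) e =
      fderiv ℝ g (Z u ⟨b, right_mem_Icc.2 hab⟩) e)
    (v w : Lp U 2 (volume.restrict (Icc a b))) :
    inner ℝ (hess (fun u => bolza hab f₀ f₁ f₂ g 0 (u, Z u)) u v) w =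
      bolzaDeriv₂ hab (hamilton₀ α f₀ Y) (hamilton₁ β f₁ Y) f₂ g (u, Z u)
        (v, fderiv ℝ Z u v) (w, fderiv ℝ Z u w) := by
  have hZd := contDiff_solution hZ
  have ha : a ∈ Icc a b := left_mem_Icc.2 hab
  have hb : b ∈ Icc a b := right_mem_Icc.2 hab
  set F₀ := hamilton₀ α f₀ Y with hF₀
  set F₁ := hamilton₁ β f₁ Y with hF₁
  -- The linear term is defined so as to cancel the state derivative at `(u, Z u)`; stationarity
  -- then holds by construction, and the adjoint equation is needed only to identify `ℓ`.
  set ℓ : C(Icc a b, E) →L[ℝ] ℝ := -((fderiv ℝ (bolza hab F₀ F₁ f₂ g 0) (u, Z u)).comp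
    (.inr ℝ _ _)) with hℓ
  have hℓ' : ∀ ζ, ℓ ζ = -bolzaDeriv hab F₀ F₁ f₂ g 0 (u, Z u) (0, ζ) := fun ζ => by
    rw [← fderiv_bolza hg]
    rfl
  -- By the adjoint equation and its terminal value, `ℓ X = ∫ ⟪Y', X⟫ - ⟪Y b, X b⟫`.
  have hint : ∀ X : C(Icc a b, E), HasIntervalIntegral a b
      (fun r => inner ℝ (Y' r) (X (projIcc a b hab r)))
      (ℓ X + inner ℝ (Y ⟨b, hb⟩) (X ⟨b, hb⟩)) := fun X => by
    have h := (hasIntervalIntegral_bolzaDeriv_snd hab F₀ F₁ f₂ g 0 u (Z u) X).const_mul (-1)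
    refine (h.of_eq ?_).congr hab ?_
    · rw [hℓ', hYb, zero_apply]
      ring
    · filter_upwards [hY'] with r hr
      rw [hr, neg_one_mul]
  -- For every control, integrating `⟪Y, X⟫'` gives `⟪Y b, X b⟫ - ⟪Y a, x⟫`. The extra Hamiltonian
  -- terms and `ℓ` thus add up to `-⟪Y a, x⟫`, which does not depend on the control.
  have hJ : ∀ u, bolza hab f₀ f₁ f₂ g 0 (u, Z u) =
      bolza hab F₀ F₁ f₂ g ℓ (u, Z u) + inner ℝ (Y ⟨a, ha⟩) x := by
    intro u'
    obtain ⟨hX, hXa⟩ := isPrimitive_solution hZ u'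
    have hp := (hY.inner hX hab).sub_eq ha hb
    simp only [projIcc_of_mem hab ha, projIcc_of_mem hab hb, hXa] at hp
    have h1 := hasIntervalIntegral_bolza hab f₀ f₁ f₂ g 0 u' (Z u')
    have h2 := hasIntervalIntegral_bolza hab F₀ F₁ f₂ g ℓ u' (Z u')
    have h3 := (h1.add ⟨(hY.inner hX hab).integrable, rfl⟩)
    have h4 := h2.add (hint (Z u'))
    have h5 := h3.unique (h4.congr hab (.of_forall fun r => by
      simp only [hF₀, hF₁, hamilton₀_fn, hamilton₁_fn, inner_add_left,
        inner_add_right, ContinuousLinearMap.adjoint_inner_left]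
      ring))
    rw [← hp, zero_apply] at h5
    linarith
  have hJ' : (fun u => bolza hab f₀ f₁ f₂ g 0 (u, Z u)) = fun u =>
      bolza hab F₀ F₁ f₂ g ℓ (u, Z u) + inner ℝ (Y ⟨a, ha⟩) x := funext hJ
  have hd : ContDiff ℝ 2 fun u => bolza hab F₀ F₁ f₂ g ℓ (u, Z u) :=
    (contDiff_bolza hg).comp (contDiff_id.prodMk hZd)
  have hfd : fderiv ℝ (fun u => bolza hab f₀ f₁ f₂ g 0 (u, Z u)) =
      fderiv ℝ fun u => bolza hab F₀ F₁ f₂ g ℓ (u, Z u) := by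
    rw [hJ']
    exact funext fun u => fderiv_add_const _
  have hdd : DifferentiableAt ℝ (fderiv ℝ fun u => bolza hab F₀ F₁ f₂ g ℓ (u, Z u)) u :=
    (hd.fderiv_right (m := 1) (by norm_num)).differentiable (by norm_num) u
  rw [inner_hess_apply (by rw [hfd]; exact hdd), hfd,
    fderiv_fderiv_comp_prodMk_of_stationary (contDiff_bolza hg) hZd, fderiv_fderiv_bolza hg]
  intro η
  have h0 : bolzaDeriv hab F₀ F₁ f₂ g ℓ (u, Z u) (0, η) =
      bolzaDeriv hab F₀ F₁ f₂ g 0 (u, Z u) (0, η) + ℓ η := by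
    simp [bolzaDeriv]
  rw [fderiv_bolza hg, h0, hℓ', add_neg_cancel]

end Lagrangian

/-! ### Integrability of products in time -/

section MemLp

variable {a b : ℝ} {E F G : Type*} [NormedAddCommGroup E] [NormedSpace ℝ E]
  [NormedAddCommGroup F] [NormedSpace ℝ F] [NormedAddCommGroup G] [NormedSpace ℝ G]

theorem ContinuousOn.memLp_Icc {f : ℝ → E} (hf : ContinuousOn f (Icc a b)) (p : ENNReal) :
    MemLp f p (volume.restrict (Icc a b)) := by
  obtain ⟨C, hC⟩ := isCompact_Icc.exists_bound_of_continuousOn hf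
  exact MemLp.of_bound (hf.aestronglyMeasurable measurableSet_Icc) C
    ((ae_restrict_iff' measurableSet_Icc).2 (.of_forall hC))

theorem SqInt.bilin_continuousOn (L : E →L[ℝ] F →L[ℝ] G) {f : ℝ → E} {g : ℝ → F}
    (hf : SqInt a b f) (hg : ContinuousOn g (Icc a b)) : SqInt a b (fun r => L (f r) (g r)) :=
  L.memLp_of_bilin 2 hf (hg.memLp_Icc ⊤)

theorem SqInt.intervalIntegrable_bilin (L : E →L[ℝ] F →L[ℝ] G) {f : ℝ → E} {g : ℝ → F} (hab : a ≤ b)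
    (hf : SqInt a b f) (hg : SqInt a b g) :
    IntervalIntegrable (fun r => L (f r) (g r)) volume a b := by
  rw [intervalIntegrable_iff_integrableOn_Icc_of_le hab]
  exact memLp_one_iff_integrable.1 (L.memLp_of_bilin 1 hf hg)

end MemLp

section Costate

variable {a b : ℝ} {E U : Type*} [NormedAddCommGroup E] [NormedSpace ℝ E]
  [NormedAddCommGroup U] [InnerProductSpace ℝ U]
  (hab : a ≤ b) (f₀ : SmoothCoeff (Icc a b) E ℝ) (f₁ : SmoothCoeff (Icc a b) E U)
  (f₂ : OpCoeff (Icc a b) E U U) (p : Lp U 2 (volume.restrict (Icc a b)) × C(Icc a b, E))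

theorem memLp_runningMixed : SqInt a b (runningMixed hab f₁ f₂ p) := by
  have h1 : SqInt a b (fun r => f₁.deriv.superpose p.2 (projIcc a b hab r)) :=
    memLp_comp_projIcc (E := E →L[ℝ] U) hab (f₁.deriv.superpose p.2) 2
  have h2 : SqInt a b (fun r => flipL E U U (f₂.deriv.superpose p.2 (projIcc a b hab r)) (p.1 r)) :=
    memLp_bilin_projIcc (E := E →L[ℝ] U →L[ℝ] U) (F := U) (G := E →L[ℝ] U) (flipL E U U) hab
      (f₂.deriv.superpose p.2) (Lp.memLp p.1)
  exact h1.add h2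

/-- Interval integrability, with the topology of the target given by a norm. -/
abbrev NormIntegrable {V : Type*} [NormedAddCommGroup V] (a b : ℝ) (f : ℝ → V) : Prop :=
  IntervalIntegrable f volume a b

theorem NormIntegrable.const_smul {V : Type*} [NormedAddCommGroup V] [NormedSpace ℝ V] (c : ℝ)
    {f : ℝ → V} (hf : NormIntegrable a b f) : NormIntegrable a b (fun r => c • f r) :=
  IntervalIntegrable.smul hf c

theorem NormIntegrable.clm {V W : Type*} [NormedAddCommGroup V] [NormedSpace ℝ V]
    [NormedAddCommGroup W] [NormedSpace ℝ W] (L : V →L[ℝ] W)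
    {f : ℝ → V} (hf : NormIntegrable a b f) : NormIntegrable a b (fun r => L (f r)) :=
  ⟨L.integrable_comp hf.1, L.integrable_comp hf.2⟩

theorem normIntegrable_postL {W : Type*} [NormedAddCommGroup W] [NormedSpace ℝ W]
    {f : ℝ → W →L[ℝ] ℝ} (hf : NormIntegrable a b f) (X : CMap (Icc a b) (E →L[ℝ] E →L[ℝ] W)) :
    NormIntegrable a b (fun r => postL E W (f r) (X (projIcc a b hab r))) :=
  intervalIntegrable_bilin (postL E W) hab hf (X.continuous.comp continuous_projIcc).continuousOn

/-- The Hessian is quadratic in the control through `f₂`, so it is only integrable in time, whereas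
the drift and the mixed term are square integrable. -/
theorem normIntegrable_runningHess : NormIntegrable a b (runningHess hab f₀ f₁ f₂ p) := by
  have h0 : NormIntegrable a b (fun r => f₀.deriv₂.superpose p.2 (projIcc a b hab r)) :=
    intervalIntegrable_of_memLp_two hab (memLp_comp_projIcc (E := E →L[ℝ] E →L[ℝ] ℝ) hab
      (f₀.deriv₂.superpose p.2) 2)
  have i1 : NormIntegrable a b (fun r => innerSL ℝ (p.1 r)) :=
    NormIntegrable.clm (innerSL ℝ) (Lp.intervalIntegrable hab p.1)
  have h1 := normIntegrable_postL hab i1 (f₁.deriv₂.superpose p.2)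
  have i2 : NormIntegrable a b (fun r => (1 / 2 : ℝ) • innerApplyL U (p.1 r) (p.1 r)) :=
    NormIntegrable.const_smul (1 / 2 : ℝ) (SqInt.intervalIntegrable_bilin (innerApplyL U) hab
      (Lp.memLp p.1) (Lp.memLp p.1))
  have h2 := normIntegrable_postL hab i2 (f₂.deriv₂.superpose p.2)
  exact (h0.add h1).add h2

end Costate

/-! ### The Hessian represented by a second costate -/

section HessianFormula

variable {a b : ℝ} {E U : Type*} [NormedAddCommGroup E] [InnerProductSpace ℝ E] [CompleteSpace E]
  [NormedAddCommGroup U] [InnerProductSpace ℝ U] [CompleteSpace U]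
  {hab : a ≤ b} {α : SmoothCoeff (Icc a b) E E} {β : OpCoeff (Icc a b) E U E}
  {f₀ : SmoothCoeff (Icc a b) E ℝ} {f₁ : SmoothCoeff (Icc a b) E U} {f₂ : OpCoeff (Icc a b) E U U}
  {g : E → ℝ} {Y : C(Icc a b, E)} {x : E} {Z : Lp U 2 (volume.restrict (Icc a b)) → C(Icc a b, E)}

/-- The test direction `w` enters the Hessian form also through its linearised state. Integrating
the derivative of `⟪l, Z'(u) w⟫` trades those terms for `⟪l, β w⟫`, because `l` solves the adjoint
linearised equation with matching terminal value. Everything is then an `L²` product with `w`. -/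
theorem hess_bolza_ae_eq (hZ : ∀ u X, stateDefect hab α β x (u, X) = 0 ↔ X = Z u)
    (hg : ContDiff ℝ 2 g) {u : Lp U 2 (volume.restrict (Icc a b))} {Y' : ℝ → E}
    (hY : IsPrimitive a b (fun s => Y (projIcc a b hab s)) Y')
    (hY' : ∀ᵐ r ∂volume.restrict (Icc a b), ∀ e, inner ℝ (Y' r) e =
      -((hamilton₀ α f₀ Y).deriv (projIcc a b hab r, Z u (projIcc a b hab r)) e
        + inner ℝ ((hamilton₁ β f₁ Y).deriv (projIcc a b hab r, Z u (projIcc a b hab r)) e) (u r)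
        + 1 / 2 * inner ℝ (f₂.deriv (projIcc a b hab r, Z u (projIcc a b hab r)) e (u r)) (u r)))
    (hYb : ∀ e, inner ℝ (Y ⟨b, right_mem_Icc.2 hab⟩) e =
      fderiv ℝ g (Z u ⟨b, right_mem_Icc.2 hab⟩) e)
    (h₂ : ∀ s y u v, inner ℝ (f₂.fn (s, y) u) v = inner ℝ u (f₂.fn (s, y) v))
    (v : Lp U 2 (volume.restrict (Icc a b))) {l l' : ℝ → E} (hl : IsPrimitive a b l l')
    (hl' : ∀ᵐ r ∂volume.restrict (Icc a b), ∀ e, inner ℝ (l' r) e =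
      -(inner ℝ (l r) (drift hab α β (u, Z u) r e)
        + runningHess hab (hamilton₀ α f₀ Y) (hamilton₁ β f₁ Y) f₂ (u, Z u) r
          (fderiv ℝ Z u v (projIcc a b hab r)) e
        + inner ℝ (v r) (runningMixed hab (hamilton₁ β f₁ Y) f₂ (u, Z u) r e)))
    (hlb : ∀ e, inner ℝ (l b) e = fderiv ℝ (fderiv ℝ g) (Z u ⟨b, right_mem_Icc.2 hab⟩)
      (fderiv ℝ Z u v ⟨b, right_mem_Icc.2 hab⟩) e) :
    hess (fun u => bolza hab f₀ f₁ f₂ g 0 (u, Z u)) u v =ᵐ[volume.restrict (Icc a b)] fun r =>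
      f₂.fn (projIcc a b hab r, Z u (projIcc a b hab r)) (v r)
        + (runningMixed hab (hamilton₁ β f₁ Y) f₂ (u, Z u) r (fderiv ℝ Z u v (projIcc a b hab r))
          + (β.fn (projIcc a b hab r, Z u (projIcc a b hab r))†) (l r)) := by
  have ha : a ∈ Icc a b := left_mem_Icc.2 hab
  have hb : b ∈ Icc a b := right_mem_Icc.2 hab
  have m1 : MemLp (fun r => f₂.fn (projIcc a b hab r, Z u (projIcc a b hab r)) (v r)) 2
      (volume.restrict (Icc a b)) :=
    (memLp_congr_ae (coeFn_mulLp hab (f₂.fn.superpose (Z u)) v)).1 (Lp.memLp _)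
  have m2 : SqInt a b (fun r => runningMixed hab (hamilton₁ β f₁ Y) f₂ (u, Z u) r
      (fderiv ℝ Z u v (projIcc a b hab r))) :=
    SqInt.bilin_continuousOn (ContinuousLinearMap.id ℝ (E →L[ℝ] U))
      (memLp_runningMixed hab (hamilton₁ β f₁ Y) f₂ (u, Z u))
      (((fderiv ℝ Z u v).continuous.comp continuous_projIcc).continuousOn)
  have m3 : MemLp (fun r => adjointApplyL U E (l r) (β.fn.superpose (Z u) (projIcc a b hab r))) 2
      (volume.restrict (Icc a b)) :=
    SqInt.bilin_continuousOn (F := U →L[ℝ] E) (adjointApplyL U E) (hl.continuousOn.memLp_Icc 2)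
      (((β.fn.superpose (Z u)).continuous.comp continuous_projIcc).continuousOn)
  set D : ℝ → U := fun r => f₂.fn (projIcc a b hab r, Z u (projIcc a b hab r)) (v r)
    + (runningMixed hab (hamilton₁ β f₁ Y) f₂ (u, Z u) r (fderiv ℝ Z u v (projIcc a b hab r))
      + (β.fn (projIcc a b hab r, Z u (projIcc a b hab r))†) (l r)) with hD
  have m : MemLp D 2 (volume.restrict (Icc a b)) := m1.add (m2.add m3)
  suffices hess (fun u => bolza hab f₀ f₁ f₂ g 0 (u, Z u)) u v = m.toLp D by
    rw [this]
    exact m.coeFn_toLp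
  refine ext_inner_right ℝ fun w => ?_
  rw [inner_hess_bolza hZ hg hY hY' hYb]
  obtain ⟨hζ, hζa⟩ := isPrimitive_fderiv_solution hZ u w
  have hp := hl.inner hζ hab
  have hs := hp.sub_eq ha hb
  simp only [projIcc_of_mem hab ha, projIcc_of_mem hab hb, hζa, inner_zero_right, sub_zero, hlb] at hs
  have h1 := hasIntervalIntegral_bolzaDeriv₂ hab (hamilton₀ α f₀ Y) (hamilton₁ β f₁ Y) f₂ g
    (u, Z u) (v, fderiv ℝ Z u v) (w, fderiv ℝ Z u w) h₂
  have h1' := h1.add ⟨hp.integrable, rfl⟩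
  have h2 : HasIntervalIntegral a b (fun r => inner ℝ (D r) (w r)) (inner ℝ (m.toLp D) w) :=
    (hasIntervalIntegral_inner hab (m.toLp D) w).congr hab (by
      filter_upwards [m.coeFn_toLp] with r hr
      rw [hr])
  have h3 := h1'.unique (h2.congr hab (by
    filter_upwards [hl'] with r hr'
    simp only [hD, hr', inner_add_left, inner_add_right, ContinuousLinearMap.adjoint_inner_left]
    ring))
  rw [← h3, ← hs]
  ring

end HessianFormula

/-! ### Composition of operators as a bilinear map -/

section Composition

/-- Composition of bounded operators, as a bounded bilinear map. -/
noncomputable def compB (E F G : Type*) [NormedAddCommGroup E] [NormedSpace ℝ E]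
    [NormedAddCommGroup F] [NormedSpace ℝ F] [NormedAddCommGroup G] [NormedSpace ℝ G] :
    BilinMap (F →L[ℝ] G) (E →L[ℝ] F) (E →L[ℝ] G) :=
  LinearMap.mkContinuous₂ (LinearMap.mk₂ ℝ (fun (M : F →L[ℝ] G) (N : E →L[ℝ] F) => M.comp N)
    (fun _ _ _ => by ext; simp) (fun _ _ _ => by ext; simp)
    (fun _ _ _ => by ext; simp) (fun _ _ _ => by ext; simp)) 1 (fun M N => by
      rw [one_mul, LinearMap.mk₂_apply]
      exact M.opNorm_comp_le N)

/-- `(M, N) ↦ -(N ∘ M)`, as a bounded bilinear map. -/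
noncomputable def negCompB (E F G : Type*) [NormedAddCommGroup E] [NormedSpace ℝ E]
    [NormedAddCommGroup F] [NormedSpace ℝ F] [NormedAddCommGroup G] [NormedSpace ℝ G] :
    BilinMap (E →L[ℝ] F) (F →L[ℝ] G) (E →L[ℝ] G) :=
  LinearMap.mkContinuous₂ (LinearMap.mk₂ ℝ (fun (M : E →L[ℝ] F) (N : F →L[ℝ] G) => -(N.comp M))
    (fun _ _ _ => by ext; simp; abel) (fun _ _ _ => by ext; simp)
    (fun _ _ _ => by ext; simp; abel) (fun _ _ _ => by ext; simp)) 1 (fun M N => by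
      rw [one_mul, LinearMap.mk₂_apply, norm_neg, mul_comm]
      exact N.opNorm_comp_le M)

variable {E F G : Type*} [NormedAddCommGroup E] [NormedSpace ℝ E]
  [NormedAddCommGroup F] [NormedSpace ℝ F] [NormedAddCommGroup G] [NormedSpace ℝ G]

theorem compB_apply (M : F →L[ℝ] G) (N : E →L[ℝ] F) : compB E F G M N = M.comp N := rfl

theorem negCompB_apply (M : E →L[ℝ] F) (N : F →L[ℝ] G) : negCompB E F G M N = -(N.comp M) := rfl

variable {V W X : Type*} [NormedAddCommGroup V] [NormedSpace ℝ V]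
  [NormedAddCommGroup W] [NormedSpace ℝ W] [NormedAddCommGroup X] [NormedSpace ℝ X] {a b : ℝ}

theorem LipschitzField.of_bilin (L : BilinMap V W W) {A : ℝ → V} (hab : a ≤ b) (hA : SqInt a b A)
    {g : ℝ → W} (hg : IntervalIntegrable g volume a b) :
    LipschitzField (fun r z => L (A r) z + g r) a b (fun r => ‖L (A r)‖) :=
  LipschitzField.of_linear (A := fun r => L (A r)) hab (L.comp_memLp' hA) hg

theorem LipschitzField.of_bilin' (L : BilinMap V W W) {A : ℝ → V} (hab : a ≤ b) (hA : SqInt a b A) :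
    LipschitzField (fun r z => L (A r) z) a b (fun r => ‖L (A r)‖) := by
  have h := LipschitzField.of_bilin L hab hA (g := fun _ => 0) intervalIntegrable_const
  simpa only [add_zero] using h

theorem intervalIntegrable_bilin_left (L : BilinMap V W X) {f : ℝ → V} {g : ℝ → W} (hab : a ≤ b)
    (hf : ContinuousOn f (Icc a b)) (hg : NormIntegrable a b g) :
    NormIntegrable a b (fun r => L (f r) (g r)) :=
  intervalIntegrable_bilin L.flip hab hg hf

theorem clm_intervalIntegral [CompleteSpace V] [CompleteSpace W] (L : V →L[ℝ] W) {f : ℝ → V}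
    (hf : NormIntegrable a b f) : ∫ r in a..b, L (f r) = L (∫ r in a..b, f r) :=
  L.intervalIntegral_comp_comm hf

theorem SqInt.mono {f : ℝ → V} (hf : SqInt a b f) {c : ℝ} (hc : a ≤ c) : SqInt c b f :=
  hf.mono_measure (Measure.restrict_mono (Icc_subset_Icc_left hc) le_rfl)

theorem ContinuousOn.clm_map {f : ℝ → V} {s : Set ℝ} (hf : ContinuousOn f s) (L : V →L[ℝ] W) :
    ContinuousOn (fun r => L (f r)) s := L.continuous.comp_continuousOn hf

end Composition

/-! ### The fundamental matrix and its inverse -/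

section FundamentalMatrix

variable {a b : ℝ} {E U : Type*} [NormedAddCommGroup E] [InnerProductSpace ℝ E]
  [FiniteDimensional ℝ E] [CompleteSpace E]
  [NormedAddCommGroup U] [InnerProductSpace ℝ U] [CompleteSpace U]
  {A : ℝ → E →L[ℝ] E}

theorem exists_fundamental (hab : a ≤ b) (hA : SqInt a b A) :
    ∃ Ψ, SolvesODE (fun s M => A s ∘L M) a b a (ContinuousLinearMap.id ℝ E) Ψ :=
  (LipschitzField.of_bilin' (compB E E E) hab hA).exists_solvesODE (left_mem_Icc.2 hab) _

/-- `Ψ` is the fundamental matrix of `A` normalised at `a`, and `Ξ` is its inverse. -/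
structure FundamentalPair (A : ℝ → E →L[ℝ] E) (a b : ℝ) (Ψ Ξ : ℝ → E →L[ℝ] E) : Prop where
  prim : IsPrimitive a b Ψ (fun s => A s ∘L Ψ s)
  prim_inv : IsPrimitive a b Ξ (fun s => -(Ξ s ∘L A s))
  init : Ψ a = ContinuousLinearMap.id ℝ E
  init_inv : Ξ a = ContinuousLinearMap.id ℝ E
  inv_comp : ∀ s ∈ Icc a b, Ξ s ∘L Ψ s = ContinuousLinearMap.id ℝ E
  comp_inv : ∀ s ∈ Icc a b, Ψ s ∘L Ξ s = ContinuousLinearMap.id ℝ E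

theorem SolvesODE.initial {E : Type*} [NormedAddCommGroup E] [NormedSpace ℝ E] {f : ℝ → E → E}
    {c : ℝ} {z : E} {Z : ℝ → E} (hc : c ∈ Icc a b) (h : SolvesODE f a b c z Z) : Z c = z := by
  simpa using h.eq_integral c hc

/-- The inverse is obtained as the solution of `Ξ' = -Ξ A`: the derivative of `Ξ Ψ` vanishes, so the
product stays the identity. -/
theorem exists_fundamentalPair (hab : a ≤ b) (hA : SqInt a b A) {Ψ : ℝ → E →L[ℝ] E}
    (hΨ : SolvesODE (fun s M => A s ∘L M) a b a (ContinuousLinearMap.id ℝ E) Ψ) :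
    ∃ Ξ, FundamentalPair A a b Ψ Ξ := by
  have ha := left_mem_Icc.2 hab
  obtain ⟨Ξ, hΞ⟩ := (LipschitzField.of_bilin' (negCompB E E E) hab hA).exists_solvesODE ha
    (ContinuousLinearMap.id ℝ E)
  have pΨ := IsPrimitive.of_solvesODE ha hΨ
  have pΞ := IsPrimitive.of_solvesODE ha hΞ
  have p := IsPrimitive.bilin (compB E E E) pΞ pΨ hab
  have inv : ∀ s ∈ Icc a b, Ξ s ∘L Ψ s = ContinuousLinearMap.id ℝ E := fun s hs => by
    have h := p.eq_integral s hs
    have h0 : (fun s => compB E E E (negCompB E E E (A s) (Ξ s)) (Ψ s) +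
        compB E E E (Ξ s) (A s ∘L Ψ s)) = fun _ => 0 := by
      funext s
      ext e
      simp [compB_apply, negCompB_apply]
    rw [h0, intervalIntegral.integral_zero, add_zero, hΨ.initial ha, hΞ.initial ha] at h
    exact h
  refine ⟨Ξ, pΨ, pΞ, hΨ.initial ha, hΞ.initial ha, inv, fun s hs => ?_⟩
  -- In finite dimension a left inverse is a right inverse.
  have h : (Ξ s : E →ₗ[ℝ] E) * (Ψ s : E →ₗ[ℝ] E) = 1 := by
    ext e
    exact DFunLike.congr_fun (inv s hs) e
  have h' := mul_eq_one_comm.1 h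
  ext e
  exact DFunLike.congr_fun h' e

variable {Ψ Ξ : ℝ → E →L[ℝ] E}

namespace FundamentalPair

theorem comp_inv_apply (h : FundamentalPair A a b Ψ Ξ) {s : ℝ} (hs : s ∈ Icc a b) (e : E) :
    Ψ s (Ξ s e) = e := DFunLike.congr_fun (h.comp_inv s hs) e

theorem adjoint_comp_inv_apply (h : FundamentalPair A a b Ψ Ξ) {s : ℝ} (hs : s ∈ Icc a b) (e : E) :
    (Ξ s†) ((Ψ s†) e) = e := by
  refine ext_inner_right ℝ fun e' => ?_
  rw [ContinuousLinearMap.adjoint_inner_left, ContinuousLinearMap.adjoint_inner_left,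
    h.comp_inv_apply hs]

/-- Both sides solve the same linear equation on `[τ, b]` and equal the identity at `τ`. -/
theorem eq_of_solvesODE (h : FundamentalPair A a b Ψ Ξ) (hA : SqInt a b A) {τ : ℝ}
    (hτ : τ ∈ Icc a b) {M : ℝ → E →L[ℝ] E}
    (hM : SolvesODE (fun s M => A s ∘L M) τ b τ (ContinuousLinearMap.id ℝ E) M) {s : ℝ}
    (hs : s ∈ Icc τ b) : M s = Ψ s ∘L Ξ τ := by
  have hf := LipschitzField.of_bilin' (compB E E E) hτ.2 (hA.mono hτ.1)
  have hp : IsPrimitive τ b (fun s => Ψ s ∘L Ξ τ) (fun s => (A s ∘L Ψ s) ∘L Ξ τ) :=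
    (h.prim.mono hτ (right_mem_Icc.2 (hτ.1.trans hτ.2))).clm ((compB E E E).flip (Ξ τ))
  have hτ' : τ ∈ Icc τ b := left_mem_Icc.2 hτ.2
  have hs' := hp.solvesODE (f := fun s M => A s ∘L M) hτ' (.of_forall fun r => rfl)
  rw [h.comp_inv τ hτ] at hs'
  exact hf.eqOn_of_solvesODE hτ' hM hs' hs

end FundamentalPair

end FundamentalMatrix

/-! ### Identification of the Fredholm kernel -/

section Kernel

variable {a b : ℝ} {E U : Type*} [NormedAddCommGroup E] [InnerProductSpace ℝ E]
  [FiniteDimensional ℝ E] [CompleteSpace E]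
  [NormedAddCommGroup U] [InnerProductSpace ℝ U] [CompleteSpace U]
  {A H : ℝ → E →L[ℝ] E} {B : ℝ → U →L[ℝ] E} {C : ℝ → E →L[ℝ] U} {G : E →L[ℝ] E}
  {Ψ Ξ : ℝ → E →L[ℝ] E} {v : ℝ → U} {ζ : ℝ → E}

/-- The kernel of the Fredholm equation of a linear-quadratic problem. -/
noncomputable def fredholmKernel (a b : ℝ) (B : ℝ → U →L[ℝ] E) (H : ℝ → E →L[ℝ] E)
    (C : ℝ → E →L[ℝ] U) (G : E →L[ℝ] E) (Φ : ℝ → ℝ → (E →L[ℝ] E)) (s r : ℝ) : U →L[ℝ] U :=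
  (B s)† ∘L (Φ b s)† ∘L G ∘L Φ b r ∘L B r
    + (∫ q in (max s r)..b, (B s)† ∘L (Φ q s)† ∘L H q ∘L Φ q r ∘L B r)
    + (Icc a s).indicator (fun r' => C s ∘L Φ s r' ∘L B r') r
    + (Icc s b).indicator (fun r' => (B s)† ∘L (Φ r' s)† ∘L (C r')†) r

/-- Variation of constants: applying `Ξ` cancels the drift and leaves only the control term. -/
theorem FundamentalPair.isPrimitive_inv_apply (h : FundamentalPair A a b Ψ Ξ) (hab : a ≤ b)
    (hζ : IsPrimitive a b ζ (fun r => A r (ζ r) + B r (v r))) :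
    IsPrimitive a b (fun s => Ξ s (ζ s)) (fun s => Ξ s (B s (v s))) := by
  refine (IsPrimitive.bilin (ContinuousLinearMap.id ℝ (E →L[ℝ] E)) h.prim_inv hζ hab).congr
    (fun _ _ => rfl) hab (.of_forall fun s => ?_)
  change Ξ s (B s (v s)) = -(Ξ s (A s (ζ s))) + Ξ s (A s (ζ s) + B s (v s))
  rw [map_add]
  abel

/-- The solution of the adjoint equation, without the factor `Ξ†`. -/
noncomputable def costateFactor (b : ℝ) (H : ℝ → E →L[ℝ] E) (C : ℝ → E →L[ℝ] U) (G : E →L[ℝ] E)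
    (Ψ : ℝ → E →L[ℝ] E) (ζ : ℝ → E) (v : ℝ → U) (s : ℝ) : E :=
  (Ψ b†) (G (ζ b)) + ∫ r in s..b, (Ψ r†) (H r (ζ r) + (C r†) (v r))

theorem NormIntegrable.sub_interval {V : Type*} [NormedAddCommGroup V] {f : ℝ → V}
    (hf : NormIntegrable a b f) {c d : ℝ} (hc : c ∈ Icc a b) (hd : d ∈ Icc a b) :
    NormIntegrable c d f :=
  hf.mono_set (by
    rw [uIcc_of_le (hc.1.trans hc.2)]; exact uIcc_subset_Icc hc hd)

theorem normIntegrable_adjoint_apply (hab : a ≤ b) (hΨ : ContinuousOn Ψ (Icc a b)) {f : ℝ → E}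
    (hf : NormIntegrable a b f) : NormIntegrable a b (fun r => (Ψ r†) (f r)) :=
  intervalIntegrable_bilin (F := E →L[ℝ] E) (adjointApplyL E E) hab hf hΨ

theorem normIntegrable_mixed (hab : a ≤ b) (hC : SqInt a b C)
    (hv : MemLp v 2 (volume.restrict (Icc a b))) :
    NormIntegrable a b (fun r => (C r†) (v r)) :=
  SqInt.intervalIntegrable_bilin (adjointApplyL E U) hab hv hC

theorem normIntegrable_apply (hab : a ≤ b) (hH : NormIntegrable a b H)
    (hζ : ContinuousOn ζ (Icc a b)) : NormIntegrable a b (fun r => H r (ζ r)) :=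
  intervalIntegrable_bilin (ContinuousLinearMap.id ℝ (E →L[ℝ] E)) hab hH hζ

/-- Variation of constants backwards in time: `Ξ†` contributes `-A† Ξ†`, and in the source term `Ξ†
Ψ†` is the identity. -/
theorem FundamentalPair.isPrimitive_costate (h : FundamentalPair A a b Ψ Ξ) (hab : a ≤ b)
    (hH : NormIntegrable a b H) (hC : SqInt a b C) (hv : MemLp v 2 (volume.restrict (Icc a b)))
    (hζ : ContinuousOn ζ (Icc a b)) :
    IsPrimitive a b (fun s => (Ξ s†) (costateFactor b H C G Ψ ζ v s))
      (fun s => -((A s†) ((Ξ s†) (costateFactor b H C G Ψ ζ v s)))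
        - (H s (ζ s) + (C s†) (v s))) := by
  have hi := normIntegrable_adjoint_apply hab h.prim.continuousOn
    ((normIntegrable_apply hab hH hζ).add (normIntegrable_mixed hab hC hv))
  have hb := right_mem_Icc.2 hab
  have hκ : IsPrimitive a b (costateFactor b H C G Ψ ζ v)
      (fun s => 0 + -((Ψ s†) (H s (ζ s) + (C s†) (v s)))) :=
    ((IsPrimitive.const ((Ψ b†) (G (ζ b)))).add (IsPrimitive.integral hi hb).neg).congr
      (fun s _ => by rw [costateFactor, intervalIntegral.integral_symm]) hab (.of_forall fun _ => rfl)
  refine (IsPrimitive.bilin (F := E →L[ℝ] E) (adjointApplyL E E) hκ h.prim_inv hab).congr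
    (fun _ _ => rfl) hab ?_
  filter_upwards [ae_restrict_mem measurableSet_Icc] with s hs
  change _ = (Ξ s†) (0 + -((Ψ s†) (H s (ζ s) + (C s†) (v s)))) +
    ((-(Ξ s ∘L A s))†) (costateFactor b H C G Ψ ζ v s)
  rw [zero_add, map_neg, h.adjoint_comp_inv_apply hs, map_neg, ContinuousLinearMap.adjoint_comp]
  simp only [neg_apply, ContinuousLinearMap.comp_apply]
  abel

theorem FundamentalPair.costate_right (h : FundamentalPair A a b Ψ Ξ) (hab : a ≤ b) :
    (Ξ b†) (costateFactor b H C G Ψ ζ v b) = G (ζ b) := by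
  rw [costateFactor, intervalIntegral.integral_same, add_zero,
    h.adjoint_comp_inv_apply (right_mem_Icc.2 hab)]

/-- The pull-back of `H` by the fundamental matrix. -/
noncomputable def pullback (Ψ H : ℝ → E →L[ℝ] E) (q : ℝ) : E →L[ℝ] E := (Ψ q)† ∘L H q ∘L Ψ q

theorem normIntegrable_pullback (hab : a ≤ b) (hΨ : ContinuousOn Ψ (Icc a b))
    (hH : NormIntegrable a b H) : NormIntegrable a b (pullback Ψ H) :=
  intervalIntegrable_bilin_left (compB E E E) hab
    (ContinuousOn.clm_map (V := E →L[ℝ] E) hΨ (adjointL E E))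
    (intervalIntegrable_bilin (compB E E E) hab hH hΨ)

/-- `M ↦ P ∘ M ∘ Q`, as a bounded linear map. -/
noncomputable def sandwichL (P : E →L[ℝ] U) (Q : U →L[ℝ] E) : (E →L[ℝ] E) →L[ℝ] (U →L[ℝ] U) :=
  (compB U E U P).comp ((compB U E E).flip Q)

theorem sandwichL_apply (P : E →L[ℝ] U) (Q : U →L[ℝ] E) (M : E →L[ℝ] E) :
    sandwichL P Q M = P ∘L M ∘L Q := rfl

/-- Since `Φ(q, s) = Ψ(q) Ξ(s)`, the dependence on `s` and `r` factors out of the `q`-integral, and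
only a tail integral of `pullback Ψ H` is left. -/
theorem FundamentalPair.fredholmKernel_eq (h : FundamentalPair A a b Ψ Ξ) (hab : a ≤ b)
    (hH : NormIntegrable a b H) {Φ : ℝ → ℝ → (E →L[ℝ] E)}
    (hΦ : ∀ τ ∈ Icc a b, ∀ s ∈ Icc τ b, Φ s τ = Ψ s ∘L Ξ τ) {s r : ℝ} (hs : s ∈ Icc a b)
    (hr : r ∈ Icc a b) (w : U) :
    fredholmKernel a b B H C G Φ s r w =
      (B s†) ((Ξ s†) ((Ψ b†) (G (Ψ b (Ξ r (B r w))))))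
      + (B s†) ((Ξ s†) ((∫ q in (max s r)..b, pullback Ψ H q) (Ξ r (B r w))))
      + (if r ≤ s then C s (Ψ s (Ξ r (B r w))) else 0)
      + (if s ≤ r then (B s†) ((Ξ s†) ((Ψ r†) ((C r†) w))) else 0) := by
  have hb := right_mem_Icc.2 hab
  have hm : max s r ∈ Icc a b := ⟨le_max_of_le_left hs.1, max_le hs.2 hr.2⟩
  have h2 : (∫ q in (max s r)..b, (B s)† ∘L (Φ q s)† ∘L H q ∘L Φ q r ∘L B r) =
      sandwichL ((B s)† ∘L (Ξ s)†) (Ξ r ∘L B r) (∫ q in (max s r)..b, pullback Ψ H q) := by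
    rw [← clm_intervalIntegral _ ((normIntegrable_pullback hab h.prim.continuousOn hH).sub_interval
      hm hb)]
    apply intervalIntegral.integral_congr
    intro q hq
    rw [uIcc_of_le hm.2] at hq
    simp only [sandwichL_apply, pullback]
    rw [hΦ s hs q ⟨(le_max_left s r).trans hq.1, hq.2⟩,
      hΦ r hr q ⟨(le_max_right s r).trans hq.1, hq.2⟩, ContinuousLinearMap.adjoint_comp]
    rfl
  have h3 : (Icc a s).indicator (fun r' => C s ∘L Φ s r' ∘L B r') r w =
      if r ≤ s then C s (Ψ s (Ξ r (B r w))) else 0 := by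
    by_cases hrs : r ≤ s
    · rw [indicator_of_mem (show r ∈ Icc a s from ⟨hr.1, hrs⟩), if_pos hrs, hΦ r hr s ⟨hrs, hs.2⟩]
      rfl
    · rw [indicator_of_notMem (fun hr' => hrs hr'.2), if_neg hrs]
      rfl
  have h4 : (Icc s b).indicator (fun r' => (B s)† ∘L (Φ r' s)† ∘L (C r')†) r w =
      if s ≤ r then (B s†) ((Ξ s†) ((Ψ r†) ((C r†) w))) else 0 := by
    by_cases hrs : s ≤ r
    · rw [indicator_of_mem (show r ∈ Icc s b from ⟨hrs, hr.2⟩), if_pos hrs, hΦ s hs r ⟨hrs, hr.2⟩,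
        ContinuousLinearMap.adjoint_comp]
      rfl
    · rw [indicator_of_notMem (fun hr' => hrs hr'.1), if_neg hrs]
      rfl
  rw [fredholmKernel, h2, hΦ s hs b ⟨hs.2, le_rfl⟩, hΦ r hr b ⟨hr.2, le_rfl⟩,
    ContinuousLinearMap.adjoint_comp, ← h3, ← h4]
  rfl

/-- With `η = Ξ ζ`, the kernel applied to `v` is, on each side of `s`, the derivative of an explicit
function. Adding the two increments, the terms `P (K + N s) (η s)` cancel, and `η a = 0` and `N b =
0` remove the outer boundary terms. -/
theorem FundamentalPair.fredholmKernel_integral (h : FundamentalPair A a b Ψ Ξ) (hab : a ≤ b)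
    (hH : NormIntegrable a b H) (hC : SqInt a b C) (hv : MemLp v 2 (volume.restrict (Icc a b)))
    {Φ : ℝ → ℝ → (E →L[ℝ] E)}
    (hΦ : ∀ τ ∈ Icc a b, ∀ s ∈ Icc τ b, Φ s τ = Ψ s ∘L Ξ τ)
    (hζ : IsPrimitive a b ζ (fun r => A r (ζ r) + B r (v r))) (hζa : ζ a = 0)
    {s : ℝ} (hs : s ∈ Icc a b) :
    IntervalIntegrable (fun r => fredholmKernel a b B H C G Φ s r (v r)) volume a b ∧
    ∫ r in a..b, fredholmKernel a b B H C G Φ s r (v r) =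
      C s (ζ s) + (B s†) ((Ξ s†) (costateFactor b H C G Ψ ζ v s)) := by
  have ha := left_mem_Icc.2 hab
  have hb := right_mem_Icc.2 hab
  set η : ℝ → E := fun s => Ξ s (ζ s) with hη
  set η' : ℝ → E := fun s => Ξ s (B s (v s)) with hη'
  have pη : IsPrimitive a b η η' := h.isPrimitive_inv_apply hab hζ
  have ηa : η a = 0 := by simp [hη, hζa]
  have ζη : ∀ r ∈ Icc a b, Ψ r (η r) = ζ r := fun r hr => h.comp_inv_apply hr _
  set N : ℝ → E →L[ℝ] E := fun σ => ∫ q in σ..b, pullback Ψ H q with hN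
  have iH := normIntegrable_pullback hab h.prim.continuousOn hH
  have pN : IsPrimitive a b N (fun q => -pullback Ψ H q) :=
    (IsPrimitive.integral iH hb).neg.congr
      (fun s _ => by rw [hN]; exact intervalIntegral.integral_symm _ _) hab (.of_forall fun _ => rfl)
  set K : E →L[ℝ] E := (Ψ b)† ∘L G ∘L Ψ b with hK
  set P : E →L[ℝ] U := (B s)† ∘L (Ξ s)† with hP
  -- the part of the kernel on `[a, s]`
  have pleft : IsPrimitive a s (fun r => (P ∘L (K + N s) + C s ∘L Ψ s) (η r))
      (fun r => fredholmKernel a b B H C G Φ s r (v r)) := by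
    refine ((pη.mono ha hs).clm (P ∘L (K + N s) + C s ∘L Ψ s)).congr (fun _ _ => rfl) hs.1 ?_
    -- Both indicators of the kernel are active at `r = s`; this single point is discarded as a null
    -- set.
    have hne : ∀ᵐ r ∂volume.restrict (Icc a s), r ≠ s :=
      ae_restrict_of_ae (by simp [ae_iff, measure_singleton])
    filter_upwards [ae_restrict_mem measurableSet_Icc, hne] with r hr hne
    have hlt : r < s := lt_of_le_of_ne hr.2 hne
    rw [h.fredholmKernel_eq hab hH hΦ hs ⟨hr.1, hr.2.trans hs.2⟩, max_eq_left hr.2, if_pos hr.2,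
      if_neg hlt.not_ge, add_zero]
    change _ = (P (K (η' r) + N s (η' r))) + C s (Ψ s (η' r))
    rw [map_add]
    rfl
  -- the part of the kernel on `[s, b]`
  have iM := normIntegrable_adjoint_apply hab h.prim.continuousOn (normIntegrable_mixed hab hC hv)
  have iHζ := normIntegrable_adjoint_apply hab h.prim.continuousOn
    (normIntegrable_apply hab hH hζ.continuousOn)
  have iT := normIntegrable_adjoint_apply hab h.prim.continuousOn
    ((normIntegrable_apply hab hH hζ.continuousOn).add (normIntegrable_mixed hab hC hv))
  -- On `[s, b]` the tail `N` varies with `r`. The term `-Ψ† H Ψ η = -Ψ† H ζ` of the product rule is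
  -- what the source `Ψ† H ζ` of the costate compensates in `pright`.
  have pNη : IsPrimitive a b (fun r => N r (η r))
      (fun r => (-pullback Ψ H r) (η r) + N r (η' r)) :=
    IsPrimitive.bilin (ContinuousLinearMap.id ℝ (E →L[ℝ] E)) pN pη hab
  have pright : IsPrimitive s b
      (fun r => P ((K (η r) + N r (η r)) +
        ∫ q in s..r, (Ψ q†) (H q (ζ q) + (C q†) (v q))))
      (fun r => fredholmKernel a b B H C G Φ s r (v r)) := by
    have p1 := ((pη.clm K).add pNη).mono hs hb
    have p2 := IsPrimitive.integral (iT.sub_interval hs hb) (left_mem_Icc.2 hs.2)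
    refine ((p1.add p2).clm P).congr (fun _ _ => rfl) hs.2 ?_
    have hne : ∀ᵐ r ∂volume.restrict (Icc s b), r ≠ s :=
      ae_restrict_of_ae (by simp [ae_iff, measure_singleton])
    filter_upwards [ae_restrict_mem measurableSet_Icc, hne] with r hr hne
    have hlt : s < r := lt_of_le_of_ne hr.1 hne.symm
    have hr' : r ∈ Icc a b := ⟨hs.1.trans hr.1, hr.2⟩
    rw [h.fredholmKernel_eq hab hH hΦ hs hr', max_eq_right hr.1, if_pos hr.1,
      if_neg hlt.not_ge, add_zero]
    change P (K (η' r)) + P (N r (η' r)) + P ((Ψ r†) ((C r†) (v r))) =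
      P ((K (η' r) + (-((Ψ r†) (H r (Ψ r (η r)))) + N r (η' r)))
        + (Ψ r†) (H r (ζ r) + (C r†) (v r)))
    rw [ζη r hr', ← map_add, ← map_add, map_add (Ψ r†)]
    congr 1
    abel
  have i1 := pleft.integrable
  have i2 := pright.integrable
  refine ⟨i1.trans i2, ?_⟩
  rw [← intervalIntegral.integral_add_adjacent_intervals i1 i2,
    ← pleft.sub_eq (left_mem_Icc.2 hs.1) (right_mem_Icc.2 hs.1),
    ← pright.sub_eq (left_mem_Icc.2 hs.2) (right_mem_Icc.2 hs.2)]
  have hNb : N b = 0 := intervalIntegral.integral_same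
  have hκ : costateFactor b H C G Ψ ζ v s =
      K (η b) + ∫ q in s..b, (Ψ q†) (H q (ζ q) + (C q†) (v q)) := by
    rw [costateFactor, show ζ b = Ψ b (η b) from (ζη b hb).symm]
    rfl
  change _ = C s (ζ s) + P (costateFactor b H C G Ψ ζ v s)
  rw [hκ, hNb, ηa, intervalIntegral.integral_same, ← ζη s hs]
  simp only [map_zero, zero_apply, add_zero, sub_zero, map_add, add_apply,
    ContinuousLinearMap.comp_apply]
  abel

end Kernel

/-! ### Matching `𝐀`, `𝐀₁`, `𝐂` and the adjoint field with derivatives of the Hamiltonian -/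

section Identification

variable {a b : ℝ} {E U : Type*} [NormedAddCommGroup E] [InnerProductSpace ℝ E] [CompleteSpace E]
  [NormedAddCommGroup U] [InnerProductSpace ℝ U] [CompleteSpace U]

theorem OpCoeff.fderiv_fn_apply {K E F G : Type*} [TopologicalSpace K]
    [NormedAddCommGroup E] [NormedSpace ℝ E]
    [NormedAddCommGroup F] [NormedSpace ℝ F] [NormedAddCommGroup G] [NormedSpace ℝ G]
    (c : OpCoeff K E F G) (s : K) (y e : E) (u : F) :
    fderiv ℝ (fun y => c.fn (s, y) u) y e = c.deriv (s, y) e u := by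
  have h : HasFDerivAt (fun y => c.fn (s, y) u) _ y :=
    (c.hasFDerivAt_fn s y).clm_apply (hasFDerivAt_const u y)
  rw [h.fderiv]
  simp

variable (hab : a ≤ b) (α : SmoothCoeff (Icc a b) E E) (β : OpCoeff (Icc a b) E U E)
  (f₀ : SmoothCoeff (Icc a b) E ℝ) (f₁ : SmoothCoeff (Icc a b) E U) (f₂ : OpCoeff (Icc a b) E U U)
  (Y : C(Icc a b, E)) (p : Lp U 2 (volume.restrict (Icc a b)) × C(Icc a b, E))

/-- Every Hessian on the left is a contraction of a second derivative by a fixed functional. The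
term in `β` changes sides through the adjoint: `⟪Y, β u⟫ = ⟪u, β† Y⟫`. -/
theorem inner_hess_hamilton {r : ℝ} {s : Icc a b} (hs : projIcc a b hab r = s) (e e' : E) :
    inner ℝ ((hess (fun y => inner ℝ (Y s) (α.fn (s, y))) (p.2 s)
      + hess (fun y => f₀.fn (s, y)) (p.2 s)
      + (1 / 2 : ℝ) • hess (fun y => inner ℝ (f₂.fn (s, y) (p.1 r)) (p.1 r)) (p.2 s)
      + hess (fun y => inner ℝ (Y s) (β.fn (s, y) (p.1 r))) (p.2 s)
      + hess (fun y => inner ℝ (f₁.fn (s, y)) (p.1 r)) (p.2 s)) e) e' =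
    runningHess hab (hamilton₀ α f₀ Y) (hamilton₁ β f₁ Y) f₂ p r e e' := by
  have k1 := α.inner_hess_fn_comp (innerSL ℝ (Y s)) s (p.2 s) e e'
  have k2 := f₀.inner_hess_fn_comp (ContinuousLinearMap.id ℝ ℝ) s (p.2 s) e e'
  have k3 := f₂.inner_hess_fn_comp (innerApplyL U (p.1 r) (p.1 r)) s (p.2 s) e e'
  have k4 := β.inner_hess_fn_comp ((innerSL ℝ (p.1 r)).comp (adjointApplyL U E (Y s))) s (p.2 s) e e'
  have k5 := f₁.inner_hess_fn_comp (innerSL ℝ (p.1 r)) s (p.2 s) e e'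
  have e3 : (fun y => innerApplyL U (p.1 r) (p.1 r) (f₂.fn (s, y))) =
      fun y => inner ℝ (f₂.fn (s, y) (p.1 r)) (p.1 r) := funext fun y => real_inner_comm _ _
  have e4 : (fun y => ((innerSL ℝ (p.1 r)).comp (adjointApplyL U E (Y s))) (β.fn (s, y))) =
      fun y => inner ℝ (Y s) (β.fn (s, y) (p.1 r)) := funext fun y => by
    rw [real_inner_comm, ← ContinuousLinearMap.adjoint_inner_right]
    rfl
  have e5 : (fun y => innerSL ℝ (p.1 r) (f₁.fn (s, y))) =
      fun y => inner ℝ (f₁.fn (s, y)) (p.1 r) := funext fun y => real_inner_comm _ _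
  rw [e3] at k3
  rw [e4] at k4
  rw [e5] at k5
  have hr : runningHess hab (hamilton₀ α f₀ Y) (hamilton₁ β f₁ Y) f₂ p r e e' =
      (f₀.deriv₂ (s, p.2 s) e e' + inner ℝ (Y s) (α.deriv₂ (s, p.2 s) e e'))
      + inner ℝ (p.1 r) (f₁.deriv₂ (s, p.2 s) e e' + (β.deriv₂ (s, p.2 s) e e'†) (Y s))
      + (1 / 2) * innerApplyL U (p.1 r) (p.1 r) (f₂.deriv₂ (s, p.2 s) e e') := by
    rw [← hs]
    rfl
  rw [hr, inner_add_right, ← k3]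
  have k2' : inner ℝ (hess (fun y => f₀.fn (s, y)) (p.2 s) e) e' = f₀.deriv₂ (s, p.2 s) e e' := k2
  have k1' : inner ℝ (hess (fun y => inner ℝ (Y s) (α.fn (s, y))) (p.2 s) e) e' =
    inner ℝ (Y s) (α.deriv₂ (s, p.2 s) e e') := k1
  have k4' : inner ℝ (hess (fun y => inner ℝ (Y s) (β.fn (s, y) (p.1 r))) (p.2 s) e) e' =
    inner ℝ (p.1 r) ((β.deriv₂ (s, p.2 s) e e'†) (Y s)) := k4
  have k5' : inner ℝ (hess (fun y => inner ℝ (f₁.fn (s, y)) (p.1 r)) (p.2 s) e) e' =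
    inner ℝ (p.1 r) (f₁.deriv₂ (s, p.2 s) e e') := k5
  rw [← k1', ← k2', ← k4', ← k5']
  simp only [add_apply, smul_apply, inner_add_left, inner_smul_left, conj_trivial]
  ring

theorem fderiv_hamilton_mixed {r : ℝ} {s : Icc a b} (hs : projIcc a b hab r = s) :
    fderiv ℝ (fun y => f₂.fn (s, y) (p.1 r)) (p.2 s) + fderiv ℝ (fun y => f₁.fn (s, y)) (p.2 s)
      + fderiv ℝ (fun y => (β.fn (s, y)†) (Y s)) (p.2 s) =
    runningMixed hab (hamilton₁ β f₁ Y) f₂ p r := by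
  ext1 e
  have k1 := OpCoeff.fderiv_fn_apply f₂ s (p.2 s) e (p.1 r)
  have k2 : fderiv ℝ (fun y => f₁.fn (s, y)) (p.2 s) = _ := (f₁.hasFDerivAt_fn s (p.2 s)).fderiv
  have k3 : fderiv ℝ (fun y => (β.fn (s, y)†) (Y s)) (p.2 s) e = _ :=
    β.fderiv_fn_comp (adjointApplyL U E (Y s)) s (p.2 s) e
  have hr : runningMixed hab (hamilton₁ β f₁ Y) f₂ p r e =
      (f₁.deriv (s, p.2 s) e + (β.deriv (s, p.2 s) e†) (Y s)) + f₂.deriv (s, p.2 s) e (p.1 r) := by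
    rw [← hs]
    rfl
  rw [hr, ← k1, add_apply, add_apply, k2, k3]
  change _ + _ + (β.deriv (s, p.2 s) e†) (Y s) = _
  abel

theorem fderiv_drift {r : ℝ} {s : Icc a b} (hs : projIcc a b hab r = s) :
    fderiv ℝ (fun y => α.fn (s, y)) (p.2 s) + fderiv ℝ (fun y => β.fn (s, y) (p.1 r)) (p.2 s) =
    drift hab α β p r := by
  ext1 e
  have k1 := OpCoeff.fderiv_fn_apply β s (p.2 s) e (p.1 r)
  have k2 : fderiv ℝ (fun y => α.fn (s, y)) (p.2 s) = _ := (α.hasFDerivAt_fn s (p.2 s)).fderiv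
  have hr : drift hab α β p r e = α.deriv (s, p.2 s) e + β.deriv (s, p.2 s) e (p.1 r) := by
    rw [← hs]
    rfl
  rw [hr, add_apply, k1, k2]

/-- The gradient in the state of the running cost. -/
noncomputable def runningGradient (r : ℝ) : E :=
  rieszL E (f₀.deriv (projIcc a b hab r, p.2 (projIcc a b hab r)))
    + adjointApplyL E U (p.1 r) (f₁.deriv (projIcc a b hab r, p.2 (projIcc a b hab r)))
    + (1 / 2 : ℝ) • rieszL E (compB E (U →L[ℝ] U) ℝ (innerApplyL U (p.1 r) (p.1 r))
      (f₂.deriv (projIcc a b hab r, p.2 (projIcc a b hab r))))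

theorem normIntegrable_compB {W : Type*} [NormedAddCommGroup W] [NormedSpace ℝ W]
    {f : ℝ → W →L[ℝ] ℝ} (hf : NormIntegrable a b f) (X : CMap (Icc a b) (E →L[ℝ] W)) :
    NormIntegrable a b (fun r => compB E W ℝ (f r) (X (projIcc a b hab r))) :=
  intervalIntegrable_bilin (compB E W ℝ) hab hf (X.continuous.comp continuous_projIcc).continuousOn

theorem normIntegrable_runningGradient : NormIntegrable a b (runningGradient hab f₀ f₁ f₂ p) := by
  have h0 : NormIntegrable a b (fun r => rieszL E (f₀.deriv.superpose p.2 (projIcc a b hab r))) :=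
    NormIntegrable.clm (rieszL E) (intervalIntegrable_of_memLp_two hab
      (memLp_comp_projIcc (E := E →L[ℝ] ℝ) hab (f₀.deriv.superpose p.2) 2))
  have h1 : NormIntegrable a b
      (fun r => adjointApplyL E U (p.1 r) (f₁.deriv.superpose p.2 (projIcc a b hab r))) :=
    intervalIntegrable_bilin (F := E →L[ℝ] U) (adjointApplyL E U) hab (Lp.intervalIntegrable hab p.1)
      ((f₁.deriv.superpose p.2).continuous.comp continuous_projIcc).continuousOn
  have h2 := normIntegrable_compB hab (SqInt.intervalIntegrable_bilin (innerApplyL U) hab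
    (Lp.memLp p.1) (Lp.memLp p.1)) (f₂.deriv.superpose p.2)
  exact (h0.add h1).add (NormIntegrable.const_smul (1 / 2 : ℝ) (NormIntegrable.clm (rieszL E) h2))

theorem gradient_running {r : ℝ} {s : Icc a b} (hs : projIcc a b hab r = s) :
    gradient (fun y => f₀.fn (s, y)) (p.2 s)
      + (fderiv ℝ (fun y => f₁.fn (s, y)) (p.2 s)†) (p.1 r)
      + (1 / 2 : ℝ) • gradient (fun y => inner ℝ (f₂.fn (s, y) (p.1 r)) (p.1 r)) (p.2 s) =
    runningGradient hab f₀ f₁ f₂ p r := by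
  have k2 : fderiv ℝ (fun y => f₁.fn (s, y)) (p.2 s) = _ := (f₁.hasFDerivAt_fn s (p.2 s)).fderiv
  have k1 : fderiv ℝ (fun y => f₀.fn (s, y)) (p.2 s) = _ := (f₀.hasFDerivAt_fn s (p.2 s)).fderiv
  have k3 : HasFDerivAt (fun y => inner ℝ (f₂.fn (s, y) (p.1 r)) (p.1 r))
      (compB E (U →L[ℝ] U) ℝ (innerApplyL U (p.1 r) (p.1 r)) (f₂.deriv (s, p.2 s))) (p.2 s) := by
    have := (innerApplyL U (p.1 r) (p.1 r)).hasFDerivAt.comp (p.2 s) (f₂.hasFDerivAt_fn s (p.2 s))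
    refine this.congr_of_eventuallyEq (.of_forall fun y => ?_)
    exact real_inner_comm _ _
  rw [gradient_eq_rieszL_comp, gradient_eq_rieszL_comp]
  dsimp only
  rw [k2, k1, k3.fderiv, ← hs]
  rfl

theorem inner_runningGradient (r : ℝ) (e : E) :
    inner ℝ (runningGradient hab f₀ f₁ f₂ p r) e =
      f₀.deriv (projIcc a b hab r, p.2 (projIcc a b hab r)) e
      + inner ℝ (f₁.deriv (projIcc a b hab r, p.2 (projIcc a b hab r)) e) (p.1 r)
      + 1 / 2 * inner ℝ (f₂.deriv (projIcc a b hab r, p.2 (projIcc a b hab r)) e (p.1 r)) (p.1 r) := by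
  set q := (projIcc a b hab r, p.2 (projIcc a b hab r))
  have h1 : inner ℝ (adjointApplyL E U (p.1 r) (f₁.deriv q)) e = inner ℝ (f₁.deriv q e) (p.1 r) := by
    rw [adjointApplyL_apply, ContinuousLinearMap.adjoint_inner_left]
    exact real_inner_comm _ _
  have h2 : compB E (U →L[ℝ] U) ℝ (innerApplyL U (p.1 r) (p.1 r)) (f₂.deriv q) e =
      inner ℝ (f₂.deriv q e (p.1 r)) (p.1 r) := real_inner_comm _ _
  have h3 : runningGradient hab f₀ f₁ f₂ p r = rieszL E (f₀.deriv q)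
    + adjointApplyL E U (p.1 r) (f₁.deriv q)
    + (1 / 2 : ℝ) • rieszL E (compB E (U →L[ℝ] U) ℝ (innerApplyL U (p.1 r) (p.1 r))
      (f₂.deriv q)) := rfl
  rw [h3, inner_add_left, inner_add_left, inner_smul_left, inner_rieszL, inner_rieszL,
    conj_trivial, h1, h2]

/-- The adjoint equation in Hamiltonian form, as required by `inner_hess_bolza`. -/
theorem neg_inner_adjoint_drift (r : ℝ) (e : E) :
    -((hamilton₀ α f₀ Y).deriv (projIcc a b hab r, p.2 (projIcc a b hab r)) e
        + inner ℝ ((hamilton₁ β f₁ Y).deriv (projIcc a b hab r, p.2 (projIcc a b hab r)) e) (p.1 r)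
        + 1 / 2 * inner ℝ (f₂.deriv (projIcc a b hab r, p.2 (projIcc a b hab r)) e (p.1 r)) (p.1 r)) =
    inner ℝ (-((drift hab α β p r†) (Y (projIcc a b hab r))) - runningGradient hab f₀ f₁ f₂ p r) e := by
  rw [inner_sub_left, inner_neg_left, ContinuousLinearMap.adjoint_inner_left, inner_runningGradient,
    hamilton₀_deriv, hamilton₁_deriv, inner_add_left, ContinuousLinearMap.adjoint_inner_left]
  have h : drift hab α β p r e = α.deriv (projIcc a b hab r, p.2 (projIcc a b hab r)) e
    + β.deriv (projIcc a b hab r, p.2 (projIcc a b hab r)) e (p.1 r) := rfl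
  rw [h, inner_add_right]
  ring

end Identification

/-! ### Application to the affine-quadratic control problem -/

namespace AQProblem

variable {n m : ℕ} {P : AQProblem n m} {t : ℝ}

/-- The coefficient `A` on `[t, T]`, with its derivatives. -/
noncomputable def coeffA (hT : 0 < P.T) (ht : t ∈ Icc 0 P.T) (h3 : P.H3) :
    SmoothCoeff (Icc t P.T) (Euc n) (Euc n) := .ofContDiffOn hT ht h3.smoothA

/-- The coefficient `B` on `[t, T]`, with its derivatives. -/
noncomputable def coeffB (hT : 0 < P.T) (ht : t ∈ Icc 0 P.T) (h3 : P.H3) :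
    OpCoeff (Icc t P.T) (Euc n) (Euc m) (Euc n) := .ofContDiffOn hT ht h3.smoothB

/-- The coefficient `Q` on `[t, T]`, with its derivatives. -/
noncomputable def coeffQ (hT : 0 < P.T) (ht : t ∈ Icc 0 P.T) (h3 : P.H3) :
    SmoothCoeff (Icc t P.T) (Euc n) ℝ := .ofContDiffOn hT ht h3.smoothQ

/-- The coefficient `S` on `[t, T]`, with its derivatives. -/
noncomputable def coeffS (hT : 0 < P.T) (ht : t ∈ Icc 0 P.T) (h3 : P.H3) :
    SmoothCoeff (Icc t P.T) (Euc n) (Euc m) := .ofContDiffOn hT ht h3.smoothS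

/-- The coefficient `R` on `[t, T]`, with its derivatives. -/
noncomputable def coeffR (hT : 0 < P.T) (ht : t ∈ Icc 0 P.T) (h3 : P.H3) :
    OpCoeff (Icc t P.T) (Euc n) (Euc m) (Euc m) := .ofContDiffOn hT ht h3.smoothR

variable (hT : 0 < P.T) (ht : t ∈ Icc 0 P.T) (h3 : P.H3)

theorem stateField_eq (u : Control m t P.T) {r : ℝ} (hr : r ∈ Icc t P.T) (z : Euc n) :
    stateField ht.2 (coeffA hT ht h3) (coeffB hT ht h3) u r z = P.A r z + P.B r z (u r) := by
  rw [stateField, projIcc_of_mem ht.2 hr]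
  rfl

theorem exists_solution (h1 : P.H1) (x : Euc n) :
    ∃ Z : Control m t P.T → C(Icc t P.T, Euc n),
      (∀ u X, stateDefect ht.2 (coeffA hT ht h3) (coeffB hT ht h3) x (u, X) = 0 ↔ X = Z u) ∧
      (∀ u, P.IsState t x u (fun r => Z u (projIcc t P.T ht.2 r))) ∧
      ∀ u X, P.IsState t x u X → ∀ r (hr : r ∈ Icc t P.T), X r = Z u ⟨r, hr⟩ := by
  obtain ⟨LA, -, hLA⟩ := h1.lipA
  obtain ⟨LB, -, hLB⟩ := h1.lipB
  have htT := left_mem_Icc.2 ht.2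
  obtain ⟨Z, hZ, hZs, hZu⟩ := exists_solution_map ht.2 (coeffA hT ht h3) (coeffB hT ht h3)
    (fun s y z => hLA s (Icc_subset_Icc_left ht.1 s.2) y z)
    (fun s y z => hLB s (Icc_subset_Icc_left ht.1 s.2) y z) x
  refine ⟨Z, hZ, fun u => (hZs u).congr_field htT fun r hr z => (stateField_eq hT ht h3 u hr z).symm,
    fun u X hX r hr => ?_⟩
  refine (hZu u X (hX.congr_field htT fun r hr z => stateField_eq hT ht h3 u hr z) hr).trans ?_
  dsimp only
  rw [projIcc_of_mem ht.2 hr]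

theorem cost_eq_bolza {x : Euc n} {Z : Control m t P.T → C(Icc t P.T, Euc n)}
    (hZs : ∀ u, P.IsState t x u (fun r => Z u (projIcc t P.T ht.2 r)))
    (hZu : ∀ u X, P.IsState t x u X → ∀ r (hr : r ∈ Icc t P.T), X r = Z u ⟨r, hr⟩) :
    P.cost t x = fun u => bolza ht.2 (coeffQ hT ht h3) (coeffS hT ht h3) (coeffR hT ht h3) P.G 0
      (u, Z u) := by
  funext u
  -- The state inside the cost is a chosen solution; existence makes the choice meaningful, and
  -- uniqueness identifies it with `Z u` on `[t, T]`.
  have hs : P.IsState t x u (P.state t x u) := Classical.epsilon_spec ⟨_, hZs u⟩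
  have hs' := hZu u _ hs
  have h := (hasIntervalIntegral_bolza ht.2 (coeffQ hT ht h3) (coeffS hT ht h3) (coeffR hT ht h3)
    P.G 0 u (Z u)).integral_eq
  rw [cost, hs' _ (right_mem_Icc.2 ht.2), ← eq_sub_iff_add_eq]
  rw [zero_apply, sub_zero] at h
  rw [← h]
  apply intervalIntegral.integral_congr
  intro r hr
  rw [uIcc_of_le ht.2] at hr
  dsimp only
  rw [hs' r hr, projIcc_of_mem ht.2 hr]
  rfl

section Trajectory

variable {u : Control m t P.T} {X Y : ℝ → Euc n} {W : C(Icc t P.T, Euc n)} {V : C(Icc t P.T, Euc n)}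

theorem bA_eq (hX : ∀ r (hr : r ∈ Icc t P.T), X r = W ⟨r, hr⟩)
    {r : ℝ} (hr : r ∈ Icc t P.T) :
    P.bA u X r = drift ht.2 (coeffA hT ht h3) (coeffB hT ht h3) (u, W) r := by
  rw [← fderiv_drift _ _ _ _ (projIcc_of_mem ht.2 hr), bA, hX r hr]
  rfl

theorem bC_eq (hX : ∀ r (hr : r ∈ Icc t P.T), X r = W ⟨r, hr⟩)
    (hY : ∀ r (hr : r ∈ Icc t P.T), Y r = V ⟨r, hr⟩) {r : ℝ} (hr : r ∈ Icc t P.T) :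
    P.bC u X Y r = runningMixed ht.2 (hamilton₁ (coeffB hT ht h3) (coeffS hT ht h3) V)
      (coeffR hT ht h3) (u, W) r := by
  rw [← fderiv_hamilton_mixed _ _ _ _ _ _ (projIcc_of_mem ht.2 hr), bC, hX r hr, hY r hr]
  rfl

theorem inner_bA₁ (hX : ∀ r (hr : r ∈ Icc t P.T), X r = W ⟨r, hr⟩)
    (hY : ∀ r (hr : r ∈ Icc t P.T), Y r = V ⟨r, hr⟩) {r : ℝ} (hr : r ∈ Icc t P.T)
    (e e' : Euc n) :
    inner ℝ (P.bA₁ u X Y r e) e' = runningHess ht.2 (hamilton₀ (coeffA hT ht h3) (coeffQ hT ht h3) V)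
      (hamilton₁ (coeffB hT ht h3) (coeffS hT ht h3) V) (coeffR hT ht h3) (u, W) r e e' := by
  rw [← inner_hess_hamilton _ _ _ _ _ _ _ _ (projIcc_of_mem ht.2 hr), bA₁, hX r hr, hY r hr]
  rfl

/-- This form of `𝐀₁` transfers the integrability in time of `runningHess` to it. -/
theorem bA₁_eq (hX : ∀ r (hr : r ∈ Icc t P.T), X r = W ⟨r, hr⟩)
    (hY : ∀ r (hr : r ∈ Icc t P.T), Y r = V ⟨r, hr⟩) {r : ℝ} (hr : r ∈ Icc t P.T) :
    P.bA₁ u X Y r = compB (Euc n) (Euc n →L[ℝ] ℝ) (Euc n) (rieszL (Euc n))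
      (runningHess ht.2 (hamilton₀ (coeffA hT ht h3) (coeffQ hT ht h3) V)
      (hamilton₁ (coeffB hT ht h3) (coeffS hT ht h3) V) (coeffR hT ht h3) (u, W) r) := by
  ext1 e
  refine ext_inner_right ℝ fun e' => ?_
  rw [inner_bA₁ hT ht h3 hX hY hr]
  exact (inner_rieszL _ _).symm

theorem sqInt_bA (hT : 0 < P.T) (ht : t ∈ Icc 0 P.T) (h3 : P.H3)
    (hX : ∀ r (hr : r ∈ Icc t P.T), X r = W ⟨r, hr⟩)
    : SqInt t P.T (P.bA u X) :=
  (memLp_congr_ae ((ae_restrict_iff' measurableSet_Icc).2 (.of_forall fun _ hr =>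
    bA_eq hT ht h3 hX hr))).2 (memLp_drift ht.2 _ _ _)

theorem sqInt_bC (hT : 0 < P.T) (ht : t ∈ Icc 0 P.T) (h3 : P.H3)
    (hX : ∀ r (hr : r ∈ Icc t P.T), X r = W ⟨r, hr⟩)
    (hY : ∀ r (hr : r ∈ Icc t P.T), Y r = V ⟨r, hr⟩) : SqInt t P.T (P.bC u X Y) :=
  (memLp_congr_ae ((ae_restrict_iff' measurableSet_Icc).2 (.of_forall fun _ hr =>
    bC_eq hT ht h3 hX hY hr))).2 (memLp_runningMixed ht.2 _ _ _)

theorem normIntegrable_bA₁ (hT : 0 < P.T) (ht : t ∈ Icc 0 P.T) (h3 : P.H3)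
    (hX : ∀ r (hr : r ∈ Icc t P.T), X r = W ⟨r, hr⟩)
    (hY : ∀ r (hr : r ∈ Icc t P.T), Y r = V ⟨r, hr⟩) :
    NormIntegrable t P.T (P.bA₁ u X Y) := by
  have h := NormIntegrable.clm (compB (Euc n) (Euc n →L[ℝ] ℝ) (Euc n) (rieszL (Euc n)))
    (normIntegrable_runningHess ht.2 (hamilton₀ (coeffA hT ht h3) (coeffQ hT ht h3) V)
      (hamilton₁ (coeffB hT ht h3) (coeffS hT ht h3) V) (coeffR hT ht h3) (u, W))
  refine h.congr ?_
  intro r hr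
  rw [uIoc_of_le ht.2] at hr
  exact (bA₁_eq hT ht h3 hX hY ⟨hr.1.le, hr.2⟩).symm

theorem adjointField_eq (hX : ∀ r (hr : r ∈ Icc t P.T), X r = W ⟨r, hr⟩)
    {r : ℝ} (hr : r ∈ Icc t P.T) (p : Euc n) :
    -(((P.bA u X r)†) p) - gradient (P.Q r) (X r) - ((fderiv ℝ (P.S r) (X r))†) (u r)
      - (1 / 2 : ℝ) • gradient (fun y => inner ℝ (P.R r y (u r)) (u r)) (X r) =
    -(((P.bA u X r)†) p)
      - runningGradient ht.2 (coeffQ hT ht h3) (coeffS hT ht h3) (coeffR hT ht h3) (u, W) r := by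
  rw [← gradient_running _ _ _ _ _ (projIcc_of_mem ht.2 hr), hX r hr, sub_sub, sub_sub, ← add_assoc]
  rfl

theorem exists_isAdjointState (hT : 0 < P.T) (ht : t ∈ Icc 0 P.T) (h3 : P.H3)
    (hX : ∀ r (hr : r ∈ Icc t P.T), X r = W ⟨r, hr⟩)
    : ∃ Y, P.IsAdjointState t u X Y := by
  have hTT := right_mem_Icc.2 ht.2
  have hg : NormIntegrable t P.T fun r =>
      -runningGradient ht.2 (coeffQ hT ht h3) (coeffS hT ht h3) (coeffR hT ht h3) (u, W) r :=
    (normIntegrable_runningGradient ht.2 _ _ _ _).neg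
  have hf := LipschitzField.of_bilin (-(ContinuousLinearMap.id ℝ (Euc n →L[ℝ] Euc n))) ht.2
    ((adjointL (Euc n) (Euc n)).comp_memLp' (sqInt_bA hT ht h3 hX (u := u))) hg
  -- The Picard argument may start from any point of the interval, so the terminal value problem
  -- needs no time reversal.
  obtain ⟨Y, hY⟩ := hf.exists_solvesODE hTT (gradient P.G (X P.T))
  refine ⟨Y, hY.congr_field hTT fun r hr p => ?_⟩
  rw [adjointField_eq hT ht h3 hX hr, sub_eq_add_neg]
  rfl

theorem exists_isFundamental (hT : 0 < P.T) (ht : t ∈ Icc 0 P.T) (h3 : P.H3)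
    (hX : ∀ r (hr : r ∈ Icc t P.T), X r = W ⟨r, hr⟩)
    : ∃ Φ, P.IsFundamental t u X Φ := by
  have h : ∀ τ, ∃ M : ℝ → Euc n →L[ℝ] Euc n, τ ∈ Icc t P.T →
      SolvesODE (fun s M => P.bA u X s ∘L M) τ P.T τ (ContinuousLinearMap.id ℝ (Euc n)) M := by
    intro τ
    by_cases hτ : τ ∈ Icc t P.T
    · obtain ⟨M, hM⟩ := exists_fundamental hτ.2 ((sqInt_bA hT ht h3 hX (u := u)).mono hτ.1)
      exact ⟨M, fun _ => hM⟩
    · exact ⟨0, fun h => absurd h hτ⟩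
  choose M hM using h
  exact ⟨fun s τ => M τ s, hM⟩

end Trajectory

end AQProblem

namespace AQProblem

variable {n m : ℕ} {P : AQProblem n m} {t : ℝ}

/-- The Hessian is the Fredholm operator. The second costate is `Ξ†` applied to `costateFactor`,
with terminal value `G_xx(X(T)) ζ(T)`, and the kernel identity rewrites `𝐂 ζ + B† l` as the integral
of `𝐅`. -/
theorem hess_cost_ae_eq (hT : 0 < P.T) (h1 : P.H1) (h2 : P.H2) (h3 : P.H3) (ht : t ∈ Icc 0 P.T)
    (x : Euc n) (u : Control m t P.T) {X Y : ℝ → Euc n} {Φ : ℝ → ℝ → (Euc n →L[ℝ] Euc n)}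
    (hX : P.IsState t x u X) (hY : P.IsAdjointState t u X Y) (hΦ : P.IsFundamental t u X Φ)
    (v : Control m t P.T) :
    ∀ᵐ s ∂(volume : Measure ℝ).restrict (Icc t P.T),
      IntervalIntegrable (fun r => P.bF t u X Y Φ s r (v r)) volume t P.T ∧
      hess (P.cost t x) u v s =
        P.R s (X s) (v s) + ∫ r in t..P.T, P.bF t u X Y Φ s r (v r) := by
  have hab := ht.2
  have htt := left_mem_Icc.2 ht.2
  have hTT := right_mem_Icc.2 ht.2
  obtain ⟨Z, hZ, hZs, hZu⟩ := exists_solution hT ht h3 h1 x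
  have hXW := hZu u X hX
  set V : C(Icc t P.T, Euc n) := ⟨_, hY.continuousOn.domRestrict⟩ with hV
  have hYV : ∀ r (hr : r ∈ Icc t P.T), Y r = V ⟨r, hr⟩ := fun r hr => rfl
  have hA := sqInt_bA hT ht h3 hXW (u := u)
  have hC := sqInt_bC hT ht h3 hXW hYV (u := u)
  have hH := normIntegrable_bA₁ hT ht h3 hXW hYV (u := u)
  obtain ⟨Ξ, hΞ⟩ := exists_fundamentalPair hab hA (hΦ t htt)
  have hΦ' : ∀ τ ∈ Icc t P.T, ∀ s ∈ Icc τ P.T, Φ s τ = (fun s => Φ s t) s ∘L Ξ τ := fun τ hτ s hs =>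
    hΞ.eq_of_solvesODE hA hτ (hΦ τ hτ) hs
  set ζ : ℝ → Euc n := fun s => fderiv ℝ Z u v (projIcc t P.T ht.2 s) with hζdef
  obtain ⟨pζ, hζ0⟩ := isPrimitive_fderiv_solution hZ u v
  have hζ : IsPrimitive t P.T ζ (fun r => P.bA u X r (ζ r) + P.B r (X r) (v r)) := by
    refine pζ.congr (fun _ _ => rfl) hab ?_
    filter_upwards [ae_restrict_mem measurableSet_Icc] with r hr
    rw [bA_eq hT ht h3 hXW hr, hXW r hr, projIcc_of_mem ht.2 hr]
    simp only [hζdef, projIcc_of_mem ht.2 hr]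
    rfl
  have hζt : ζ t = 0 := by
    simp only [hζdef, projIcc_of_mem ht.2 htt]
    exact hζ0
  have pY : IsPrimitive t P.T (fun s => V (projIcc t P.T ht.2 s)) _ :=
    (IsPrimitive.of_solvesODE hTT hY).congr
      (fun s hs => by rw [projIcc_of_mem ht.2 hs]; rfl) hab (.of_forall fun _ => rfl)
  have hpY : ∀ᵐ r ∂(volume : Measure ℝ).restrict (Icc t P.T), ∀ e : Euc n, inner ℝ
      (-(((P.bA u X r)†) (Y r)) - gradient (P.Q r) (X r) - ((fderiv ℝ (P.S r) (X r))†) (u r)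
        - (1 / 2 : ℝ) • gradient (fun y => inner ℝ (P.R r y (u r)) (u r)) (X r)) e =
      -((hamilton₀ (coeffA hT ht h3) (coeffQ hT ht h3) V).deriv
          (projIcc t P.T ht.2 r, Z u (projIcc t P.T ht.2 r)) e
        + inner ℝ ((hamilton₁ (coeffB hT ht h3) (coeffS hT ht h3) V).deriv
          (projIcc t P.T ht.2 r, Z u (projIcc t P.T ht.2 r)) e) (u r)
        + 1 / 2 * inner ℝ ((coeffR hT ht h3).deriv
          (projIcc t P.T ht.2 r, Z u (projIcc t P.T ht.2 r)) e (u r)) (u r)) := by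
    filter_upwards [ae_restrict_mem measurableSet_Icc] with r hr
    intro e
    rw [adjointField_eq hT ht h3 hXW hr, hYV r hr, bA_eq hT ht h3 hXW hr,
      ← projIcc_of_mem ht.2 hr]
    exact (neg_inner_adjoint_drift ht.2 (coeffA hT ht h3) (coeffB hT ht h3) (coeffQ hT ht h3)
      (coeffS hT ht h3) (coeffR hT ht h3) V (u, Z u) r e).symm
  have hYT : ∀ e, inner ℝ (V ⟨P.T, hTT⟩) e = fderiv ℝ P.G (Z u ⟨P.T, hTT⟩) e := fun e => by
    rw [← hXW P.T hTT, ← inner_gradient_apply, ← hY.initial hTT]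
    rfl
  have hsym : ∀ s y u v, inner ℝ ((coeffR hT ht h3).fn (s, y) u) v =
      inner ℝ u ((coeffR hT ht h3).fn (s, y) v) := fun s y u v =>
    (h2.symmR s (Icc_subset_Icc_left ht.1 s.2) y).isSymmetric u v
  have hl := hΞ.isPrimitive_costate (G := hess P.G (X P.T)) hab hH hC (Lp.memLp v) hζ.continuousOn
  have hGd : DifferentiableAt ℝ (fderiv ℝ P.G) (X P.T) :=
    (h3.smoothG.fderiv_right (m := 1) (by norm_num)).differentiable (by norm_num) _
  have key := hess_bolza_ae_eq hZ h3.smoothG pY hpY hYT hsym v hl (by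
    filter_upwards [ae_restrict_mem measurableSet_Icc] with r hr
    intro e
    rw [inner_sub_left, inner_neg_left, inner_add_left,
      ContinuousLinearMap.adjoint_inner_left (P.bA u X r),
      ContinuousLinearMap.adjoint_inner_left (P.bC u X Y r), inner_bA₁ hT ht h3 hXW hYV hr,
      bC_eq hT ht h3 hXW hYV hr, bA_eq hT ht h3 hXW hr]
    ring) (fun e => by
    rw [hΞ.costate_right hab, inner_hess_apply hGd, hXW P.T hTT]
    simp only [hζdef, projIcc_of_mem ht.2 hTT])
  rw [cost_eq_bolza hT ht h3 hZs hZu]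
  filter_upwards [ae_restrict_mem measurableSet_Icc, key] with s hs hs'
  obtain ⟨i1, i2⟩ := hΞ.fredholmKernel_integral (B := fun s => P.B s (X s)) (G := hess P.G (X P.T))
    hab hH hC (Lp.memLp v) hΦ' hζ hζt hs
  refine ⟨i1, ?_⟩
  rw [hs']
  refine congrArg₂ (· + ·) ?_ ?_
  · rw [hXW s hs, projIcc_of_mem ht.2 hs]
    rfl
  · refine Eq.trans ?_ i2.symm
    rw [bC_eq hT ht h3 hXW hYV hs, hXW s hs, projIcc_of_mem ht.2 hs]
    simp only [hζdef, projIcc_of_mem ht.2 hs]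
    rfl

end AQProblem

/-! ### Invertibility criteria for bounded operators -/

section Invertible

variable {V W : Type*} [NormedAddCommGroup V] [NormedSpace ℝ V] [CompleteSpace V]
  [NormedAddCommGroup W] [NormedSpace ℝ W] [CompleteSpace W]

theorem ContinuousLinearMap.isInvertible_of_bijective {D : V →L[ℝ] W} (h : Function.Bijective D) :
    D.IsInvertible := by
  refine ⟨ContinuousLinearEquiv.ofBijective D (LinearMap.ker_eq_bot.2 h.1)
    (LinearMap.range_eq_top.2 h.2), ?_⟩
  ext1 v
  rfl

theorem isInvertible_of_coercive {U : Type*} [NormedAddCommGroup U] [InnerProductSpace ℝ U]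
    [FiniteDimensional ℝ U] [CompleteSpace U] {R : U →L[ℝ] U} {ρ : ℝ} (hρ : 0 < ρ)
    (h : ∀ u, ρ * ‖u‖ ^ 2 ≤ inner ℝ (R u) u) : R.IsInvertible := by
  have hi : Function.Injective R := by
    refine (injective_iff_map_eq_zero R).2 fun u hu => ?_
    have := h u
    rw [hu, inner_zero_left] at this
    have h2 : ‖u‖ ^ 2 ≤ 0 := nonpos_of_mul_nonpos_right this hρ
    exact norm_eq_zero.1 (pow_eq_zero_iff two_ne_zero |>.1 (le_antisymm h2 (sq_nonneg _)))
  exact ContinuousLinearMap.isInvertible_of_bijective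
    ⟨hi, (LinearMap.injective_iff_surjective (f := (R : U →ₗ[ℝ] U))).1 hi⟩

theorem continuous_inverse_comp {K : Type*} [TopologicalSpace K] {f : K → V →L[ℝ] W}
    (hf : Continuous f) (hi : ∀ s, (f s).IsInvertible) : Continuous fun s => (f s).inverse :=
  continuous_iff_continuousAt.2 fun s =>
    ((hi s).contDiffAt_map_inverse (n := 0)).continuousAt.comp hf.continuousAt

/-- A Neumann series: `S' D` is within `c < 1` of the identity, hence a unit, and `D` is this unit
followed by the bijection `S`. -/
theorem bijective_of_norm_sub_le {D : V →L[ℝ] W} {S : V →L[ℝ] W} {S' : W →L[ℝ] V} {c : ℝ}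
    (h1 : ∀ v, S' (S v) = v) (h2 : ∀ w, S (S' w) = w) (hc0 : 0 ≤ c) (hc : c < 1)
    (h : ∀ v, ‖S' (D v) - v‖ ≤ c * ‖v‖) : Function.Bijective D := by
  have hK : ‖ContinuousLinearMap.id ℝ V - S'.comp D‖ < 1 :=
    (ContinuousLinearMap.opNorm_le_bound _ hc0 fun v => by
      rw [sub_apply, norm_sub_rev]
      exact h v).trans_lt hc
  have hu : IsUnit (1 - (ContinuousLinearMap.id ℝ V - S'.comp D)) := (Units.oneSub _ hK).isUnit
  have hb : Function.Bijective (1 - (ContinuousLinearMap.id ℝ V - S'.comp D) : V →L[ℝ] V) :=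
    ContinuousLinearMap.isUnit_iff_bijective.1 hu
  have e : D = S ∘ (1 - (ContinuousLinearMap.id ℝ V - S'.comp D) : V →L[ℝ] V) := by
    funext v
    simp [h2]
  rw [e]
  exact (Function.bijective_iff_has_inverse.2 ⟨S', h1, h2⟩).comp hb

end Invertible

/-! ### Well-posedness of the Fredholm equation -/

namespace AQProblem

variable {n m : ℕ} {P : AQProblem n m} {t : ℝ}

/-- A solution map is a two-sided inverse of `D`; conversely the open mapping theorem supplies its
continuity. -/
theorem fredholmWellPosed_iff_bijective {u : Control m t P.T} {X Y : ℝ → Euc n}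
    {Φ : ℝ → ℝ → (Euc n →L[ℝ] Euc n)} {D : Control m t P.T →L[ℝ] Control m t P.T}
    (h : ∀ w v, P.SolvesFredholm t u X Y Φ w v ↔ D v = w) :
    P.FredholmWellPosed t u X Y Φ ↔ Function.Bijective D := by
  constructor
  · rintro ⟨sol, -, hsol⟩
    refine Function.bijective_iff_has_inverse.2 ⟨sol, fun v => ?_, fun w => ?_⟩
    · exact ((hsol (D v) v).1 ((h _ _).2 rfl)).symm
    · exact (h w (sol w)).1 ((hsol w (sol w)).2 rfl)
  · intro hD
    obtain ⟨e, he⟩ := ContinuousLinearMap.isInvertible_of_bijective hD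
    refine ⟨e.symm, e.symm.continuous, fun w v => ?_⟩
    rw [h, ← he, ContinuousLinearEquiv.eq_symm_apply]
    rfl

theorem solvesFredholm_iff (hT : 0 < P.T) (h1 : P.H1) (h2 : P.H2) (h3 : P.H3) (ht : t ∈ Icc 0 P.T)
    (x : Euc n) (u : Control m t P.T) {X Y : ℝ → Euc n} {Φ : ℝ → ℝ → (Euc n →L[ℝ] Euc n)}
    (hX : P.IsState t x u X) (hY : P.IsAdjointState t u X Y) (hΦ : P.IsFundamental t u X Φ)
    (w v : Control m t P.T) :
    P.SolvesFredholm t u X Y Φ w v ↔ hess (P.cost t x) u v = w := by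
  have key := hess_cost_ae_eq hT h1 h2 h3 ht x u hX hY hΦ v
  constructor
  · intro h
    apply Lp.ext
    filter_upwards [h, key] with s hs hs'
    rw [hs.2, hs'.2]
  · rintro rfl
    exact key

theorem isInvertible_R (h2 : P.H2) {s : ℝ} (hs : s ∈ Icc 0 P.T) (y : Euc n) :
    (P.R s y).IsInvertible := by
  obtain ⟨L, -, Q₀, -, G₀, -, S₀, -, ε₀, -, ρ₀, hρ₀, ρ, -, hρ, hb⟩ := h2.bounds
  exact isInvertible_of_coercive (hρ₀.trans_le (hρ y)) (hb s hs y).1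

/-- Multiplication by `R(s, X(s))` is invertible on `L²`, since the pointwise inverse is continuous
in `s` on a compact interval. After applying it, the Hessian is the identity plus an integral
operator of norm at most `c (T - t) < 1`. -/
theorem bijective_hess_cost (hT : 0 < P.T) (h1 : P.H1) (h2 : P.H2) (h3 : P.H3)
    (ht : t ∈ Icc 0 P.T) (x : Euc n) (u : Control m t P.T) {X Y : ℝ → Euc n}
    {Φ : ℝ → ℝ → (Euc n →L[ℝ] Euc n)}
    (hX : P.IsState t x u X) (hY : P.IsAdjointState t u X Y) (hΦ : P.IsFundamental t u X Φ)
    {α : ℝ} (hα : α < 1 / P.T)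
    (hF : ∀ᵐ s ∂(volume : Measure ℝ).restrict (Icc t P.T),
      ∀ᵐ r ∂(volume : Measure ℝ).restrict (Icc t P.T),
        ‖(P.R s (X s)).inverse ∘L P.bF t u X Y Φ s r‖ ≤ α) :
    Function.Bijective (hess (P.cost t x) u) := by
  have hab := ht.2
  obtain ⟨Z, hZ, hZs, hZu⟩ := exists_solution hT ht h3 h1 x
  have hXW := hZu u X hX
  have hinv : ∀ s : Icc t P.T, (P.R s (Z u s)).IsInvertible := fun s =>
    isInvertible_R h2 (Icc_subset_Icc_left ht.1 s.2) _
  set Rc : CMap (Icc t P.T) (Euc m →L[ℝ] Euc m) := (coeffR hT ht h3).fn.superpose (Z u) with hRc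
  set Ri : CMap (Icc t P.T) (Euc m →L[ℝ] Euc m) :=
    ⟨fun s => (P.R s (Z u s)).inverse, continuous_inverse_comp Rc.continuous hinv⟩ with hRi
  have hi1 : ∀ s e, Ri s (Rc s e) = e := fun s e => by
    obtain ⟨L, hL⟩ := hinv s
    change (P.R s (Z u s)).inverse (P.R s (Z u s) e) = e
    rw [← hL, ContinuousLinearMap.inverse_equiv]
    exact L.symm_apply_apply e
  have hi2 : ∀ s e, Rc s (Ri s e) = e := fun s e => by
    obtain ⟨L, hL⟩ := hinv s
    change P.R s (Z u s) ((P.R s (Z u s)).inverse e) = e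
    rw [← hL, ContinuousLinearMap.inverse_equiv]
    exact L.apply_symm_apply e
  have comp : ∀ M N : CMap (Icc t P.T) (Euc m →L[ℝ] Euc m), (∀ s e, M s (N s e) = e) →
      ∀ v : Control m t P.T, mulLp hab M (mulLp hab N v) = v := fun M N h v => by
    apply Lp.ext
    filter_upwards [coeFn_mulLp hab M (mulLp hab N v), coeFn_mulLp hab N v] with s hs hs'
    rw [hs, hs', h]
  -- A negative `α` is possible when `t = T`, as the kernel bound then holds vacuously.
  set c : ℝ := max α 0 with hc
  have hc0 : 0 ≤ c := le_max_right _ _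
  have hlen : 0 ≤ P.T - t := sub_nonneg.2 ht.2
  have hc1 : c * (P.T - t) < 1 := by
    have h1 : c < 1 / P.T := max_lt hα (by positivity)
    have h2 : c * P.T < 1 := by rwa [lt_div_iff₀ hT] at h1
    nlinarith [ht.1]
  refine bijective_of_norm_sub_le (S := mulLp hab Rc) (S' := mulLp hab Ri) (comp _ _ hi1)
    (comp _ _ hi2) (by positivity : 0 ≤ c * (P.T - t)) hc1 fun v => ?_
  have key := hess_cost_ae_eq hT h1 h2 h3 ht x u hX hY hΦ v
  have bound : ∀ᵐ s ∂(volume : Measure ℝ).restrict (Icc t P.T),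
      ‖(mulLp hab Ri (hess (P.cost t x) u v) - v) s‖ ≤ c * (√(P.T - t) * ‖v‖) := by
    filter_upwards [ae_restrict_mem measurableSet_Icc, key, hF,
      Lp.coeFn_sub (mulLp hab Ri (hess (P.cost t x) u v)) v,
      coeFn_mulLp hab Ri (hess (P.cost t x) u v)] with s hs hk hf e1 e2
    have e3 : Ri (projIcc t P.T hab s) = (P.R s (X s)).inverse := by
      rw [projIcc_of_mem hab hs, hXW s hs]
      rfl
    have e4 : (P.R s (X s)).inverse (P.R s (X s) (v s)) = v s := by
      rw [hXW s hs]
      exact hi1 ⟨s, hs⟩ (v s)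
    rw [e1, Pi.sub_apply, e2, hk.2, map_add, e3, e4, add_sub_cancel_left,
      ← clm_intervalIntegral _ hk.1]
    have hv := (Lp.intervalIntegrable hab v).norm.const_mul c
    refine (intervalIntegral.norm_integral_le_of_norm_le hab ?_ hv).trans ?_
    · have hf' := (ae_restrict_iff' measurableSet_Icc).1 hf
      filter_upwards [hf'] with r hr hr'
      refine (((P.R s (X s)).inverse ∘L P.bF t u X Y Φ s r).le_opNorm (v r)).trans ?_
      gcongr
      exact (hr ⟨hr'.1.le, hr'.2⟩).trans (le_max_left _ _)
    · rw [intervalIntegral.integral_const_mul]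
      gcongr
      have := integral_norm_le_sqrt_mul_norm hab v
      rwa [integral_Icc_eq_integral_Ioc, ← intervalIntegral.integral_of_le hab] at this
  -- One factor `√(T - t)` comes from Cauchy–Schwarz in `r`, the other from the `L²` norm in `s` of
  -- a bounded function.
  refine (Lp.norm_le_of_ae_bound (by positivity) bound).trans (le_of_eq ?_)
  have hm : (measureUnivNNReal ((volume : Measure ℝ).restrict (Icc t P.T)) : ℝ) = P.T - t := by
    change ((volume : Measure ℝ).restrict (Icc t P.T) univ).toReal = _
    rw [Measure.restrict_apply_univ, Real.volume_Icc, ENNReal.toReal_ofReal hlen]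
  rw [hm, ENNReal.toReal_ofNat, show (2 : ℝ)⁻¹ = 1 / 2 by norm_num, ← Real.sqrt_eq_rpow]
  linear_combination c * ‖v‖ * Real.mul_self_sqrt hlen

end AQProblem

theorem proposition5p1 {n m : ℕ} (P : AQProblem n m) (hT : 0 < P.T)
    (h1 : P.H1) (h2 : P.H2) (h3 : P.H3)
    (t : ℝ) (ht : t ∈ Set.Icc 0 P.T) (x : Euc n) (u : Control m t P.T) :
    -- the objects in the claim exist
    (Differentiable ℝ (P.cost t x) ∧ DifferentiableAt ℝ (gradient (P.cost t x)) u ∧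
      ∃ X Y Φ, P.IsState t x u X ∧ P.IsAdjointState t u X Y ∧ P.IsFundamental t u X Φ) ∧
    ∀ X Y Φ, P.IsState t x u X → P.IsAdjointState t u X Y → P.IsFundamental t u X Φ →
      ((hess (P.cost t x) u).IsInvertible ↔ P.FredholmWellPosed t u X Y Φ) ∧
      ∀ α : ℝ, α < 1 / P.T →
        (∀ᵐ s ∂((MeasureTheory.volume : MeasureTheory.Measure ℝ).restrict (Set.Icc t P.T)),
          ∀ᵐ r ∂((MeasureTheory.volume : MeasureTheory.Measure ℝ).restrict (Set.Icc t P.T)),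
            ‖(P.R s (X s)).inverse ∘L P.bF t u X Y Φ s r‖ ≤ α) →
        P.FredholmWellPosed t u X Y Φ ∧ (hess (P.cost t x) u).IsInvertible := by
  obtain ⟨Z, hZ, hZs, hZu⟩ := AQProblem.exists_solution hT ht h3 h1 x
  have hcd : ContDiff ℝ 2 (P.cost t x) := by
    rw [AQProblem.cost_eq_bolza hT ht h3 hZs hZu]
    exact (contDiff_bolza h3.smoothG).comp (contDiff_id.prodMk (contDiff_solution hZ))
  refine ⟨⟨hcd.differentiable (by norm_num), ?_, ?_⟩, ?_⟩
  · exact (hasFDerivAt_gradient ((hcd.fderiv_right (m := 1) (by norm_num)).differentiable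
      (by norm_num) u)).differentiableAt
  · have hX := hZu u _ (hZs u)
    obtain ⟨Y, hY⟩ := AQProblem.exists_isAdjointState hT ht h3 hX (u := u)
    obtain ⟨Φ, hΦ⟩ := AQProblem.exists_isFundamental hT ht h3 hX (u := u)
    exact ⟨_, Y, Φ, hZs u, hY, hΦ⟩
  · intro X Y Φ hX hY hΦ
    have hiff := AQProblem.fredholmWellPosed_iff_bijective
      (AQProblem.solvesFredholm_iff hT h1 h2 h3 ht x u hX hY hΦ)
    refine ⟨?_, fun α hα hF => ?_⟩
    · rw [hiff]
      refine ⟨?_, ContinuousLinearMap.isInvertible_of_bijective⟩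
      rintro ⟨e, he⟩
      rw [← he]
      exact e.bijective
    · have hb := AQProblem.bijective_hess_cost hT h1 h2 h3 ht x u hX hY hΦ hα hF
      exact ⟨hiff.2 hb, ContinuousLinearMap.isInvertible_of_bijective hb⟩
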